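/- Let $w_1,\dots,w_N$ be positive integers with $\gcd(w_1,\dots,w_N)=1$, put $d=w_1+\cdots+w_N$, and assume $w_j\mid d$ for all $j$. Put $q_j=w_j/d$, $\zeta=e^{2\pi\mathrm i/d}$, $v_c=d^{-d}\prod_j w_j^{w_j}$. Let $\langle x\rangle$ be the fractional part of $x$, let $\mathfrak F=\{0\le f<1: fw_j\in\mathbb Z\text{ for some }j\}$, and for $f\in\mathfrak F$ let $\overline f=\langle 1-f\rangle$ and $N_f=\#\{j: fw_j\in\mathbb Z\}$. Let $$H_{\mathrm{ext}}=\bigoplus_{k=1}^{d}\mathbb C\,\phi_{k-1},\qquad H_{\mathrm{CR}}(\mathbb P(\underline w))=\bigoplus_{f\in\mathfrak F}H^*(\mathbb P(\underline w)_f;\mathbb C),\qquad H^*(\mathbb P(\underline w)_f;\mathbb C)=\mathbb C[p]/(p^{N_f})\cdot\mathbf 1_f ,$$ where $p$ is the hyperplane class and the index of $\phi_{k-1}$ is read modulo $d$; a holomorphic function of $p$ near $p=0$ stands for its Taylor series evaluated at the nilpotent class $p$. Let $\lambda,z\in\mathbb C$, $z\ne0$, and assume $\xi:=\lambda/z\notin\mathbb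 Z$. With $\log u=-\frac1d\log v$, consider the functions of $\log v$ $$\mathcal H^{\mathrm{tw}}_{\mathrm{GW}}=z\,e^{\frac{p}{2\pi\mathrm i}\log v}\sum_{\substack{n\in\mathbb Q_{\ge0}\\ \exists j:\,nw_j\in\mathbb Z}}v^n\,\frac{\Gamma\left(1+d\frac{p}{2\pi\mathrm i}+\xi+dn\right)}{\prod_{j=1}^N\Gamma\left(1+w_j\frac{p}{2\pi\mathrm i}+w_jn\right)}\,\mathbf 1_{\langle-n\rangle},$$ $$\mathcal H^{\mathrm{tw}}_{\mathrm{FJRW}}=z\sum_{k\ge1}u^k\,\frac{(-1)^{k-1}(2\pi\mathrm i)}{\Gamma(k)\prod_{j:kq_j\in\mathbb Z}(-q_j\xi)\prod_{j=1}^N\Gamma(1-q_j(k+\xi))}\,\phi_{k-1}.$$ These series converge for $\operatorname{Re}\log v<\log v_c$ and for $\operatorname{Re}\log u<-\frac1d\log v_c$ (that is, $\operatorname{Re}\log v>\log v_c$), respectively. For $l\in\mathbb Z$ define a linear map $\mathbb U_l^{\mathrm{tw}}:H_{\mathrm{ext}}\to H_{\mathrm{CR}}(\mathbb P(\underline w))$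 by $$\mathbb U^{\mathrm{tw}}_l(\phi_{k-1})=\frac1d\sum_{f\in\mathfrak F}\mathbf 1_f\,\frac{\left(\zeta^ke^{p+2\pi\mathrm i(\overline f+\xi/d)}\right)^l}{\zeta^ke^{p+2\pi\mathrm i(\overline f+\xi/d)}-1}\prod_{j:kq_j\in\mathbb Z}(-q_j\xi),\qquad k=1,\dots,d.$$ Let $\gamma_l$ be any path in the $(\log v)$-plane from a point with $\operatorname{Re}\log v<\log v_c$ to a point with $\operatorname{Re}\log v>\log v_c$ that meets the line $\operatorname{Re}\log v=\log v_c$ only in the open window between $\log v_c+2(l-1)\pi\mathrm i$ and $\log v_c+2l\pi\mathrm i$. Then $\mathcal H^{\mathrm{tw}}_{\mathrm{GW}}$ can be continued analytically along $\gamma_l$, and its continuation satisfies, near the endpoint of $\gamma_l$, $$u^{-\xi}\,(\mathcal H^{\mathrm{tw}}_{\mathrm{GW}})_{\mathrm{continued}}=\mathbb U^{\mathrm{tw}}_l\left(\mathcal H^{\mathrm{tw}}_{\mathrm{FJRW}}\right),\qquad u^{-\xi}:=e^{-\xi\log u}.$$ -/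

import Mathlib

open Complex Filter Topology

noncomputable section

namespace LGCY

variable {N : ℕ}

/-- The degree `d = w₁ + ⋯ + w_N` (Calabi-Yau condition). -/
def deg (w : Fin N → ℕ) : ℕ := ∑ j, w j

/-- The charges `q_j = w_j / d`. -/
def charge (w : Fin N → ℕ) (j : Fin N) : ℚ := (w j : ℚ) / (deg w : ℚ)

/-- `v_c = d^{-d} ∏_j w_j^{w_j}`, the singular point of the Picard-Fuchs equation. -/
def vc (w : Fin N → ℕ) : ℝ := ((deg w : ℝ) ^ deg w)⁻¹ * ∏ j, (w j : ℝ) ^ w j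

/-! ### State spaces -/

/-- The index set `𝔉 = {0 ≤ f < 1 | f w_j ∈ ℤ for some j}` of the sectors of the inertia stack of
`ℙ(w)`, listed as the fractions `m / w_j` with `0 ≤ m < w_j`. -/
def sectors (w : Fin N → ℕ) : Finset ℚ :=
  Finset.univ.biUnion fun j => (Finset.range (w j)).image fun m : ℕ => (m : ℚ) / (w j : ℚ)

theorem mem_sectors {w : Fin N → ℕ} (hw : ∀ j, 0 < w j) {f : ℚ} :
    f ∈ sectors w ↔ 0 ≤ f ∧ f < 1 ∧ ∃ j, ∃ m : ℤ, f * w j = m := by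
  simp only [sectors, Finset.mem_biUnion, Finset.mem_univ, true_and, Finset.mem_image,
    Finset.mem_range]
  constructor
  · rintro ⟨j, m, hm, rfl⟩
    have h : (0 : ℚ) < w j := by exact_mod_cast hw j
    refine ⟨by positivity, ?_, j, m, ?_⟩
    · rw [div_lt_one h]
      exact_mod_cast hm
    · push_cast
      field_simp
  · rintro ⟨h0, h1, j, m, hm⟩
    have h : (0 : ℚ) < w j := by exact_mod_cast hw j
    have hm0 : (0 : ℚ) ≤ m := by rw [← hm]; positivity
    have hm0' : 0 ≤ m := by exact_mod_cast hm0
    have hm1 : (m : ℚ) < w j := by rw [← hm]; nlinarith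
    have hm1' : m < w j := by exact_mod_cast hm1
    obtain ⟨a, rfl⟩ := Int.eq_ofNat_of_zero_le hm0'
    refine ⟨j, a, by exact_mod_cast hm1', ?_⟩
    rw [div_eq_iff h.ne', hm]
    simp

/-- `N_f = #{j | f w_j ∈ ℤ} = 1 + dim ℙ(w)_f`. -/
def sectorRank (w : Fin N → ℕ) (f : ℚ) : ℕ :=
  (Finset.univ.filter fun j => (f * (w j : ℚ)).isInt).card

/-- `ℂ[p] / (p ^ n)`, the cohomology ring with complex coefficients of an `(n - 1)`-dimensional
weighted projective stack, with `p = c₁(𝒪(1))`. -/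
abbrev ProjCohomology (n : ℕ) : Type := AdjoinRoot (Polynomial.X ^ n : Polynomial ℂ)

/-- The coordinates with respect to the basis `1, p, …, p ^ (n - 1)`. -/
def ProjCohomology.coords (n : ℕ) :
    ProjCohomology n ≃ₗ[ℂ]
      (Fin (AdjoinRoot.powerBasis' (Polynomial.monic_X_pow (R := ℂ) n)).dim → ℂ) :=
  (AdjoinRoot.powerBasis' (Polynomial.monic_X_pow (R := ℂ) n)).basis.equivFun

/-- The supremum norm of the coordinates; it only serves to fix the usual topology of this
finite-dimensional complex vector space. -/
instance (n : ℕ) : NormedAddCommGroup (ProjCohomology n) :=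
  NormedAddCommGroup.induced _ _ (ProjCohomology.coords n).toLinearMap
    (ProjCohomology.coords n).injective

instance (n : ℕ) : NormedSpace ℂ (ProjCohomology n) :=
  NormedSpace.induced ℂ _ _ (ProjCohomology.coords n).toLinearMap

/-- `H_CR(ℙ(w)) = ⨁_{f ∈ 𝔉} H(ℙ(w)_f; ℂ)`; the product is the cup product on each sector. -/
abbrev HCR (w : Fin N → ℕ) : Type := (f : sectors w) → ProjCohomology (sectorRank w f)

/-- The identity class `𝟏_f` of the sector `ℙ(w)_f`. -/
def unitClass (w : Fin N → ℕ) (f : ℚ) : HCR w := fun f' => if (f' : ℚ) = f then 1 else 0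

/-- The class `g(p)` in `H_CR(ℙ(w))` for a function `g` that is holomorphic at `0`: the Taylor
series of `g` at `0`, evaluated at the (nilpotent) hyperplane class `p` on each sector. -/
def ofHyperplane (w : Fin N → ℕ) (g : ℂ → ℂ) : HCR w := fun f =>
  ∑ i ∈ Finset.range (sectorRank w f),
    (iteratedDeriv i g 0 / (i.factorial : ℂ)) •
      (AdjoinRoot.root (Polynomial.X ^ sectorRank w f : Polynomial ℂ)) ^ i

/-- The extended narrow state space `H_ext = ⨁_{k = 1}^{d} ℂ φ_{k-1}`. -/
abbrev Hext (w : Fin N → ℕ) : Type := Fin (deg w) → ℂ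

/-- The basis vector `φ_m`, the index `m` being reduced modulo `d` to `{0, …, d - 1}`. -/
def phi (w : Fin N → ℕ) (m : ℕ) : Hext w := fun i => if (i : ℕ) = m % deg w then 1 else 0

/-! ### The `H`-functions, as functions of `log v` and of `log u` -/

/-- The exponents `n ∈ ℚ_{≥ 0}` with `n w_j ∈ ℤ` for some `j`. -/
abbrev GWIndex (w : Fin N → ℕ) : Type :=
  {n : ℚ // 0 ≤ n ∧ ∃ j, (n * (w j : ℚ)).isInt}

/-- The summand
`e^{p log v / 2πi} v^n Γ(1 + d p/2πi + ξ + d n) / ∏_j Γ(1 + w_j p/2πi + w_j n) 𝟏_{⟨-n⟩}`. -/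
def gwTerm (w : Fin N → ℕ) (ξ logv : ℂ) (n : GWIndex w) : HCR w :=
  ofHyperplane w (fun p =>
      exp (p / (2 * Real.pi * I) * logv) * exp (((n : ℚ) : ℂ) * logv) *
        (Gamma (1 + deg w * (p / (2 * Real.pi * I)) + ξ + deg w * ((n : ℚ) : ℂ)) /
          ∏ j, Gamma (1 + w j * (p / (2 * Real.pi * I)) + w j * ((n : ℚ) : ℂ)))) *
    unitClass w (Int.fract (-(n : ℚ)))

/-- The twisted `H`-function of GW theory, with `ξ = lam / z`. -/
def hGW (w : Fin N → ℕ) (z lam logv : ℂ) : HCR w :=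
  z • ∑' n : GWIndex w, gwTerm w (lam / z) logv n

/-- `∏_{j : k q_j ∈ ℤ} (-q_j ξ)`. -/
def broadFactor (w : Fin N → ℕ) (ξ : ℂ) (k : ℕ) : ℂ :=
  ∏ j with ((k : ℚ) * charge w j).isInt, (-(charge w j : ℂ) * ξ)

/-- The summand `u^k (-1)^{k-1} (2πi) / (Γ(k) ∏_{j : k q_j ∈ ℤ} (-q_j ξ) ∏_j Γ(1 - q_j (k + ξ)))
φ_{k-1}`. -/
def fjrwTerm (w : Fin N → ℕ) (ξ logu : ℂ) (k : ℕ+) : Hext w :=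
  (exp ((k : ℕ) * logu) * ((-1) ^ ((k : ℕ) - 1) * (2 * Real.pi * I) /
      (Gamma (k : ℕ) * broadFactor w ξ k *
        ∏ j, Gamma (1 - (charge w j : ℂ) * ((k : ℕ) + ξ))))) •
    phi w ((k : ℕ) - 1)

/-- The twisted `H`-function of FJRW theory, with `ξ = lam / z`. -/
def hFJRW (w : Fin N → ℕ) (z lam logu : ℂ) : Hext w :=
  z • ∑' k : ℕ+, fjrwTerm w (lam / z) logu k

/-! ### The connection map -/

/-- `ζ^k e^{p + 2πi (f̄ + ξ/d)}` with `ζ = e^{2πi/d}` and `f̄ = ⟨1 - f⟩`. -/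
def windowExp (w : Fin N → ℕ) (ξ : ℂ) (k : ℕ) (f : ℚ) (p : ℂ) : ℂ :=
  exp (2 * Real.pi * I / deg w) ^ k *
    exp (p + 2 * Real.pi * I * ((Int.fract (1 - f) : ℚ) + ξ / deg w))

/-- The value `𝕌_l^tw (φ_{k-1})`, for `k = 1, …, d`. -/
def connectionValue (w : Fin N → ℕ) (l : ℤ) (ξ : ℂ) (k : ℕ) : HCR w :=
  (1 / (deg w : ℂ)) • ∑ f ∈ sectors w,
    broadFactor w ξ k •
      (unitClass w f *
        ofHyperplane w fun p => windowExp w ξ k f p ^ l / (windowExp w ξ k f p - 1))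

/-- The linear map `𝕌_l^tw : H_ext → H_CR(ℙ(w))`. -/
def connectionMap (w : Fin N → ℕ) (l : ℤ) (ξ : ℂ) : Hext w →ₗ[ℂ] HCR w :=
  (Pi.basisFun ℂ (Fin (deg w))).constr ℂ fun i => connectionValue w l ξ ((i : ℕ) + 1)

/-! ### Analytic continuation -/

/-- `γ` is a path in the `log v`-plane from the half-plane `Re log v < log v_c` to the half-plane
`Re log v > log v_c` that meets the line `Re log v = log v_c` only in the `l`-th window, between
the singular points `log v_c + 2(l-1)πi` and `log v_c + 2lπi`. -/
structure IsWindowPath (w : Fin N → ℕ) (l : ℤ) {a b : ℂ} (γ : Path a b) : Prop where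
  source_re : a.re < Real.log (vc w)
  target_re : Real.log (vc w) < b.re
  window : ∀ s, (γ s).re = Real.log (vc w) →
    2 * ((l : ℝ) - 1) * Real.pi < (γ s).im ∧ (γ s).im < 2 * (l : ℝ) * Real.pi

/-- `Φ` is an analytic continuation along `γ` of the germ of `F` at the source of `γ`: each `Φ s`
is analytic at `γ s`, and for `s'` near `s` the functions `Φ s'` and `Φ s` agree near `γ s'`. -/
structure IsContinuationAlong {V : Type*} [NormedAddCommGroup V] [NormedSpace ℂ V] {a b : ℂ}
    (γ : Path a b) (F : ℂ → V) (Φ : unitInterval → ℂ → V) : Prop where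
  analyticAt : ∀ s, AnalyticAt ℂ (Φ s) (γ s)
  compatible : ∀ s, ∀ᶠ s' in 𝓝 s, Φ s' =ᶠ[𝓝 (γ s')] Φ s
  start : Φ 0 =ᶠ[𝓝 a] F

end LGCY

end

/-!
The proof is a Mellin-Barnes argument. Both `H`-functions are residue sums of one integrand,
`v^s Γ(1 + ξ + d s) / ∏_j Γ(1 + w_j s)` times the periodic kernel `-W^l / (W - 1)` with
`W = e^{2πi(c - s)}` and `c = p / 2πi + f̄`, over a vertical line. The poles of the kernel on the
right of the line give the Gromov-Witten series of the sector of `f`, up to finitely many summands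
that are added separately (`tendsto_sum_gammaTerm`). The poles `s_k = -(ξ + k) / d` of the
numerator, all on its left, give the FJRW series, and the kernel, which by periodicity depends
only on `k` modulo `d`, contributes the entries of the connection map (`tendsto_sum_gammaRes`,
`fjrwTerm_apply`, `connectionValue_apply`). The remaining residues on the left, at
`c - 1, c - 2, …`, vanish modulo `p ^ N_f`, because each of the `N_f` factors `1 / Γ(1 + w_j s)`
with `f w_j ∈ ℤ` vanishes there at `p = 0` (`jet_gammaTerm_left_eq_zero`).

Stirling's formula is not needed. The Gamma ratio satisfies a first order difference equation
whose coefficient tends to `1 / v_c` at infinity (`tendsto_stepDen_div_stepNum`). For `|v| < v_c`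
each shift of the line to the right therefore contracts the integral, and for `|v| > v_c` each
shift to the left does, so a bound on a single vertical strip is enough to close the contour
(`tendsto_sum_residues`). That bound, `e^{δ|Im s|}` for every `δ > 0`, follows from comparing `Γ`
at points with the same imaginary part, by the triangle inequality for the Beta integral, with its
values on a line, which the reflection formula gives (`exists_norm_gammaRatio_le`). The product of
`v^s` and the kernel decays exponentially in both directions when `Im log v` is in the `l`-th
window, so there the integral converges and is holomorphic in `log v`
(`differentiableOn_jet_mbSum`).

All of this is done with `p` a complex number in a small disc. The passage to the nilpotent class
`p` is made by writing Taylor coefficients as Cauchy integrals over a circle (`jet`), which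
commute with the series and with the integral.

In the window the three functions (Gromov-Witten series, Mellin-Barnes integral, image of the FJRW
series) coincide where they are defined. Together they define a function that is analytic at every
point of a path as in the theorem (`analyticAt_gluedBranch`); any other continuation agrees with
it by the identity theorem (`IsContinuationAlong.eventuallyEq`).
-/

noncomputable section

namespace LGCY

open MeasureTheory Set

variable {N : ℕ}

/-! ### Contour integrals over vertical lines -/

/-- A function on the line that decays exponentially outside a bounded interval and is continuous
decays exponentially everywhere. -/
theorem exists_exp_decay_of_continuous {h : ℝ → ℂ} (hc : Continuous h) {C T ε : ℝ}
    (hd : ∀ τ, T ≤ |τ| → ‖h τ‖ ≤ C * Real.exp (-ε * |τ|)) :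
    ∃ C', ∀ τ, ‖h τ‖ ≤ C' * Real.exp (-ε * |τ|) := by
  have hc' : Continuous fun τ => ‖h τ‖ * Real.exp (ε * |τ|) := by fun_prop
  obtain ⟨B, hB⟩ := (isCompact_Icc (a := -T) (b := T)).bddAbove_image hc'.continuousOn
  refine ⟨max B C, fun τ => ?_⟩
  by_cases hτ : T ≤ |τ|
  · exact (hd τ hτ).trans (by gcongr; exact le_max_right _ _)
  · have h1 : τ ∈ Icc (-T) T := abs_le.1 (not_le.1 hτ).le
    have h2 := hB (mem_image_of_mem _ h1)
    have h3 : ‖h τ‖ = ‖h τ‖ * Real.exp (ε * |τ|) * Real.exp (-ε * |τ|) := by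
      rw [mul_assoc, ← Real.exp_add]; simp
    rw [h3]
    gcongr
    exact h2.trans (le_max_left _ _)

theorem integrable_exp_neg_mul_abs {ε : ℝ} (hε : 0 < ε) :
    Integrable fun τ : ℝ => Real.exp (-ε * |τ|) := by
  rw [← integrableOn_univ, ← Iic_union_Ioi (a := (0 : ℝ))]
  refine IntegrableOn.union ?_ ?_
  · refine (integrableOn_exp_mul_Iic hε 0).congr_fun (fun x hx => ?_) measurableSet_Iic
    simp [abs_of_nonpos (mem_Iic.1 hx)]
  · refine (integrableOn_exp_mul_Ioi (neg_lt_zero.2 hε) 0).congr_fun (fun x hx => ?_)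
      measurableSet_Ioi
    simp [abs_of_pos (mem_Ioi.1 hx)]

theorem integrable_of_exp_decay {h : ℝ → ℂ} (hc : Continuous h) {C T ε : ℝ} (hε : 0 < ε)
    (hd : ∀ τ, T ≤ |τ| → ‖h τ‖ ≤ C * Real.exp (-ε * |τ|)) : Integrable h := by
  obtain ⟨C', hC'⟩ := exists_exp_decay_of_continuous hc hd
  exact ((integrable_exp_neg_mul_abs hε).const_mul C').mono' hc.aestronglyMeasurable
    (Eventually.of_forall hC')

theorem continuous_verticalLine {f : ℂ → ℂ} {σ : ℝ}
    (hf : ∀ s : ℂ, s.re = σ → ContinuousAt f s) : Continuous fun τ : ℝ => f (σ + τ * I) := by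
  rw [continuous_iff_continuousAt]
  intro τ
  exact ContinuousAt.comp (f := fun τ : ℝ => (σ : ℂ) + τ * I) (hf _ (by simp)) (by fun_prop)

/-- Cauchy's theorem for a vertical strip. -/
theorem integral_verticalLine_eq {f : ℂ → ℂ} {a b C T ε : ℝ} (hab : a ≤ b) (hε : 0 < ε)
    (hd : ∀ s : ℂ, a ≤ s.re → s.re ≤ b → DifferentiableAt ℂ f s)
    (hb : ∀ s : ℂ, a ≤ s.re → s.re ≤ b → T ≤ |s.im| → ‖f s‖ ≤ C * Real.exp (-ε * |s.im|)) :
    ∫ τ : ℝ, f (b + τ * I) = ∫ τ : ℝ, f (a + τ * I) := by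
  have hint : ∀ σ, a ≤ σ → σ ≤ b → Integrable fun τ : ℝ => f (σ + τ * I) := fun σ h1 h2 =>
    integrable_of_exp_decay (T := T) (C := C)
      (continuous_verticalLine fun s hs => (hd s (hs ▸ h1) (hs ▸ h2)).continuousAt) hε
      fun τ hτ => by simpa using hb (σ + τ * I) (by simpa) (by simpa) (by simpa)
  have key : ∀ R : ℝ, I • (∫ y : ℝ in (-R)..R, f (b + y * I)) -
      I • (∫ y : ℝ in (-R)..R, f (a + y * I)) =
      (∫ x : ℝ in a..b, f (x + R * I)) - ∫ x : ℝ in a..b, f (x + (-R : ℝ) * I) := by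
    intro R
    have := integral_boundary_rect_eq_zero_of_differentiableOn f (a + (-R : ℝ) * I) (b + R * I)
      (fun s hs => by
        have h1 := hs.1
        simp [uIcc_of_le hab] at h1
        exact (hd s h1.1 h1.2).differentiableWithinAt)
    simp at this
    push_cast
    simp only [neg_mul, smul_eq_mul]
    linear_combination this
  have hz : ∀ e : ℝ, |e| = 1 →
      Tendsto (fun R : ℝ => ∫ x : ℝ in a..b, f (x + (e * R : ℝ) * I)) atTop (𝓝 0) := by
    intro e he
    have hlim : Tendsto (fun R : ℝ => C * Real.exp (-ε * R) * |b - a|) atTop (𝓝 0) := by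
      have : Tendsto (fun R : ℝ => -ε * R) atTop atBot :=
        tendsto_id.const_mul_atTop_of_neg (neg_lt_zero.2 hε)
      simpa using ((Real.tendsto_exp_atBot.comp this).const_mul C).mul_const |b - a|
    refine squeeze_zero_norm' ?_ hlim
    filter_upwards [eventually_ge_atTop (max T 0)] with R hR
    have hR0 : 0 ≤ R := (le_max_right _ _).trans hR
    have hab' : |e * R| = R := by rw [abs_mul, he, one_mul, abs_of_nonneg hR0]
    refine intervalIntegral.norm_integral_le_of_norm_le_const fun x hx => ?_
    rw [uIoc_of_le hab] at hx
    have := hb (x + (e * R : ℝ) * I) (by simpa using hx.1.le) (by simpa using hx.2)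
      (by
        have him : ((x : ℂ) + (e * R : ℝ) * I).im = e * R := by simp
        rw [him, hab']
        exact (le_max_left _ _).trans hR)
    have him : ((x : ℂ) + (e * R : ℝ) * I).im = e * R := by simp
    rwa [him, hab'] at this
  have hv : ∀ σ, a ≤ σ → σ ≤ b →
      Tendsto (fun R : ℝ => ∫ y : ℝ in (-R)..R, f (σ + y * I)) atTop
        (𝓝 (∫ τ : ℝ, f (σ + τ * I))) := fun σ h1 h2 =>
    intervalIntegral_tendsto_integral (hint σ h1 h2) tendsto_neg_atTop_atBot tendsto_id
  have h1 := ((hv b hab le_rfl).const_smul I).sub ((hv a le_rfl hab).const_smul I)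
  have h2 := (hz 1 (by simp)).sub (hz (-1) (by simp))
  have h3 := tendsto_nhds_unique h1 (h2.congr fun R => by
    rw [key R]; simp)
  rw [sub_zero, ← smul_sub, smul_eq_zero] at h3
  exact sub_eq_zero.1 (h3.resolve_left I_ne_zero)

/-! ### The cosecant kernel -/

theorem abs_sinh_im_le_norm_sin (z : ℂ) : |Real.sinh z.im| ≤ ‖sin z‖ := by
  have h : sin z = (exp (-z * I) - exp (z * I)) * I / 2 := rfl
  have h1 : ‖exp (-z * I)‖ = Real.exp z.im := by rw [norm_exp]; simp
  have h2 : ‖exp (z * I)‖ = Real.exp (-z.im) := by rw [norm_exp]; simp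
  have h3 := abs_norm_sub_norm_le (exp (-z * I)) (exp (z * I))
  rw [h1, h2] at h3
  rw [h, Real.sinh_eq, norm_div, norm_mul, norm_I, mul_one, abs_div]
  simp only [Complex.norm_ofNat, abs_two]
  gcongr

theorem exp_div_four_le_sinh {x : ℝ} (hx : 1 ≤ x) : Real.exp x / 4 ≤ Real.sinh x := by
  rw [Real.sinh_eq]
  have h1 : Real.exp (-x) ≤ 1 := Real.exp_le_one_iff.2 (by linarith)
  have h2 : x + 1 ≤ Real.exp x := Real.add_one_le_exp x
  linarith

/-- The kernel `π / sin (π s)`. -/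
def cosec (s : ℂ) : ℂ := Real.pi / sin (Real.pi * s)

theorem norm_cosec_le {s : ℂ} (hs : 1 ≤ |s.im|) :
    ‖cosec s‖ ≤ 4 * Real.pi * Real.exp (-1 * |s.im|) := by
  have hpi : (1 : ℝ) ≤ Real.pi := by linarith [Real.pi_gt_three]
  have h1 := abs_sinh_im_le_norm_sin (Real.pi * s)
  have him : ((Real.pi : ℂ) * s).im = Real.pi * s.im := by simp
  have h4 : |s.im| ≤ Real.pi * |s.im| := by nlinarith [abs_nonneg s.im]
  rw [him, Real.abs_sinh, abs_mul, abs_of_pos Real.pi_pos] at h1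
  have h2 := exp_div_four_le_sinh (hs.trans h4)
  have h3 : Real.exp |s.im| ≤ Real.exp (Real.pi * |s.im|) := Real.exp_le_exp.2 h4
  rw [cosec, norm_div, norm_real, Real.norm_of_nonneg Real.pi_pos.le, neg_one_mul, Real.exp_neg,
    div_le_iff₀ (by linarith [Real.exp_pos |s.im|]), mul_assoc, mul_assoc]
  have h5 := Real.exp_pos |s.im|
  have : 1 ≤ 4 * ((Real.exp |s.im|)⁻¹ * ‖sin (Real.pi * s)‖) := by
    rw [← mul_assoc, mul_comm 4, mul_assoc, ← div_eq_inv_mul, le_div_iff₀ h5]; linarith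
  nlinarith [Real.pi_pos]

theorem sin_pi_mul_ne_zero {s : ℂ} (h1 : -1 < s.re) (h2 : s.re < 1) (h0 : s ≠ 0) :
    sin (Real.pi * s) ≠ 0 := by
  rw [Ne, sin_eq_zero_iff]
  rintro ⟨k, hk⟩
  have hpi : (Real.pi : ℂ) ≠ 0 := by exact_mod_cast Real.pi_ne_zero
  have hs : s = k := by rw [mul_comm] at hk; exact mul_right_cancel₀ hpi hk
  rw [hs, intCast_re] at h1 h2
  have h3 : -1 < k := by exact_mod_cast h1
  have h4 : k < 1 := by exact_mod_cast h2
  exact h0 (by rw [hs, show k = 0 by omega]; simp)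

theorem differentiableAt_cosec {s : ℂ} (h1 : -1 < s.re) (h2 : s.re < 1) (h0 : s ≠ 0) :
    DifferentiableAt ℂ cosec s := by
  unfold cosec
  exact (differentiableAt_const _).div (by fun_prop) (sin_pi_mul_ne_zero h1 h2 h0)

theorem tendsto_mul_cosec : Tendsto (fun s : ℂ => s * cosec s) (𝓝[≠] 0) (𝓝 1) := by
  have hd : HasDerivAt (fun s : ℂ => sin (Real.pi * s)) (Real.pi : ℂ) 0 := by
    have := ((hasDerivAt_id' (0 : ℂ)).const_mul (Real.pi : ℂ)).csin
    simpa using this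
  have h := hd.tendsto_slope
  have hpi : (Real.pi : ℂ) ≠ 0 := by exact_mod_cast Real.pi_ne_zero
  have h' := (h.inv₀ hpi).const_mul (Real.pi : ℂ)
  rw [mul_inv_cancel₀ hpi] at h'
  refine h'.congr' ?_
  filter_upwards with s
  simp [slope_def_field, cosec]
  ring

theorem cosec_sub_one (s : ℂ) : cosec (s - 1) = -cosec s := by
  rw [cosec, cosec, mul_sub, mul_one, sin_sub_pi, div_neg]

theorem integral_cosec_half : ∫ τ : ℝ, cosec ((1 / 2 : ℝ) + τ * I) = Real.pi := by
  have hval : ∀ τ : ℝ, cosec ((1 / 2 : ℝ) + τ * I) =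
      ((Real.pi / Real.cosh (Real.pi * τ) : ℝ) : ℂ) := by
    intro τ
    rw [cosec]
    have : (Real.pi : ℂ) * ((1 / 2 : ℝ) + τ * I) = (Real.pi * τ : ℂ) * I + Real.pi / 2 := by
      push_cast; ring
    rw [this, sin_add_pi_div_two, cos_mul_I]
    push_cast
    rfl
  have hc : Continuous fun τ : ℝ => cosec ((1 / 2 : ℝ) + τ * I) :=
    continuous_verticalLine fun s hs => (differentiableAt_cosec (by rw [hs]; norm_num)
      (by rw [hs]; norm_num) (by rintro rfl; simp at hs)).continuousAt
  have hint : Integrable fun τ : ℝ => cosec ((1 / 2 : ℝ) + τ * I) :=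
    integrable_of_exp_decay (T := 1) (C := 4 * Real.pi) (ε := 1) hc one_pos fun τ hτ => by
      simpa using norm_cosec_le (s := (1 / 2 : ℝ) + τ * I) (by simpa using hτ)
  have hder : ∀ τ : ℝ, HasDerivAt
      (fun τ : ℝ => ((2 * Real.arctan (Real.exp (Real.pi * τ)) : ℝ) : ℂ))
      (cosec ((1 / 2 : ℝ) + τ * I)) τ := by
    intro τ
    rw [hval]
    refine HasDerivAt.ofReal_comp ?_
    have h1 : HasDerivAt (fun τ : ℝ => Real.exp (Real.pi * τ))
        (Real.exp (Real.pi * τ) * Real.pi) τ := by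
      simpa using ((hasDerivAt_id τ).const_mul Real.pi).exp
    have h2 := (h1.arctan).const_mul 2
    refine h2.congr_deriv ?_
    rw [Real.cosh_eq, Real.exp_neg]
    have := Real.exp_pos (Real.pi * τ)
    field_simp
    ring
  have hpos : Tendsto (fun τ : ℝ => Real.pi * τ) atTop atTop :=
    tendsto_id.const_mul_atTop Real.pi_pos
  have hneg : Tendsto (fun τ : ℝ => Real.pi * τ) atBot atBot :=
    tendsto_id.const_mul_atBot Real.pi_pos
  have htop : Tendsto (fun τ : ℝ => ((2 * Real.arctan (Real.exp (Real.pi * τ)) : ℝ) : ℂ)) atTop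
      (𝓝 ((2 * (Real.pi / 2) : ℝ) : ℂ)) := by
    refine (continuous_ofReal.tendsto _).comp (Tendsto.const_mul 2 ?_)
    exact (Real.tendsto_arctan_atTop.mono_right nhdsWithin_le_nhds).comp
      (Real.tendsto_exp_atTop.comp hpos)
  have hbot : Tendsto (fun τ : ℝ => ((2 * Real.arctan (Real.exp (Real.pi * τ)) : ℝ) : ℂ)) atBot
      (𝓝 ((2 * 0 : ℝ) : ℂ)) := by
    refine (continuous_ofReal.tendsto _).comp (Tendsto.const_mul 2 ?_)
    rw [← Real.arctan_zero]
    exact (Real.continuous_arctan.tendsto _).comp (Real.tendsto_exp_atBot.comp hneg)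
  rw [integral_of_hasDerivAt_of_tendsto hder hint hbot htop]
  push_cast
  ring

theorem integral_cosec {B : ℝ} (h0 : 0 < B) (h1 : B < 1) :
    ∫ τ : ℝ, cosec (B + τ * I) = Real.pi := by
  rw [← integral_cosec_half]
  have key : ∀ a b : ℝ, 0 < a → a ≤ b → b < 1 →
      ∫ τ : ℝ, cosec (b + τ * I) = ∫ τ : ℝ, cosec (a + τ * I) := fun a b ha hab hb =>
    integral_verticalLine_eq (C := 4 * Real.pi) (T := 1) hab one_pos
      (fun s h1 h2 => differentiableAt_cosec (by linarith) (by linarith)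
        (by rintro rfl; simp at h1; linarith))
      (fun s _ _ hs => norm_cosec_le hs)
  rcases le_total B (1 / 2) with h | h
  · exact (key _ _ h0 h (by norm_num)).symm
  · exact key _ _ (by norm_num) h h1

/-- Together with `integral_cosec_sub'`: the integral of `cosec (s - c)` over a vertical line jumps
by `2 π` when the line crosses the pole `c`. -/
theorem integral_cosec_sub {c : ℂ} {B : ℝ} (h0 : c.re < B) (h1 : B < c.re + 1) :
    ∫ τ : ℝ, cosec (B + τ * I - c) = Real.pi := by
  rw [← integral_cosec (B := B - c.re) (by linarith) (by linarith),
    ← integral_sub_right_eq_self (fun τ : ℝ => cosec ((B - c.re : ℝ) + τ * I)) c.im]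
  congr 1
  ext τ
  congr 1
  apply Complex.ext <;> simp

theorem integral_cosec_sub' {c : ℂ} {B : ℝ} (h0 : c.re - 1 < B) (h1 : B < c.re) :
    ∫ τ : ℝ, cosec (B + τ * I - c) = -Real.pi := by
  rw [← integral_cosec_sub (c := c) (B := B + 1) (by linarith) (by linarith), ← integral_neg]
  congr 1
  ext τ
  rw [← cosec_sub_one]
  congr 1
  push_cast
  ring

/-! ### Residues in a vertical strip -/

/-- Riemann's theorem on removable singularities, for a finite set of points. -/
theorem exists_differentiableAt_extension {g : ℂ → ℂ} {P S : Set ℂ} (hP : P.Finite)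
    (hd : ∀ s ∈ S, s ∉ P → DifferentiableAt ℂ g s)
    (hd' : ∀ c ∈ P, ∀ᶠ s in 𝓝[≠] c, DifferentiableAt ℂ g s)
    (hr : ∀ c ∈ P, Tendsto (fun s => (s - c) * g s) (𝓝[≠] c) (𝓝 0)) :
    ∃ G : ℂ → ℂ, (∀ s ∉ P, G s = g s) ∧ ∀ s ∈ S, DifferentiableAt ℂ G s := by
  classical
  let G : ℂ → ℂ := fun s => if s ∈ P then limUnder (𝓝[≠] s) g else g s
  have hG : ∀ s ∉ P, G s = g s := fun s hs => if_neg hs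
  have hnear : ∀ c, ∀ᶠ s in 𝓝[≠] c, s ∉ P := fun c => by
    have h : (P \ {c})ᶜ ∈ 𝓝 c := (hP.sdiff (t := {c})).isClosed.isOpen_compl.mem_nhds (by simp)
    filter_upwards [mem_nhdsWithin_of_mem_nhds h, self_mem_nhdsWithin] with s h1 h2 h3
    exact h1 ⟨h3, h2⟩
  refine ⟨G, hG, fun s hs => ?_⟩
  by_cases hsP : s ∈ P
  · have hGg : G =ᶠ[𝓝[≠] s] g := (hnear s).mono hG
    have hlim : Tendsto g (𝓝[≠] s) (𝓝 (G s)) := by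
      rw [show G s = limUnder (𝓝[≠] s) g from if_pos hsP]
      refine tendsto_limUnder_of_differentiable_on_punctured_nhds_of_isLittleO (hd' s hsP) ?_
      refine (Asymptotics.isLittleO_iff_tendsto' ?_).2 ?_
      · filter_upwards [self_mem_nhdsWithin] with z hz h
        exact absurd (inv_eq_zero.1 h) (sub_ne_zero.2 hz)
      · have h1 : Tendsto (fun z : ℂ => (z - s) * g s) (𝓝[≠] s) (𝓝 0) := by
          have : Tendsto (fun z : ℂ => (z - s) * g s) (𝓝 s) (𝓝 ((s - s) * g s)) :=
            Continuous.tendsto (by fun_prop) s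
          simpa using this.mono_left nhdsWithin_le_nhds
        have h2 := (hr s hsP).sub h1
        rw [sub_zero] at h2
        refine h2.congr fun z => ?_
        rw [div_inv_eq_mul]
        ring
    refine (analyticAt_of_differentiable_on_punctured_nhds_of_continuousAt ?_ ?_).differentiableAt
    · have h2 : ∀ᶠ z in 𝓝[≠] s, G =ᶠ[𝓝 z] g := by
        have := eventually_eventually_nhdsWithin.2 hGg
        filter_upwards [this, self_mem_nhdsWithin] with z hz hzs
        rwa [(isOpen_compl_singleton.nhdsWithin_eq hzs)] at hz
      filter_upwards [h2, hd' s hsP] with z h3 h4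
      exact h4.congr_of_eventuallyEq h3
    · exact continuousAt_iff_punctured_nhds.2 (hlim.congr' hGg.symm)
  · refine (hd s hs hsP).congr_of_eventuallyEq ?_
    exact (hP.isClosed.isOpen_compl.mem_nhds hsP |> fun h => eventually_of_mem h hG)

/-- The residue theorem for a strip of width one: the poles `c i` are simple, with residues
`r i`. Subtracting multiples of the cosecant kernel removes the poles and reduces the claim to
Cauchy's theorem. -/
theorem integral_verticalLine_sub {g : ℂ → ℂ} {a C T ε : ℝ} (hε : 0 < ε) {ι : Type*} [Fintype ι]
    {c r : ι → ℂ} (hinj : Function.Injective c) (hca : ∀ i, a < (c i).re)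
    (hcb : ∀ i, (c i).re < a + 1)
    (hd : ∀ s : ℂ, a ≤ s.re → s.re ≤ a + 1 → (∀ i, s ≠ c i) → DifferentiableAt ℂ g s)
    (hr : ∀ i, Tendsto (fun s => (s - c i) * g s) (𝓝[≠] (c i)) (𝓝 (r i)))
    (hb : ∀ s : ℂ, a ≤ s.re → s.re ≤ a + 1 → T ≤ |s.im| → ‖g s‖ ≤ C * Real.exp (-ε * |s.im|)) :
    (∫ τ : ℝ, g ((a + 1 : ℝ) + τ * I)) - ∫ τ : ℝ, g (a + τ * I) = 2 * Real.pi * ∑ i, r i := by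
  classical
  have hcos : ∀ i (s : ℂ), a ≤ s.re → s.re ≤ a + 1 → s ≠ c i →
      DifferentiableAt ℂ (fun s => cosec (s - c i)) s := fun i s h1 h2 h3 =>
    DifferentiableAt.comp (g := cosec) s (differentiableAt_cosec
      (by rw [sub_re]; linarith [hcb i]) (by rw [sub_re]; linarith [hca i]) (sub_ne_zero.2 h3))
      (by fun_prop)
  let F : ℂ → ℂ := fun s => g s - ∑ i, r i * cosec (s - c i)
  have hFd : ∀ s : ℂ, a ≤ s.re → s.re ≤ a + 1 → (∀ i, s ≠ c i) → DifferentiableAt ℂ F s :=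
    fun s h1 h2 h3 => (hd s h1 h2 h3).sub
      (DifferentiableAt.fun_sum fun i _ => (hcos i s h1 h2 (h3 i)).const_mul _)
  have hfin : (Set.range c).Finite := Set.finite_range c
  have hFr : ∀ p ∈ Set.range c, Tendsto (fun s => (s - p) * F s) (𝓝[≠] p) (𝓝 0) := by
    rintro _ ⟨i, rfl⟩
    have h1 : ∀ j, Tendsto (fun s => (s - c i) * (r j * cosec (s - c j))) (𝓝[≠] (c i))
        (𝓝 (if j = i then r i else 0)) := by
      intro j
      split_ifs with hji
      · subst hji
        have h2 : Tendsto (fun s : ℂ => s - c j) (𝓝[≠] (c j)) (𝓝[≠] 0) := by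
          refine tendsto_nhdsWithin_iff.2 ⟨?_, ?_⟩
          · have : Tendsto (fun s : ℂ => s - c j) (𝓝 (c j)) (𝓝 (c j - c j)) :=
              Continuous.tendsto (by fun_prop) _
            rw [sub_self] at this
            exact this.mono_left nhdsWithin_le_nhds
          · filter_upwards [self_mem_nhdsWithin] with z hz using sub_ne_zero.2 hz
        have h3 := (tendsto_mul_cosec.comp h2).const_mul (r j)
        rw [mul_one] at h3
        refine h3.congr fun s => ?_
        simp only [Function.comp]
        ring
      · have h2 : ContinuousAt (fun s => (s - c i) * (r j * cosec (s - c j))) (c i) :=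
          ContinuousAt.mul (by fun_prop) (ContinuousAt.mul continuousAt_const
            (hcos j (c i) (hca i).le (hcb i).le (fun h => hji (hinj h).symm)).continuousAt)
        have h3 := h2.tendsto
        rw [sub_self, zero_mul] at h3
        exact h3.mono_left nhdsWithin_le_nhds
    have h4 := (hr i).sub (tendsto_finsetSum Finset.univ fun j _ => h1 j)
    simp only [Finset.sum_ite_eq', Finset.mem_univ, if_true, sub_self] at h4
    refine h4.congr fun s => ?_
    rw [← Finset.mul_sum, ← mul_sub]
  have hFd' : ∀ p ∈ Set.range c, ∀ᶠ s in 𝓝[≠] p, DifferentiableAt ℂ F s := by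
    rintro _ ⟨i, rfl⟩
    have h1 : ∀ᶠ s : ℂ in 𝓝[≠] (c i), a < s.re ∧ s.re < a + 1 := by
      refine Filter.Eventually.filter_mono nhdsWithin_le_nhds ?_
      exact (continuous_re.continuousAt.eventually (lt_mem_nhds (hca i))).and
        (continuous_re.continuousAt.eventually (gt_mem_nhds (hcb i)))
    have h2 : ∀ᶠ s : ℂ in 𝓝[≠] (c i), ∀ j, s ≠ c j := by
      rw [eventually_all]
      intro j
      by_cases hji : j = i
      · subst hji; exact self_mem_nhdsWithin
      · exact Filter.Eventually.filter_mono nhdsWithin_le_nhds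
          (isOpen_ne.mem_nhds fun h => hji (hinj h).symm)
    filter_upwards [h1, h2] with s h3 h4
    exact hFd s h3.1.le h3.2.le h4
  obtain ⟨G, hGF, hG⟩ := exists_differentiableAt_extension (S := {s : ℂ | a ≤ s.re ∧ s.re ≤ a + 1})
    hfin (fun s hs hsP => hFd s hs.1 hs.2 fun i h => hsP ⟨i, h.symm⟩) hFd' hFr
  have hcosb : ∀ i (s : ℂ), 1 + ∑ j, |(c j).im| ≤ |s.im| →
      ‖cosec (s - c i)‖ ≤ 4 * Real.pi * Real.exp |(c i).im| * Real.exp (-1 * |s.im|) := by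
    intro i s hs
    have h1 : |(c i).im| ≤ ∑ j, |(c j).im| :=
      Finset.single_le_sum (f := fun j => |(c j).im|) (fun j _ => abs_nonneg _) (Finset.mem_univ i)
    have h2 : |s.im| - |(c i).im| ≤ |(s - c i).im| := by
      rw [sub_im]
      exact abs_sub_abs_le_abs_sub _ _
    refine (norm_cosec_le (by linarith)).trans ?_
    rw [mul_assoc _ (Real.exp _), ← Real.exp_add]
    gcongr
    linarith
  have hGb : ∀ s : ℂ, a ≤ s.re → s.re ≤ a + 1 → max T (1 + ∑ j, |(c j).im|) ≤ |s.im| →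
      ‖G s‖ ≤ (|C| + ∑ i, ‖r i‖ * (4 * Real.pi * Real.exp |(c i).im|)) *
        Real.exp (-min ε 1 * |s.im|) := by
    intro s h1 h2 h3
    have hsP : s ∉ Set.range c := by
      rintro ⟨i, rfl⟩
      have h4 : |(c i).im| ≤ ∑ j, |(c j).im| :=
        Finset.single_le_sum (f := fun j => |(c j).im|) (fun j _ => abs_nonneg _)
          (Finset.mem_univ i)
      linarith [(le_max_right _ _).trans h3]
    rw [hGF s hsP, add_mul, Finset.sum_mul]
    refine (norm_sub_le _ _).trans (add_le_add ?_ ((norm_sum_le _ _).trans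
      (Finset.sum_le_sum fun i _ => ?_)))
    · refine (hb s h1 h2 ((le_max_left _ _).trans h3)).trans ?_
      gcongr
      · exact le_abs_self C
      · exact min_le_left _ _
    · rw [norm_mul, mul_assoc]
      gcongr
      refine (hcosb i s ((le_max_right _ _).trans h3)).trans ?_
      gcongr
      exact min_le_right _ _
  have hmain := integral_verticalLine_eq (f := G) (a := a) (b := a + 1) (by linarith)
    (lt_min hε one_pos) (fun s h1 h2 => hG s ⟨h1, h2⟩) hGb
  have hline : ∀ σ : ℝ, a ≤ σ → σ ≤ a + 1 → (∀ i, (c i).re ≠ σ) →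
      ∫ τ : ℝ, G (σ + τ * I) =
        (∫ τ : ℝ, g (σ + τ * I)) - ∑ i, r i * ∫ τ : ℝ, cosec (σ + τ * I - c i) := by
    intro σ h1 h2 h3
    have hne : ∀ s : ℂ, s.re = σ → ∀ i, s ≠ c i := fun s hs i h => h3 i (h ▸ hs)
    have hgi : Integrable fun τ : ℝ => g (σ + τ * I) :=
      integrable_of_exp_decay (T := T) (C := C) (continuous_verticalLine fun s hs =>
        (hd s (hs ▸ h1) (hs ▸ h2) (hne s hs)).continuousAt) hε
        fun τ hτ => by simpa using hb (σ + τ * I) (by simpa) (by simpa) (by simpa)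
    have hci : ∀ i, Integrable fun τ : ℝ => cosec (σ + τ * I - c i) := fun i =>
      integrable_of_exp_decay (T := 1 + ∑ j, |(c j).im|)
        (C := 4 * Real.pi * Real.exp |(c i).im|) (ε := 1)
        (continuous_verticalLine (f := fun s => cosec (s - c i)) fun s hs =>
          (hcos i s (hs ▸ h1) (hs ▸ h2) (hne s hs i)).continuousAt) one_pos
        fun τ hτ => by simpa using hcosb i (σ + τ * I) (by simpa)
    have h4 : ∀ τ : ℝ, G (σ + τ * I) =
        g (σ + τ * I) - ∑ i, r i * cosec (σ + τ * I - c i) := fun τ =>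
      hGF _ (by rintro ⟨i, hi⟩; exact hne _ (by simp) i hi.symm)
    simp_rw [h4]
    rw [integral_sub hgi (integrable_finsetSum _ fun i _ => (hci i).const_mul _),
      integral_finsetSum _ fun i _ => (hci i).const_mul _]
    simp_rw [integral_const_mul]
  rw [hline (a + 1) (by linarith) le_rfl (fun i => (hcb i).ne), hline a le_rfl (by linarith)
    (fun i => (hca i).ne')] at hmain
  have h1 : ∀ i, ∫ τ : ℝ, cosec ((a + 1 : ℝ) + τ * I - c i) = Real.pi := fun i =>
    integral_cosec_sub (by linarith [hcb i]) (by linarith [hca i])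
  have h2 : ∀ i, ∫ τ : ℝ, cosec (a + τ * I - c i) = -Real.pi := fun i =>
    integral_cosec_sub' (by linarith [hcb i]) (by linarith [hca i])
  simp_rw [h1, h2] at hmain
  rw [← Finset.sum_mul, ← Finset.sum_mul] at hmain
  linear_combination hmain

/-- Closing a contour to the right. The integrand satisfies a first order difference equation whose
coefficient has a limit of modulus less than one at infinity, so that its integral over the line
`Re s = σ + M` tends to zero as `M` grows; the integral over the line `Re s = σ` is then
`-2π` times the sum of the residues to the right of this line, grouped by strips of width one. -/
theorem tendsto_sum_residues {g q : ℂ → ℂ} {σ C T ε : ℝ} {L : ℂ} (hε : 0 < ε) (hL : ‖L‖ < 1)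
    (hq : Tendsto q (Bornology.cobounded ℂ) (𝓝 L)) {ι : Type*} [Fintype ι] {c r : ℕ → ι → ℂ}
    (hinj : ∀ M, Function.Injective (c M)) (hca : ∀ M i, σ + M < (c M i).re)
    (hcb : ∀ M i, (c M i).re < σ + M + 1) (him : ∀ M i, |(c M i).im| < T)
    (hd : ∀ s : ℂ, σ ≤ s.re → (∀ M i, s ≠ c M i) → DifferentiableAt ℂ g s)
    (hr : ∀ M i, Tendsto (fun s => (s - c M i) * g s) (𝓝[≠] (c M i)) (𝓝 (r M i)))
    (hstep : ∀ s : ℂ, σ ≤ s.re → (∀ M i, s ≠ c M i) → g (s + 1) = q s * g s)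
    (hb : ∀ s : ℂ, σ ≤ s.re → s.re ≤ σ + 1 → T ≤ |s.im| → ‖g s‖ ≤ C * Real.exp (-ε * |s.im|)) :
    Tendsto (fun n => ∑ M ∈ Finset.range n, ∑ i, r M i) atTop
      (𝓝 (-(2 * Real.pi : ℂ)⁻¹ * ∫ τ : ℝ, g (σ + τ * I))) := by
  obtain ⟨θ, hLθ, hθ1⟩ := exists_between hL
  have hθ0 : 0 < θ := (norm_nonneg _).trans_lt hLθ
  obtain ⟨R, hR⟩ : ∃ R : ℝ, ∀ s : ℂ, R ≤ ‖s‖ → ‖q s‖ ≤ θ := by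
    have h1 : ∀ᶠ s in Bornology.cobounded ℂ, ‖q s‖ < θ := hq.norm.eventually (gt_mem_nhds hLθ)
    rw [← comap_norm_atTop, eventually_comap] at h1
    obtain ⟨R, hR⟩ := eventually_atTop.1 h1
    exact ⟨R, fun s hs => (hR _ hs s rfl).le⟩
  -- the difference equation carries the decay from the first strip to all others
  have hbM : ∀ M : ℕ, ∀ s : ℂ, σ + M ≤ s.re → s.re ≤ σ + M + 1 → max T R ≤ |s.im| →
      ‖g s‖ ≤ C * Real.exp (-ε * |s.im|) := by
    intro M
    induction M with
    | zero =>
      intro s h1 h2 h3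
      exact hb s (by simpa using h1) (by simpa using h2) ((le_max_left _ _).trans h3)
    | succ M ih =>
      intro s h1 h2 h3
      push_cast at h1 h2
      have hre : (s - 1).re = s.re - 1 := by simp
      have him' : (s - 1).im = s.im := by simp
      have h4 : g s = q (s - 1) * g (s - 1) := by
        rw [← hstep (s - 1), sub_add_cancel]
        · rw [hre]; linarith [Nat.cast_nonneg (α := ℝ) M]
        · intro M' i h
          have := him M' i
          rw [← h, him'] at this
          linarith [(le_max_left _ _).trans h3]
      have h5 := ih (s - 1) (by rw [hre]; linarith) (by rw [hre]; linarith) (by rwa [him'])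
      have h6 : ‖q (s - 1)‖ ≤ 1 := (hR _ (((le_max_right _ _).trans h3).trans
        (him' ▸ abs_im_le_norm (s - 1)))).trans hθ1.le
      rw [him'] at h5
      rw [h4, norm_mul]
      calc ‖q (s - 1)‖ * ‖g (s - 1)‖ ≤ 1 * ‖g (s - 1)‖ := by gcongr
        _ ≤ _ := by rwa [one_mul]
  have hne : ∀ (M : ℕ) (s : ℂ), s.re = σ + M → ∀ M' i, s ≠ c M' i := by
    intro M s hs M' i h
    have h1 := hca M' i
    have h2 := hcb M' i
    rw [← h, hs] at h1 h2
    have h3 : M' < M := by exact_mod_cast (add_lt_add_iff_left σ).1 h1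
    have h4 : M < M' + 1 := by
      exact_mod_cast (add_lt_add_iff_left σ).1 (by linarith : σ + M < σ + (M' + 1))
    omega
  have hdiffline : ∀ (M : ℕ), Integrable fun τ : ℝ => g ((σ + M : ℝ) + τ * I) := by
    intro M
    refine integrable_of_exp_decay (T := max T R) (C := C) (continuous_verticalLine fun s hs =>
      (hd s (by rw [hs]; linarith [Nat.cast_nonneg (α := ℝ) M]) (hne M s hs)).continuousAt) hε
      fun τ hτ => ?_
    have := hbM M ((σ + M : ℝ) + τ * I) (by simp) (by simp) (by simpa using hτ)
    simpa using this
  have hstrip : ∀ M : ℕ, ∑ i, r M i = (2 * Real.pi : ℂ)⁻¹ *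
      ((∫ τ : ℝ, g ((σ + (M + 1 : ℕ) : ℝ) + τ * I)) - ∫ τ : ℝ, g ((σ + M : ℝ) + τ * I)) := by
    intro M
    have h1 := integral_verticalLine_sub (g := g) (a := σ + M) (T := max T R) (C := C) hε (hinj M)
      (hca M) (hcb M) (fun s h1 h2 h3 => hd s (by linarith [Nat.cast_nonneg (α := ℝ) M]) ?_)
      (hr M) (hbM M)
    · have hpi : (2 * Real.pi : ℂ) ≠ 0 := by simp [Real.pi_ne_zero]
      rw [show (σ + (M + 1 : ℕ) : ℝ) = σ + M + 1 by push_cast; ring, h1, inv_mul_cancel_left₀ hpi]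
    · intro M' i h
      rcases lt_trichotomy M' M with h4 | h4 | h4
      · have h5 := hcb M' i
        rw [← h] at h5
        have h6 : (M' : ℝ) + 1 ≤ M := by exact_mod_cast h4
        linarith
      · subst h4; exact h3 i h
      · have h5 := hca M' i
        rw [← h] at h5
        have h6 : (M : ℝ) + 1 ≤ M' := by exact_mod_cast h4
        linarith
  have hsum : ∀ n : ℕ, ∑ M ∈ Finset.range n, ∑ i, r M i = (2 * Real.pi : ℂ)⁻¹ *
      ((∫ τ : ℝ, g ((σ + n : ℝ) + τ * I)) - ∫ τ : ℝ, g (σ + τ * I)) := by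
    intro n
    simp_rw [hstrip]
    rw [← Finset.mul_sum, Finset.sum_range_sub
      (fun M : ℕ => ∫ τ : ℝ, g ((σ + M : ℝ) + τ * I))]
    simp
  -- far to the right, each shift by one multiplies the integrand by at most `θ < 1`
  have hlim : Tendsto (fun n : ℕ => ∫ τ : ℝ, g ((σ + n : ℝ) + τ * I)) atTop (𝓝 0) := by
    obtain ⟨M₁, hM₁⟩ := exists_nat_ge (|R| + |σ|)
    have hj : ∀ j : ℕ, ∀ τ : ℝ, ‖g ((σ + (j + M₁ : ℕ) : ℝ) + τ * I)‖ ≤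
        θ ^ j * ‖g ((σ + M₁ : ℝ) + τ * I)‖ := by
      intro j τ
      induction j with
      | zero => simp
      | succ j ih =>
        set s : ℂ := (σ + (j + M₁ : ℕ) : ℝ) + τ * I with hs
        have hsre : s.re = σ + (j + M₁ : ℕ) := by simp [hs]
        have h1 : ((σ + (j + 1 + M₁ : ℕ) : ℝ) : ℂ) + τ * I = s + 1 := by
          rw [hs]; push_cast; ring
        have h2 : ‖q s‖ ≤ θ := by
          refine hR s (le_trans ?_ (abs_re_le_norm s))
          rw [hsre]
          push_cast
          have := neg_abs_le σ
          linarith [le_abs_self R, le_abs_self (σ + (j + M₁ : ℝ)), Nat.cast_nonneg (α := ℝ) j]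
        rw [h1, hstep s (by rw [hsre]; linarith [Nat.cast_nonneg (α := ℝ) (j + M₁)])
          (hne _ s hsre), norm_mul, pow_succ', mul_assoc]
        gcongr
    rw [← tendsto_add_atTop_iff_nat M₁]
    have h0 : Tendsto (fun j : ℕ => θ ^ j * ∫ τ : ℝ, ‖g ((σ + M₁ : ℝ) + τ * I)‖) atTop (𝓝 0) := by
      simpa using (tendsto_pow_atTop_nhds_zero_of_lt_one hθ0.le hθ1).mul_const
        (∫ τ : ℝ, ‖g ((σ + M₁ : ℝ) + τ * I)‖)
    refine squeeze_zero_norm (fun j => ?_) h0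
    rw [← integral_const_mul]
    exact norm_integral_le_of_norm_le ((hdiffline M₁).norm.const_mul _)
      (Eventually.of_forall (hj j))
  have h := (hlim.sub_const (∫ τ : ℝ, g (σ + τ * I))).const_mul (2 * Real.pi : ℂ)⁻¹
  rw [zero_sub, mul_neg, ← neg_mul] at h
  exact h.congr fun n => (hsum n).symm

/-! ### Bounds for the Gamma function on vertical strips -/

/-- Comparison of `Γ` at two points with the same imaginary part, from the triangle inequality for
the Beta integral. -/
theorem norm_Gamma_mul_Gamma_le {s : ℂ} {β : ℝ} (hs : 0 < s.re) (hβ : 0 < β) :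
    ‖Gamma s‖ * Real.Gamma (s.re + β) ≤ Real.Gamma s.re * ‖Gamma (s + β)‖ := by
  have h1 := Gamma_mul_Gamma_eq_betaIntegral (s := s) (t := β) hs (by simpa)
  have h2 := Gamma_mul_Gamma_eq_betaIntegral (s := s.re) (t := β) (by simpa) (by simpa)
  set b : ℝ := ∫ x : ℝ in (0 : ℝ)..1, x ^ (s.re - 1) * (1 - x) ^ (β - 1) with hb
  have hbeta : betaIntegral s.re β = b := by
    rw [betaIntegral, hb, ← intervalIntegral.integral_ofReal]
    refine intervalIntegral.integral_congr fun x hx => ?_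
    rw [uIcc_of_le zero_le_one] at hx
    rw [ofReal_mul, ofReal_cpow hx.1, ofReal_cpow (by linarith [hx.2])]
    push_cast
    rfl
  have hle : ‖betaIntegral s β‖ ≤ b := by
    rw [betaIntegral, hb]
    refine (intervalIntegral.norm_integral_le_integral_norm zero_le_one).trans (le_of_eq ?_)
    refine intervalIntegral.integral_congr_ae ?_
    have hne : ∀ᵐ x : ℝ, x ≠ 1 := by simp [ae_iff, measure_singleton]
    filter_upwards [hne] with x hx1 hx
    rw [uIoc_of_le zero_le_one] at hx
    have h3 : (0 : ℝ) < 1 - x := by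
      have := lt_of_le_of_ne hx.2 hx1
      linarith
    have h4 : (1 - (x : ℂ)) = ((1 - x : ℝ) : ℂ) := by push_cast; rfl
    rw [norm_mul, h4, norm_cpow_eq_rpow_re_of_pos hx.1, norm_cpow_eq_rpow_re_of_pos h3]
    simp
  rw [hbeta, Gamma_ofReal, Gamma_ofReal, ← ofReal_add, Gamma_ofReal] at h2
  have h2' : Real.Gamma s.re * Real.Gamma β = Real.Gamma (s.re + β) * b := by exact_mod_cast h2
  have hG := Real.Gamma_pos_of_pos hβ
  have h1' : ‖Gamma s‖ * Real.Gamma β = ‖Gamma (s + β)‖ * ‖betaIntegral s β‖ := by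
    rw [← norm_mul, ← h1, norm_mul, Gamma_ofReal, norm_real, Real.norm_of_nonneg hG.le]
  have hGa := Real.Gamma_pos_of_pos (add_pos hs hβ)
  refine le_of_mul_le_mul_right ?_ hG
  calc ‖Gamma s‖ * Real.Gamma (s.re + β) * Real.Gamma β
      = ‖Gamma (s + β)‖ * ‖betaIntegral s β‖ * Real.Gamma (s.re + β) := by rw [← h1']; ring
    _ ≤ ‖Gamma (s + β)‖ * b * Real.Gamma (s.re + β) := by gcongr
    _ = Real.Gamma s.re * ‖Gamma (s + β)‖ * Real.Gamma β := by
        linear_combination -‖Gamma (s + β)‖ * h2'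

/-- A consequence of the reflection formula. -/
theorem norm_Gamma_one_add_mul_I_sq {b : ℝ} (hb : b ≠ 0) :
    ‖Gamma (1 + b * I)‖ ^ 2 = Real.pi * |b| / Real.sinh (Real.pi * |b|) := by
  have hbI : (b : ℂ) * I ≠ 0 := by simp [hb]
  have h1 : Gamma (1 + b * I) = b * I * Gamma (b * I) := by rw [add_comm, Gamma_add_one _ hbI]
  have h2 := Gamma_mul_Gamma_one_sub (b * I)
  have h3 : Gamma (1 - b * I) = (starRingEnd ℂ) (Gamma (1 + b * I)) := by
    rw [← Gamma_conj]
    simp [sub_eq_add_neg]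
  have h4 : ((‖Gamma (1 + b * I)‖ ^ 2 : ℝ) : ℂ) =
      ((Real.pi * b / Real.sinh (Real.pi * b) : ℝ) : ℂ) := by
    push_cast
    rw [← mul_conj', ← h3, h1, mul_assoc, h2, ← mul_assoc, sin_mul_I]
    have : sinh ((Real.pi : ℂ) * b) ≠ 0 := by
      rw [← ofReal_mul, ← ofReal_sinh]
      exact_mod_cast fun h => mul_ne_zero Real.pi_ne_zero hb (Real.sinh_eq_zero.1 h)
    field_simp
  rw [ofReal_inj.1 h4]
  rcases abs_cases b with ⟨h, _⟩ | ⟨h, _⟩ <;> rw [h]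
  rw [mul_neg, Real.sinh_neg, neg_div_neg_eq]

theorem exp_le_norm_Gamma_one_add {b : ℝ} (hb : 1 ≤ |b|) :
    Real.exp (-(Real.pi / 2) * |b|) ≤ ‖Gamma (1 + b * I)‖ := by
  have hb0 : b ≠ 0 := by rintro rfl; simp at hb; linarith
  refine le_of_sq_le_sq ?_ (norm_nonneg _)
  rw [norm_Gamma_one_add_mul_I_sq hb0, ← Real.exp_nat_mul]
  have hpi := Real.pi_gt_three
  have h1 : 0 < Real.pi * |b| := by positivity
  have h2 : Real.sinh (Real.pi * |b|) ≤ Real.exp (Real.pi * |b|) := by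
    rw [Real.sinh_eq]; linarith [Real.exp_pos (Real.pi * |b|), Real.exp_pos (-(Real.pi * |b|))]
  have h3 : 0 < Real.sinh (Real.pi * |b|) := Real.sinh_pos_iff.2 h1
  rw [le_div_iff₀ h3]
  calc _ ≤ Real.exp ((2 : ℕ) * (-(Real.pi / 2) * |b|)) * Real.exp (Real.pi * |b|) := by gcongr
    _ = 1 := by rw [← Real.exp_add]; push_cast; ring_nf; simp
    _ ≤ _ := by nlinarith

/-- Every step of the recursion costs a factor `|b|`, absorbed by an arbitrarily small loss in the
exponent. -/
theorem exists_norm_Gamma_nat_add_le (n : ℕ) : ∀ δ : ℝ, 0 < δ → ∃ C, 0 ≤ C ∧ ∀ b : ℝ, 1 ≤ |b| →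
    ‖Gamma (n + 1 + b * I)‖ ≤ C * Real.exp (-(Real.pi / 2 - δ) * |b|) := by
  induction n with
  | zero =>
    intro δ hδ
    refine ⟨√(2 * Real.pi / δ), Real.sqrt_nonneg _, fun b hb => ?_⟩
    have hb0 : b ≠ 0 := by rintro rfl; simp at hb; linarith
    refine le_of_sq_le_sq ?_ (by positivity)
    have hpi := Real.pi_gt_three
    have h1 : 1 ≤ Real.pi * |b| := by nlinarith
    have h2 := exp_div_four_le_sinh h1
    have h5 : 2 * δ * |b| ≤ Real.exp (2 * δ * |b|) := by
      linarith [Real.add_one_le_exp (2 * δ * |b|)]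
    rw [mul_pow, Real.sq_sqrt (by positivity), ← Real.exp_nat_mul, Nat.cast_zero, zero_add,
      norm_Gamma_one_add_mul_I_sq hb0, div_le_iff₀ (by linarith [Real.exp_pos (Real.pi * |b|)])]
    have h6 : Real.exp ((2 : ℕ) * (-(Real.pi / 2 - δ) * |b|)) * Real.exp (Real.pi * |b|) =
        Real.exp (2 * δ * |b|) := by
      rw [← Real.exp_add]; push_cast; ring_nf
    calc Real.pi * |b| = 2 * Real.pi / δ * (2 * δ * |b|) / 4 := by field_simp; ring
      _ ≤ 2 * Real.pi / δ * Real.exp (2 * δ * |b|) / 4 := by gcongr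
      _ = 2 * Real.pi / δ * Real.exp ((2 : ℕ) * (-(Real.pi / 2 - δ) * |b|)) *
          (Real.exp (Real.pi * |b|) / 4) := by rw [← h6]; ring
      _ ≤ _ := by gcongr
  | succ n ih =>
    intro δ hδ
    obtain ⟨C, hC0, hC⟩ := ih (δ / 2) (by positivity)
    refine ⟨(n + 1 + 2 / δ) * C, by positivity, fun b hb => ?_⟩
    have h1 : (n + 1 + b * I : ℂ) ≠ 0 := by
      intro h
      have := congrArg Complex.re h
      simp at this
      linarith [Nat.cast_nonneg (α := ℝ) n]
    have h2 : ((n + 1 : ℕ) : ℂ) + 1 + b * I = (n + 1 + b * I) + 1 := by push_cast; ring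
    rw [h2, Gamma_add_one _ h1, norm_mul]
    have h3 : ‖(n + 1 + b * I : ℂ)‖ ≤ n + 1 + |b| := by
      refine (norm_add_le _ _).trans (add_le_add ?_ (by simp))
      exact_mod_cast (Complex.norm_natCast (n + 1)).le
    have h4 : δ / 2 * |b| + 1 ≤ Real.exp (δ / 2 * |b|) := Real.add_one_le_exp _
    have h0 : 0 ≤ δ / 2 * |b| := by positivity
    have h5 : (n + 1 + |b| : ℝ) ≤ (n + 1 + 2 / δ) * Real.exp (δ / 2 * |b|) := by
      have h6 : |b| = 2 / δ * (δ / 2 * |b|) := by field_simp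
      have h7 : 2 / δ * (δ / 2 * |b|) ≤ 2 / δ * Real.exp (δ / 2 * |b|) := by gcongr; linarith
      have h8 : (n + 1 : ℝ) * 1 ≤ (n + 1) * Real.exp (δ / 2 * |b|) := by gcongr; linarith
      rw [← h6] at h7
      linarith
    calc _ ≤ ((n + 1 + 2 / δ) * Real.exp (δ / 2 * |b|)) *
          (C * Real.exp (-(Real.pi / 2 - δ / 2) * |b|)) := by
          gcongr
          · exact h3.trans h5
          · exact hC b hb
      _ = (n + 1 + 2 / δ) * C * (Real.exp (δ / 2 * |b|) *
          Real.exp (-(Real.pi / 2 - δ / 2) * |b|)) := by ring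
      _ = _ := by rw [← Real.exp_add]; ring_nf

theorem exists_bounds_realGamma {a A : ℝ} (ha : 0 < a) :
    ∃ m M, 0 < m ∧ 0 < M ∧ ∀ x, a ≤ x → x ≤ A → m ≤ Real.Gamma x ∧ Real.Gamma x ≤ M := by
  rcases lt_or_ge A a with h | h
  · exact ⟨1, 1, one_pos, one_pos, fun x h1 h2 => absurd (h1.trans h2) (not_le.2 h)⟩
  have hc : ContinuousOn Real.Gamma (Icc a A) :=
    Real.differentiableOn_Gamma_Ioi.continuousOn.mono fun x hx => mem_Ioi.2 (ha.trans_le hx.1)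
  obtain ⟨x, hx, hxm⟩ := isCompact_Icc.exists_isMinOn (nonempty_Icc.2 h) hc
  obtain ⟨y, hy, hyM⟩ := isCompact_Icc.exists_isMaxOn (nonempty_Icc.2 h) hc
  exact ⟨_, _, Real.Gamma_pos_of_pos (ha.trans_le hx.1), Real.Gamma_pos_of_pos (ha.trans_le hy.1),
    fun z h1 h2 => ⟨hxm ⟨h1, h2⟩, hyM ⟨h1, h2⟩⟩⟩

/-- The upper bound on a strip, by comparison with the line `Re s = n + 1` on its right. -/
theorem exists_norm_Gamma_le {a A δ : ℝ} (ha : 0 < a) (hδ : 0 < δ) :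
    ∃ C, 0 ≤ C ∧ ∀ s : ℂ, a ≤ s.re → s.re ≤ A → 1 ≤ |s.im| →
      ‖Gamma s‖ ≤ C * Real.exp (-(Real.pi / 2 - δ) * |s.im|) := by
  obtain ⟨n, hn⟩ := exists_nat_ge A
  obtain ⟨C, hC0, hC⟩ := exists_norm_Gamma_nat_add_le n δ hδ
  obtain ⟨m, M, hm, hM, hmM⟩ := exists_bounds_realGamma (A := A) ha
  have hn1 : 0 < Real.Gamma (n + 1) := Real.Gamma_pos_of_pos (by positivity)
  refine ⟨M * C / Real.Gamma (n + 1), by positivity, fun s h1 h2 h3 => ?_⟩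
  have h4 := norm_Gamma_mul_Gamma_le (s := s) (β := n + 1 - s.re) (by linarith) (by linarith)
  have h5 : s + ((n + 1 - s.re : ℝ) : ℂ) = n + 1 + s.im * I := by
    apply Complex.ext <;> simp
  rw [h5, add_sub_cancel] at h4
  rw [div_mul_eq_mul_div, le_div_iff₀ hn1, mul_assoc]
  refine h4.trans ?_
  gcongr
  · exact (hmM _ h1 h2).2
  · exact hC _ h3

/-- The lower bound on a strip, by comparison with the line `Re s = 1` on its left. -/
theorem exists_le_norm_Gamma (A : ℝ) :
    ∃ c, 0 < c ∧ ∀ s : ℂ, 1 ≤ s.re → s.re ≤ A → 1 ≤ |s.im| →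
      c * Real.exp (-(Real.pi / 2) * |s.im|) ≤ ‖Gamma s‖ := by
  obtain ⟨m, M, hm, hM, hmM⟩ := exists_bounds_realGamma (A := A) one_pos
  refine ⟨min m 1, lt_min hm one_pos, fun s h1 h2 h3 => ?_⟩
  have h4 := exp_le_norm_Gamma_one_add h3
  rcases h1.eq_or_lt with h | h
  · have h5 : s = 1 + s.im * I := by apply Complex.ext <;> simp [← h]
    calc _ ≤ 1 * Real.exp (-(Real.pi / 2) * |s.im|) := by gcongr; exact min_le_right _ _
      _ ≤ _ := by rw [one_mul]; exact h4.trans (by rw [← h5])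
  · have h5 := norm_Gamma_mul_Gamma_le (s := 1 + s.im * I) (β := s.re - 1) (by simp) (by linarith)
    have h6 : (1 : ℂ) + s.im * I + ((s.re - 1 : ℝ) : ℂ) = s := by apply Complex.ext <;> simp
    have h7 : ((1 : ℂ) + s.im * I).re = 1 := by simp
    rw [h6, h7, add_sub_cancel, Real.Gamma_one, one_mul] at h5
    refine le_trans ?_ h5
    rw [mul_comm]
    gcongr
    exact (min_le_left _ _).trans (hmM _ h1 h2).1

/-! ### The ratio of Gamma functions -/

/-- The function `s ↦ Γ(1 + ξ + d s) / ∏_j Γ(1 + w_j s)` interpolating the coefficients of both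
`H`-functions. -/
def gammaRatio (w : Fin N → ℕ) (ξ s : ℂ) : ℂ :=
  Gamma (1 + ξ + deg w * s) / ∏ j, Gamma (1 + w j * s)

/-- `∏_{i = 1}^d (ξ + d s + i)`, the factor by which the numerator of `gammaRatio` grows from `s` to
`s + 1`. -/
def stepNum (w : Fin N → ℕ) (ξ s : ℂ) : ℂ := ∏ i ∈ Finset.range (deg w), (1 + ξ + deg w * s + i)

/-- `∏_j ∏_{i = 1}^{w_j} (w_j s + i)`, the factor by which the denominator of `gammaRatio` grows
from `s` to `s + 1`. -/
def stepDen (w : Fin N → ℕ) (s : ℂ) : ℂ := ∏ j, ∏ i ∈ Finset.range (w j), (1 + w j * s + i)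

theorem Gamma_add_nat_of_ne_zero (z : ℂ) (n : ℕ) (h : ∏ i ∈ Finset.range n, (z + i) ≠ 0) :
    Gamma (z + n) = (∏ i ∈ Finset.range n, (z + i)) * Gamma z := by
  induction n with
  | zero => simp
  | succ n ih =>
    rw [Finset.prod_range_succ] at h ⊢
    rw [Nat.cast_succ, ← add_assoc, Gamma_add_one _ (right_ne_zero_of_mul h),
      ih (left_ne_zero_of_mul h)]
    ring

theorem inv_Gamma_eq_prod_mul (z : ℂ) (n : ℕ) :
    (Gamma z)⁻¹ = (∏ i ∈ Finset.range n, (z + i)) * (Gamma (z + n))⁻¹ := by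
  induction n with
  | zero => simp
  | succ n ih =>
    rw [ih, one_div_Gamma_eq_self_mul_one_div_Gamma_add_one (z + n), Finset.prod_range_succ,
      Nat.cast_succ]
    ring_nf

/-- The difference equation of `gammaRatio`, in a form that holds also at the zeros of `stepDen`. -/
theorem gammaRatio_add_one (w : Fin N → ℕ) {ξ s : ℂ} (h : stepNum w ξ s ≠ 0) :
    gammaRatio w ξ s * stepNum w ξ s = stepDen w s * gammaRatio w ξ (s + 1) := by
  have h1 : Gamma (1 + ξ + deg w * (s + 1)) = stepNum w ξ s * Gamma (1 + ξ + deg w * s) := by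
    rw [stepNum, ← Gamma_add_nat_of_ne_zero _ _ h]
    ring_nf
  have h2 : (∏ j, Gamma (1 + w j * s))⁻¹ = stepDen w s * (∏ j, Gamma (1 + w j * (s + 1)))⁻¹ := by
    rw [← Finset.prod_inv_distrib, ← Finset.prod_inv_distrib, stepDen, ← Finset.prod_mul_distrib]
    refine Finset.prod_congr rfl fun j _ => ?_
    rw [inv_Gamma_eq_prod_mul _ (w j)]
    ring_nf
  rw [gammaRatio, gammaRatio, div_eq_mul_inv, div_eq_mul_inv, h1, h2]
  ring

theorem deg_pos {w : Fin N → ℕ} (hpos : ∀ j, 0 < w j) (hN : 0 < N) : 0 < deg w :=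
  Finset.sum_pos (fun j _ => hpos j) ⟨⟨0, hN⟩, Finset.mem_univ _⟩

theorem vc_pos {w : Fin N → ℕ} (hpos : ∀ j, 0 < w j) (hN : 0 < N) : 0 < vc w := by
  have := deg_pos hpos hN
  exact mul_pos (by positivity) (Finset.prod_pos fun j _ => pow_pos (by exact_mod_cast hpos j) _)

theorem tendsto_linear_div (a b : ℂ) :
    Tendsto (fun s : ℂ => (a + b * s) / s) (Bornology.cobounded ℂ) (𝓝 b) := by
  have h := ((tendsto_inv₀_cobounded (α := ℂ)).const_mul a).add_const b
  rw [mul_zero, zero_add] at h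
  refine h.congr' ?_
  have h0 : ∀ᶠ s : ℂ in Bornology.cobounded ℂ, s ≠ 0 := Bornology.eventually_ne_cobounded 0
  filter_upwards [h0] with s hs
  field_simp

/-- The coefficient of the difference equation of `gammaRatio`, read from right to left, tends to
`v_c`. -/
theorem tendsto_stepDen_div_stepNum {w : Fin N → ℕ} (hpos : ∀ j, 0 < w j) (hN : 0 < N) (ξ : ℂ) :
    Tendsto (fun s => stepDen w s / stepNum w ξ s) (Bornology.cobounded ℂ) (𝓝 (vc w : ℂ)) := by
  have hd : (deg w : ℂ) ≠ 0 := by exact_mod_cast (deg_pos hpos hN).ne'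
  have h1 : Tendsto (fun s : ℂ => ∏ i ∈ Finset.range (deg w), ((1 + ξ + i + deg w * s) / s))
      (Bornology.cobounded ℂ) (𝓝 (∏ i ∈ Finset.range (deg w), (deg w : ℂ))) :=
    tendsto_finsetProd _ fun i _ => tendsto_linear_div _ _
  have h2 : Tendsto (fun s : ℂ => ∏ j, ∏ i ∈ Finset.range (w j), ((1 + i + w j * s) / s))
      (Bornology.cobounded ℂ) (𝓝 (∏ j, ∏ i ∈ Finset.range (w j), (w j : ℂ))) :=
    tendsto_finsetProd _ fun j _ => tendsto_finsetProd _ fun i _ => tendsto_linear_div _ _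
  have h3 := h2.div h1 (by simp [hd])
  have hv : (∏ j, ∏ i ∈ Finset.range (w j), (w j : ℂ)) / ∏ i ∈ Finset.range (deg w), (deg w : ℂ) =
      (vc w : ℂ) := by
    simp only [Finset.prod_const, Finset.card_range, vc]
    push_cast
    rw [div_eq_inv_mul]
  rw [hv] at h3
  refine h3.congr' ?_
  have h0 : ∀ᶠ s : ℂ in Bornology.cobounded ℂ, s ≠ 0 := Bornology.eventually_ne_cobounded 0
  filter_upwards [h0] with s hs
  simp only [Pi.div_apply, Finset.prod_div_distrib, Finset.prod_const, Finset.card_range]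
  rw [Finset.prod_pow_eq_pow_sum, ← deg, div_div_div_cancel_right₀ (pow_ne_zero _ hs), stepDen,
    stepNum]
  congr 1
  · exact Finset.prod_congr rfl fun j _ => Finset.prod_congr rfl fun i _ => by ring
  · exact Finset.prod_congr rfl fun i _ => by ring

theorem tendsto_stepNum_div_stepDen {w : Fin N → ℕ} (hpos : ∀ j, 0 < w j) (hN : 0 < N) (ξ : ℂ) :
    Tendsto (fun s => stepNum w ξ s / stepDen w s) (Bornology.cobounded ℂ) (𝓝 (vc w : ℂ)⁻¹) := by
  refine ((tendsto_stepDen_div_stepNum hpos hN ξ).inv₀ ?_).congr fun s => inv_div _ _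
  exact_mod_cast (vc_pos hpos hN).ne'

theorem differentiable_inv_prod_Gamma (w : Fin N → ℕ) :
    Differentiable ℂ fun s : ℂ => (∏ j, Gamma (1 + w j * s))⁻¹ := by
  simp_rw [← Finset.prod_inv_distrib]
  refine Differentiable.fun_finsetProd fun j _ => ?_
  exact differentiable_one_div_Gamma.comp (f := fun s : ℂ => 1 + w j * s) (by fun_prop)

theorem differentiableAt_gammaRatio (w : Fin N → ℕ) {ξ s : ℂ}
    (h : ∀ k : ℕ, 1 + ξ + deg w * s ≠ -k) : DifferentiableAt ℂ (gammaRatio w ξ) s := by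
  have h1 : DifferentiableAt ℂ (fun s : ℂ => Gamma (1 + ξ + deg w * s)) s :=
    DifferentiableAt.comp (g := Gamma) s (differentiableAt_Gamma _ h) (by fun_prop)
  exact h1.mul (differentiable_inv_prod_Gamma w s)

/-- Subexponential growth on a vertical strip on which all the Gamma functions involved have
arguments with positive real part: the exponential factors of numerator and denominator cancel
because `d = ∑ w_j`. -/
theorem exists_norm_gammaRatio_le {w : Fin N → ℕ} (hpos : ∀ j, 0 < w j) (hN : 0 < N) {ξ : ℂ}
    {a b δ : ℝ} (ha : 0 ≤ a) (ha' : 0 < 1 + ξ.re + deg w * a) (hδ : 0 < δ) :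
    ∃ C T, 0 ≤ C ∧ ∀ s : ℂ, a ≤ s.re → s.re ≤ b → T ≤ |s.im| →
      ‖gammaRatio w ξ s‖ ≤ C * Real.exp (δ * |s.im|) := by
  have hd : (1 : ℝ) ≤ deg w := by exact_mod_cast deg_pos hpos hN
  have hd0 : (0 : ℝ) < deg w := by linarith
  set δ' : ℝ := min (δ / deg w) (Real.pi / 2) with hδ'
  have hδ'0 : 0 < δ' := lt_min (by positivity) (by positivity)
  have hδ'1 : δ' * deg w ≤ δ := by
    rw [← le_div_iff₀ hd0]; exact min_le_left _ _
  have hδ'2 : δ' ≤ Real.pi / 2 := min_le_right _ _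
  obtain ⟨C, hC0, hC⟩ := exists_norm_Gamma_le (A := 1 + ξ.re + deg w * b) ha' hδ'0
  choose c hc0 hc using fun j => exists_le_norm_Gamma (1 + w j * b)
  have hcp : 0 < ∏ j, c j := Finset.prod_pos fun j _ => hc0 j
  refine ⟨C * Real.exp ((Real.pi / 2 - δ') * |ξ.im|) / ∏ j, c j, 1 + |ξ.im|, by positivity,
    fun s h1 h2 h3 => ?_⟩
  have hre : (1 + ξ + deg w * s).re = 1 + ξ.re + deg w * s.re := by simp
  have him : (1 + ξ + deg w * s).im = ξ.im + deg w * s.im := by simp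
  have habs : deg w * |s.im| - |ξ.im| ≤ |ξ.im + deg w * s.im| := by
    have := abs_sub_abs_le_abs_sub (deg w * s.im) (-ξ.im)
    rw [abs_mul, abs_neg, abs_of_pos hd0, sub_neg_eq_add, add_comm _ ξ.im] at this
    exact this
  have hds : |s.im| ≤ deg w * |s.im| := le_mul_of_one_le_left (abs_nonneg _) hd
  have hnum := hC (1 + ξ + deg w * s) (by rw [hre]; gcongr) (by rw [hre]; gcongr)
    (by rw [him]; linarith)
  have hden : (∏ j, c j) * Real.exp (-(Real.pi / 2) * (deg w * |s.im|)) ≤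
      ‖∏ j, Gamma (1 + w j * s)‖ := by
    have : Real.exp (-(Real.pi / 2) * (deg w * |s.im|)) =
        ∏ j, Real.exp (-(Real.pi / 2) * (w j * |s.im|)) := by
      rw [← Real.exp_sum, ← Finset.mul_sum, ← Finset.sum_mul, deg]
      push_cast
      rfl
    rw [this, ← Finset.prod_mul_distrib, norm_prod]
    refine Finset.prod_le_prod (fun j _ => mul_nonneg (hc0 j).le (Real.exp_pos _).le) fun j _ => ?_
    have hwj : (1 : ℝ) ≤ w j := by exact_mod_cast hpos j
    have h4 := hc j (1 + w j * s) (by simpa using mul_nonneg (by linarith) (ha.trans h1))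
      (by simp; gcongr) (by
        simp only [add_im, one_im, mul_im, natCast_re, natCast_im, zero_mul, add_zero, zero_add,
          abs_mul, Nat.abs_cast]
        nlinarith [abs_nonneg s.im, abs_nonneg ξ.im])
    simpa [abs_mul] using h4
  have hden0 : 0 < (∏ j, c j) * Real.exp (-(Real.pi / 2) * (deg w * |s.im|)) := by positivity
  rw [gammaRatio, norm_div, div_le_iff₀ (hden0.trans_le hden)]
  refine hnum.trans (le_trans ?_ (mul_le_mul_of_nonneg_left hden (by positivity)))
  have h5 : C * Real.exp ((Real.pi / 2 - δ') * |ξ.im|) / (∏ j, c j) * Real.exp (δ * |s.im|) *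
      ((∏ j, c j) * Real.exp (-(Real.pi / 2) * (deg w * |s.im|))) =
      C * Real.exp ((Real.pi / 2 - δ') * |ξ.im| + δ * |s.im| +
        -(Real.pi / 2) * (deg w * |s.im|)) := by
    rw [Real.exp_add, Real.exp_add]
    field_simp
  rw [h5, him]
  gcongr
  have h6 : (Real.pi / 2 - δ') * (deg w * |s.im| - |ξ.im|) ≤
      (Real.pi / 2 - δ') * |ξ.im + deg w * s.im| := by
    gcongr
  have h7 : δ' * deg w * |s.im| ≤ δ * |s.im| := by gcongr
  nlinarith

/-- The points `s_k = -(ξ + k) / d`, which for `k ≥ 1` are the poles of `gammaRatio`. -/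
def gammaPole (w : Fin N → ℕ) (ξ : ℂ) (k : ℤ) : ℂ := -(ξ + k) / deg w

/-- The residue of `gammaRatio` at `s_k`. The value of `Gamma` at the integers `k ≤ 0` is zero in
Mathlib, so that this is zero for `k ≤ 0`, in accordance with the absence of a pole. -/
def gammaRes (w : Fin N → ℕ) (ξ : ℂ) (k : ℤ) : ℂ :=
  (-1) ^ (k - 1) / (deg w * Gamma k * ∏ j, Gamma (1 - (charge w j : ℂ) * (k + ξ)))

theorem tendsto_add_mul_Gamma_neg_nat (n : ℕ) :
    Tendsto (fun z : ℂ => (z + n) * Gamma z) (𝓝[≠] (-n : ℂ)) (𝓝 ((-1) ^ n / n.factorial)) := by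
  induction n with
  | zero => simpa using tendsto_self_mul_Gamma_nhds_zero
  | succ n ih =>
    have hne : (-((n + 1 : ℕ) : ℂ)) ≠ 0 := neg_ne_zero.2 (Nat.cast_ne_zero.2 n.succ_ne_zero)
    have h1 : Tendsto (fun z : ℂ => z + 1) (𝓝[≠] (-((n + 1 : ℕ) : ℂ))) (𝓝[≠] (-n : ℂ)) := by
      refine tendsto_nhdsWithin_iff.2 ⟨?_, ?_⟩
      · have : Tendsto (fun z : ℂ => z + 1) (𝓝 (-((n + 1 : ℕ) : ℂ)))
            (𝓝 (-((n + 1 : ℕ) : ℂ) + 1)) := Continuous.tendsto (by fun_prop) _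
        rw [show (-((n + 1 : ℕ) : ℂ) + 1) = -n by push_cast; ring] at this
        exact this.mono_left nhdsWithin_le_nhds
      · filter_upwards [self_mem_nhdsWithin] with z hz h
        refine hz ?_
        rw [mem_singleton_iff] at h ⊢
        push_cast
        linear_combination h
    have h2 : Tendsto (fun z : ℂ => z⁻¹) (𝓝[≠] (-((n + 1 : ℕ) : ℂ)))
        (𝓝 (-((n + 1 : ℕ) : ℂ))⁻¹) :=
      (continuousAt_inv₀ hne).tendsto.mono_left nhdsWithin_le_nhds
    have h3 := (ih.comp h1).mul h2
    have h4 : ((-1) ^ n / (n.factorial : ℂ)) * (-((n + 1 : ℕ) : ℂ))⁻¹ =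
        (-1) ^ (n + 1) / ((n + 1).factorial : ℂ) := by
      rw [Nat.factorial_succ]
      push_cast
      have : (n.factorial : ℂ) ≠ 0 := Nat.cast_ne_zero.2 n.factorial_ne_zero
      have h5 : (n + 1 : ℂ) ≠ 0 := by exact_mod_cast n.succ_ne_zero
      rw [inv_neg]
      field_simp
      ring
    rw [h4] at h3
    refine h3.congr' ?_
    have h0 : ∀ᶠ z : ℂ in 𝓝[≠] (-((n + 1 : ℕ) : ℂ)), z ≠ 0 :=
      nhdsWithin_le_nhds (isOpen_ne.mem_nhds hne)
    filter_upwards [h0] with z hz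
    simp only [Function.comp, Gamma_add_one z hz]
    push_cast
    field_simp
    ring

theorem tendsto_sub_mul_gammaRatio {w : Fin N → ℕ} (hpos : ∀ j, 0 < w j) (hN : 0 < N) (ξ : ℂ)
    (k : ℤ) : Tendsto (fun s => (s - gammaPole w ξ k) * gammaRatio w ξ s) (𝓝[≠] gammaPole w ξ k)
      (𝓝 (gammaRes w ξ k)) := by
  have hd : (deg w : ℂ) ≠ 0 := by exact_mod_cast (deg_pos hpos hN).ne'
  have harg : 1 + ξ + deg w * gammaPole w ξ k = 1 - k := by
    rw [gammaPole]; field_simp; ring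
  have hprod : (∏ j, Gamma (1 + w j * gammaPole w ξ k))⁻¹ =
      (∏ j, Gamma (1 - (charge w j : ℂ) * (k + ξ)))⁻¹ := by
    congr 1
    refine Finset.prod_congr rfl fun j _ => ?_
    rw [gammaPole, charge]
    push_cast
    congr 1
    field_simp
    ring
  have hinv := ((differentiable_inv_prod_Gamma w).continuous.tendsto (gammaPole w ξ k)).mono_left
    (nhdsWithin_le_nhds (s := {gammaPole w ξ k}ᶜ))
  rw [hprod] at hinv
  have hG : Tendsto (fun s => (s - gammaPole w ξ k) * Gamma (1 + ξ + deg w * s))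
      (𝓝[≠] gammaPole w ξ k) (𝓝 ((-1) ^ (k - 1) / (deg w * Gamma k))) := by
    rcases le_or_gt k 0 with hk | hk
    · have h0 : Gamma (k : ℂ) = 0 := by
        obtain ⟨n, rfl⟩ : ∃ n : ℕ, k = -n := ⟨(-k).toNat, by omega⟩
        simpa using Gamma_neg_nat_eq_zero n
      rw [h0, mul_zero, div_zero]
      have hc : ContinuousAt (fun s => (s - gammaPole w ξ k) * Gamma (1 + ξ + deg w * s))
          (gammaPole w ξ k) := by
        refine ContinuousAt.mul (by fun_prop) ?_
        refine ContinuousAt.comp (g := Gamma) (DifferentiableAt.continuousAt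
          (differentiableAt_Gamma _ fun m h => ?_)) (by fun_prop)
        rw [harg] at h
        have : (1 - k : ℤ) = -m := by exact_mod_cast h
        omega
      have := hc.tendsto
      rw [sub_self, zero_mul] at this
      exact this.mono_left nhdsWithin_le_nhds
    · obtain ⟨n, rfl⟩ : ∃ n : ℕ, k = n + 1 := ⟨(k - 1).toNat, by omega⟩
      have h1 : Tendsto (fun s => 1 + ξ + deg w * s) (𝓝[≠] gammaPole w ξ (n + 1))
          (𝓝[≠] (-n : ℂ)) := by
        refine tendsto_nhdsWithin_iff.2 ⟨?_, ?_⟩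
        · have : Tendsto (fun s => 1 + ξ + deg w * s) (𝓝 (gammaPole w ξ (n + 1)))
              (𝓝 (1 + ξ + deg w * gammaPole w ξ (n + 1))) := Continuous.tendsto (by fun_prop) _
          rw [harg, show (1 - ((n + 1 : ℤ) : ℂ)) = -n by push_cast; ring] at this
          exact this.mono_left nhdsWithin_le_nhds
        · filter_upwards [self_mem_nhdsWithin] with s hs h
          refine hs ?_
          rw [mem_singleton_iff] at h ⊢
          rw [gammaPole, eq_div_iff hd]
          push_cast
          linear_combination h
      have h2 := ((tendsto_add_mul_Gamma_neg_nat n).comp h1).const_mul (deg w : ℂ)⁻¹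
      have h3 : (deg w : ℂ)⁻¹ * ((-1) ^ n / (n.factorial : ℂ)) =
          (-1) ^ ((n + 1 : ℤ) - 1) / (deg w * Gamma ((n + 1 : ℤ) : ℂ)) := by
        push_cast
        rw [Gamma_nat_eq_factorial, add_sub_cancel_right, zpow_natCast]
        field_simp
      rw [h3] at h2
      refine h2.congr fun s => ?_
      simp only [Function.comp, gammaPole]
      push_cast
      field_simp
      ring
  refine ((hG.mul hinv).congr fun s => ?_).trans (le_of_eq ?_)
  · rw [gammaRatio]; ring
  · rw [gammaRes, ← div_eq_mul_inv, div_div]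

/-! ### The periodic kernel -/

/-- The kernel `-W ^ l / (W - 1)` with `W = e^{2πi(c - s)}`. As a function of `s` it is
periodic, and it has simple poles with residue `1 / 2πi` at the points of `c + ℤ`. -/
def kern (l : ℤ) (c s : ℂ) : ℂ :=
  -(exp (2 * Real.pi * I * (c - s)) ^ l / (exp (2 * Real.pi * I * (c - s)) - 1))

theorem kern_eq_of_sub_eq (l : ℤ) {c s c' s' : ℂ} (n : ℤ) (h : c - s = c' - s' + n) :
    kern l c s = kern l c' s' := by
  have : exp (2 * Real.pi * I * (c - s)) = exp (2 * Real.pi * I * (c' - s')) := by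
    rw [exp_eq_exp_iff_exists_int]
    exact ⟨n, by rw [h]; ring⟩
  rw [kern, kern, this]

theorem exp_two_pi_I_mul_eq_one {x : ℂ} : exp (2 * Real.pi * I * x) = 1 ↔ ∃ n : ℤ, x = n := by
  rw [exp_eq_one_iff]
  refine exists_congr fun n => ?_
  rw [mul_comm (n : ℂ)]
  exact mul_right_inj' two_pi_I_ne_zero

theorem differentiableAt_kern (l : ℤ) {c s : ℂ} (h : ∀ n : ℤ, c - s ≠ n) :
    DifferentiableAt ℂ (kern l c) s := by
  have h1 : exp (2 * Real.pi * I * (c - s)) - 1 ≠ 0 := fun h0 => by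
    obtain ⟨n, hn⟩ := exp_two_pi_I_mul_eq_one.1 (sub_eq_zero.1 h0)
    exact h n hn
  unfold kern
  have h2 : DifferentiableAt ℂ (fun s : ℂ => exp (2 * Real.pi * I * (c - s))) s := by fun_prop
  exact ((h2.zpow (Or.inl (exp_ne_zero _))).div (h2.sub_const 1) h1).neg

theorem tendsto_sub_mul_kern (l : ℤ) (c : ℂ) (m : ℤ) :
    Tendsto (fun s => (s - (c + m)) * kern l c s) (𝓝[≠] (c + m)) (𝓝 (2 * Real.pi * I)⁻¹) := by
  have hval : exp (2 * Real.pi * I * (c - (c + m))) = 1 :=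
    exp_two_pi_I_mul_eq_one.2 ⟨-m, by push_cast; ring⟩
  have hd : HasDerivAt (fun s : ℂ => exp (2 * Real.pi * I * (c - s))) (-(2 * Real.pi * I))
      (c + m) := by
    have := (((hasDerivAt_id' (c + m : ℂ)).const_sub c).const_mul (2 * Real.pi * I)).cexp
    rw [hval] at this
    simpa using this
  have h1 := hd.tendsto_slope.inv₀ (neg_ne_zero.2 two_pi_I_ne_zero)
  have h2 : Tendsto (fun s : ℂ => exp (2 * Real.pi * I * (c - s)) ^ l) (𝓝[≠] (c + m)) (𝓝 1) := by
    have : ContinuousAt (fun s : ℂ => exp (2 * Real.pi * I * (c - s)) ^ l) (c + m) :=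
      ContinuousAt.zpow₀ (by fun_prop) _ (Or.inl (exp_ne_zero _))
    have := this.tendsto
    rw [hval, one_zpow] at this
    exact this.mono_left nhdsWithin_le_nhds
  have h3 := (h2.mul h1).neg
  rw [one_mul, inv_neg, neg_neg] at h3
  refine h3.congr fun s => ?_
  rw [slope_def_field, hval, inv_div, kern]
  ring

theorem norm_kern_le_of_le (l : ℤ) {c s : ℂ} (h : |c.im| + 1 ≤ s.im) :
    ‖kern l c s‖ ≤ 2 * Real.exp (2 * Real.pi * (l - 1) * (s.im - c.im)) := by
  have hn : ‖exp (2 * Real.pi * I * (c - s))‖ = Real.exp (2 * Real.pi * (s.im - c.im)) := by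
    rw [norm_exp]; congr 1; simp; ring
  have hpi := Real.pi_gt_three
  have h1 : 1 ≤ s.im - c.im := by linarith [le_abs_self c.im]
  have h2 : 2 ≤ Real.exp (2 * Real.pi * (s.im - c.im)) := by
    have := Real.add_one_le_exp (2 * Real.pi * (s.im - c.im))
    nlinarith
  have h3 : Real.exp (2 * Real.pi * (s.im - c.im)) / 2 ≤
      ‖exp (2 * Real.pi * I * (c - s)) - 1‖ := by
    have := norm_sub_norm_le (exp (2 * Real.pi * I * (c - s))) 1
    rw [hn, norm_one] at this
    linarith
  rw [kern, norm_neg, norm_div, norm_zpow, hn, div_le_iff₀ (by linarith)]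
  calc _ = 2 * Real.exp (2 * Real.pi * (l - 1) * (s.im - c.im)) *
        (Real.exp (2 * Real.pi * (s.im - c.im)) / 2) := by
        rw [← Real.rpow_intCast, ← Real.exp_mul, mul_comm (2 : ℝ) (Real.exp _),
          mul_assoc (Real.exp _) 2,
          mul_div_cancel₀ _ two_ne_zero, ← Real.exp_add]
        ring_nf
    _ ≤ _ := by gcongr

theorem norm_kern_le_of_ge (l : ℤ) {c s : ℂ} (h : s.im ≤ -(|c.im| + 1)) :
    ‖kern l c s‖ ≤ 2 * Real.exp (2 * Real.pi * l * (s.im - c.im)) := by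
  have hn : ‖exp (2 * Real.pi * I * (c - s))‖ = Real.exp (2 * Real.pi * (s.im - c.im)) := by
    rw [norm_exp]; congr 1; simp; ring
  have hpi := Real.pi_gt_three
  have h1 : 1 ≤ c.im - s.im := by linarith [neg_abs_le c.im]
  have h2 : Real.exp (2 * Real.pi * (s.im - c.im)) ≤ 1 / 2 := by
    rw [show 2 * Real.pi * (s.im - c.im) = -(2 * Real.pi * (c.im - s.im)) by ring, Real.exp_neg,
      inv_eq_one_div]
    have := Real.add_one_le_exp (2 * Real.pi * (c.im - s.im))
    gcongr
    nlinarith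
  have h3 : 1 / 2 ≤ ‖exp (2 * Real.pi * I * (c - s)) - 1‖ := by
    have := norm_sub_norm_le 1 (exp (2 * Real.pi * I * (c - s)))
    rw [hn, norm_one, norm_sub_rev] at this
    linarith
  rw [kern, norm_neg, norm_div, norm_zpow, hn, div_le_iff₀ (by linarith)]
  calc _ = 2 * Real.exp (2 * Real.pi * l * (s.im - c.im)) * (1 / 2) := by
        rw [← Real.rpow_intCast, ← Real.exp_mul]
        ring_nf
    _ ≤ _ := by gcongr

/-! ### The Mellin-Barnes integral -/

/-- The function `s ↦ v^s Γ(1 + ξ + d s) / ∏_j Γ(1 + w_j s)`, with `t = log v`. -/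
def gammaTerm (w : Fin N → ℕ) (ξ t s : ℂ) : ℂ := gammaRatio w ξ s * exp (t * s)

/-- The Mellin-Barnes integrand, with poles at the points of `c + ℤ` and at the poles of
`gammaRatio`. -/
def mbIntegrand (w : Fin N → ℕ) (ξ : ℂ) (l : ℤ) (c t s : ℂ) : ℂ :=
  gammaTerm w ξ t s * kern l c s

/-- The Mellin-Barnes integrand decays exponentially along vertical lines when `Im log v` lies in
the `l`-th window, since `v^s` times the kernel does. -/
theorem exists_norm_mbIntegrand_le {w : Fin N → ℕ} (hpos : ∀ j, 0 < w j) (hN : 0 < N) {ξ : ℂ}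
    (l : ℤ) {a b : ℝ} (ha : 0 ≤ a) (ha' : 0 < 1 + ξ.re + deg w * a) {δ : ℝ} (hδ : 0 < δ) (B : ℝ) :
    ∃ C T, ∀ c t s : ℂ, |c.im| ≤ B → |t.re| ≤ B → 2 * (l - 1) * Real.pi + 2 * δ ≤ t.im →
      t.im ≤ 2 * l * Real.pi - 2 * δ → a ≤ s.re → s.re ≤ b → T ≤ |s.im| →
      ‖mbIntegrand w ξ l c t s‖ ≤ C * Real.exp (-δ * |s.im|) := by
  obtain ⟨C, T, hC0, hC⟩ := exists_norm_gammaRatio_le hpos hN (b := b) ha ha' hδ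
  set E : ℝ := 2 * Real.pi * (|(l : ℝ)| + 1) * B with hE
  refine ⟨C * (Real.exp (B * b) * (2 * Real.exp E)), max T (B + 1),
    fun c t s hc ht h1 h2 h3 h4 h5 => ?_⟩
  have hB : 0 ≤ B := (abs_nonneg _).trans hc
  have hpi := Real.pi_pos
  have hR := hC s h3 h4 ((le_max_left _ _).trans h5)
  have h6 : B + 1 ≤ |s.im| := (le_max_right _ _).trans h5
  have he : ‖exp (t * s)‖ ≤ Real.exp (B * b) * Real.exp (-(t.im * s.im)) := by
    rw [norm_exp, mul_re, sub_eq_add_neg, Real.exp_add]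
    have hs0 := ha.trans h3
    have : t.re * s.re ≤ B * b :=
      (mul_le_mul_of_nonneg_right (le_abs_self _) hs0).trans (mul_le_mul ht h4 hs0 hB)
    gcongr
  have hcB : -B ≤ c.im ∧ c.im ≤ B := abs_le.1 hc
  have hk : Real.exp (-(t.im * s.im)) * ‖kern l c s‖ ≤
      2 * Real.exp E * Real.exp (-(2 * δ) * |s.im|) := by
    rcases le_total 0 s.im with h0 | h0
    · rw [abs_of_nonneg h0] at h6 ⊢
      have h7 : 2 * Real.pi * (l - 1) * (-c.im) ≤ E := by
        calc 2 * Real.pi * (l - 1) * (-c.im) ≤ |2 * Real.pi * (l - 1) * (-c.im)| := le_abs_self _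
          _ = 2 * Real.pi * |(l : ℝ) - 1| * |c.im| := by
            rw [abs_mul, abs_mul, abs_neg, abs_of_pos (by positivity : 0 < 2 * Real.pi)]
          _ ≤ E := by
            rw [hE]
            have := abs_sub (l : ℝ) 1
            rw [abs_one] at this
            gcongr
      calc _ ≤ Real.exp (-(t.im * s.im)) *
            (2 * Real.exp (2 * Real.pi * (l - 1) * (s.im - c.im))) := by
            gcongr; exact norm_kern_le_of_le l (by linarith)
        _ = 2 * Real.exp (2 * Real.pi * (l - 1) * (-c.im)) *
            Real.exp (-((t.im - 2 * (l - 1) * Real.pi) * s.im)) := by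
            rw [mul_left_comm, ← Real.exp_add, mul_assoc (2 : ℝ) (Real.exp _), ← Real.exp_add]
            ring_nf
        _ ≤ 2 * Real.exp E * Real.exp (-(2 * δ) * s.im) := by
            rw [neg_mul]
            gcongr
            linarith
    · rw [abs_of_nonpos h0] at h6 ⊢
      have h7 : 2 * Real.pi * l * (-c.im) ≤ E := by
        calc 2 * Real.pi * l * (-c.im) ≤ |2 * Real.pi * l * (-c.im)| := le_abs_self _
          _ = 2 * Real.pi * |(l : ℝ)| * |c.im| := by
            rw [abs_mul, abs_mul, abs_neg, abs_of_pos (by positivity : 0 < 2 * Real.pi)]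
          _ ≤ E := by
            rw [hE]
            gcongr
            linarith
      calc _ ≤ Real.exp (-(t.im * s.im)) *
            (2 * Real.exp (2 * Real.pi * l * (s.im - c.im))) := by
            gcongr; exact norm_kern_le_of_ge l (by linarith)
        _ = 2 * Real.exp (2 * Real.pi * l * (-c.im)) *
            Real.exp (-((2 * l * Real.pi - t.im) * -s.im)) := by
            rw [mul_left_comm, ← Real.exp_add, mul_assoc (2 : ℝ) (Real.exp _), ← Real.exp_add]
            ring_nf
        _ ≤ 2 * Real.exp E * Real.exp (-(2 * δ) * -s.im) := by
            rw [neg_mul]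
            gcongr
            · linarith
            · linarith
  rw [mbIntegrand, gammaTerm, norm_mul, norm_mul, mul_assoc]
  calc _ ≤ C * Real.exp (δ * |s.im|) *
        (Real.exp (B * b) * Real.exp (-(t.im * s.im)) * ‖kern l c s‖) := by gcongr
    _ = C * Real.exp (δ * |s.im|) *
        (Real.exp (B * b) * (Real.exp (-(t.im * s.im)) * ‖kern l c s‖)) := by ring
    _ ≤ C * Real.exp (δ * |s.im|) *
        (Real.exp (B * b) * (2 * Real.exp E * Real.exp (-(2 * δ) * |s.im|))) := by gcongr
    _ = C * (Real.exp (B * b) * (2 * Real.exp E)) *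
        (Real.exp (δ * |s.im|) * Real.exp (-(2 * δ) * |s.im|)) := by ring
    _ = _ := by rw [← Real.exp_add]; ring_nf

theorem norm_exp_mul_lt_one {t : ℂ} {v : ℝ} (hv : 0 < v) (ht : t.re < Real.log v) :
    ‖(v : ℂ)⁻¹ * exp t‖ < 1 := by
  rw [norm_mul, norm_inv, norm_exp, norm_real, Real.norm_of_nonneg hv.le, inv_mul_lt_iff₀ hv,
    mul_one, ← Real.lt_log_iff_exp_lt hv]
  exact ht

theorem norm_mul_exp_neg_lt_one {t : ℂ} {v : ℝ} (hv : 0 < v) (ht : Real.log v < t.re) :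
    ‖(v : ℂ) * exp (-t)‖ < 1 := by
  rw [norm_mul, norm_exp, norm_real, Real.norm_of_nonneg hv.le, neg_re, Real.exp_neg,
    ← div_eq_mul_inv, div_lt_one (Real.exp_pos _), ← Real.log_lt_iff_lt_exp hv]
  exact ht

theorem gammaTerm_add_one {w : Fin N → ℕ} {ξ t s : ℂ} (h1 : stepNum w ξ s ≠ 0)
    (h2 : stepDen w s ≠ 0) :
    gammaTerm w ξ t (s + 1) = stepNum w ξ s / stepDen w s * exp t * gammaTerm w ξ t s := by
  have h := gammaRatio_add_one w h1
  rw [gammaTerm, gammaTerm, mul_add, mul_one, exp_add]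
  have : gammaRatio w ξ (s + 1) = stepNum w ξ s / stepDen w s * gammaRatio w ξ s := by
    field_simp
    linear_combination -h
  rw [this]
  ring

theorem gammaTerm_sub_one {w : Fin N → ℕ} {ξ t s : ℂ} (h1 : stepNum w ξ s ≠ 0) :
    gammaTerm w ξ t s = stepDen w s / stepNum w ξ s * exp (-t) * gammaTerm w ξ t (s + 1) := by
  have h := gammaRatio_add_one w h1
  rw [gammaTerm, gammaTerm, mul_add, mul_one, exp_add, exp_neg]
  have : gammaRatio w ξ s = stepDen w s / stepNum w ξ s * gammaRatio w ξ (s + 1) := by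
    field_simp
    linear_combination h
  rw [this]
  field_simp [exp_ne_zero]

theorem stepDen_ne_zero (w : Fin N → ℕ) {s : ℂ} (h : ∀ j, -1 < (w j : ℝ) * s.re) :
    stepDen w s ≠ 0 := by
  refine Finset.prod_ne_zero_iff.2 fun j _ => Finset.prod_ne_zero_iff.2 fun i _ h0 => ?_
  have := congrArg Complex.re h0
  simp at this
  linarith [Nat.cast_nonneg (α := ℝ) i, h j]

theorem stepNum_ne_zero (w : Fin N → ℕ) {ξ s : ℂ}
    (h : ∀ k : ℤ, k ≤ deg w → ξ + deg w * s ≠ -k) : stepNum w ξ s ≠ 0 := by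
  refine Finset.prod_ne_zero_iff.2 fun i hi h0 => ?_
  have := Finset.mem_range.1 hi
  refine h (i + 1) (by omega) ?_
  push_cast
  linear_combination h0

/-! ### Closing the Mellin-Barnes contour -/

/-- The line `Re s = σ` separates `c - 1` from `c`, it contains no point `s_k`, the arguments of all
Gamma functions have positive real part on the strip `σ - 1 ≤ Re s`, and no point of
`c + ℤ` is an `s_k`. -/
structure IsSeparating (w : Fin N → ℕ) (ξ c : ℂ) (σ : ℝ) : Prop where
  one_le : 1 ≤ σ
  arg_pos : 0 < 1 + ξ.re + deg w * (σ - 1)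
  avoid : ∀ k : ℤ, deg w * σ + ξ.re ≠ k
  lt_re : σ < c.re
  re_lt : c.re < σ + 1
  generic : ∀ n : ℤ, ξ + deg w * c ≠ n

/-- The imaginary part of `t = log v` lies in the `l`-th window. -/
def InWindow (l : ℤ) (t : ℂ) : Prop :=
  2 * ((l : ℝ) - 1) * Real.pi < t.im ∧ t.im < 2 * (l : ℝ) * Real.pi

theorem InWindow.exists_gap {l : ℤ} {t : ℂ} (ht : InWindow l t) :
    ∃ δ, 0 < δ ∧ 2 * ((l : ℝ) - 1) * Real.pi + 2 * δ < t.im ∧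
      t.im < 2 * (l : ℝ) * Real.pi - 2 * δ := by
  obtain ⟨h1, h2⟩ := ht
  refine ⟨min (t.im - 2 * ((l : ℝ) - 1) * Real.pi) (2 * (l : ℝ) * Real.pi - t.im) / 4, ?_, ?_, ?_⟩
  · have : 0 < min (t.im - 2 * ((l : ℝ) - 1) * Real.pi) (2 * (l : ℝ) * Real.pi - t.im) :=
      lt_min (by linarith) (by linarith)
    linarith
  · linarith [min_le_left (t.im - 2 * ((l : ℝ) - 1) * Real.pi) (2 * (l : ℝ) * Real.pi - t.im)]
  · linarith [min_le_right (t.im - 2 * ((l : ℝ) - 1) * Real.pi) (2 * (l : ℝ) * Real.pi - t.im)]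

theorem eq_gammaPole_of {w : Fin N → ℕ} (hd : (deg w : ℂ) ≠ 0) {ξ s : ℂ} {k : ℤ}
    (h : ξ + deg w * s = -k) : s = gammaPole w ξ k := by
  rw [gammaPole, eq_div_iff hd]
  linear_combination h

theorem differentiableAt_gammaTerm (w : Fin N → ℕ) {ξ t s : ℂ}
    (h : ∀ k : ℤ, 1 ≤ k → ξ + deg w * s ≠ -k) : DifferentiableAt ℂ (gammaTerm w ξ t) s := by
  refine (differentiableAt_gammaRatio w fun k hk => h (k + 1) (by omega) ?_).mul (by fun_prop)
  push_cast
  linear_combination hk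

theorem tendsto_sub_mul_mbIntegrand {w : Fin N → ℕ} {ξ t c : ℂ} (l m : ℤ)
    (h : ∀ k : ℤ, 1 ≤ k → ξ + deg w * (c + m) ≠ -k) :
    Tendsto (fun s => (s - (c + m)) * mbIntegrand w ξ l c t s) (𝓝[≠] (c + m))
      (𝓝 ((2 * Real.pi * I)⁻¹ * gammaTerm w ξ t (c + m))) := by
  have h1 := (differentiableAt_gammaTerm w (t := t) h).continuousAt.tendsto.mono_left
    (nhdsWithin_le_nhds (s := {c + (m : ℂ)}ᶜ))
  refine ((tendsto_sub_mul_kern l c m).mul h1).congr fun s => ?_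
  rw [mbIntegrand]
  ring

/-- Closing to the right, for `|v| < v_c`: the residues are the summands of the Gromov-Witten
`H`-function. -/
theorem tendsto_sum_gammaTerm {w : Fin N → ℕ} (hpos : ∀ j, 0 < w j) (hN : 0 < N) {ξ c t : ℂ}
    {l : ℤ} {σ : ℝ} (hσ : IsSeparating w ξ c σ) (htw : InWindow l t)
    (htv : t.re < Real.log (vc w)) :
    Tendsto (fun n => ∑ M ∈ Finset.range n, gammaTerm w ξ t (c + M)) atTop
      (𝓝 (-I * ∫ τ : ℝ, mbIntegrand w ξ l c t (σ + τ * I))) := by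
  have hd : (0 : ℝ) < deg w := by exact_mod_cast deg_pos hpos hN
  obtain ⟨δ, hδ, hδ1, hδ2⟩ := htw.exists_gap
  obtain ⟨C, T, hC⟩ := exists_norm_mbIntegrand_le hpos hN (ξ := ξ) l (a := σ - 1) (b := σ + 1)
    (by linarith [hσ.one_le]) hσ.arg_pos hδ (max |c.im| |t.re|)
  have hre : ∀ s : ℂ, σ ≤ s.re → ∀ k : ℤ, 1 ≤ k → ξ + deg w * s ≠ -k := by
    intro s hs k hk h
    have h1 := congrArg Complex.re h
    simp only [add_re, mul_re, natCast_re, natCast_im, zero_mul, sub_zero, neg_re, intCast_re] at h1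
    have h2 : (1 : ℝ) ≤ k := by exact_mod_cast hk
    have h3 : (deg w : ℝ) * (σ - 1) ≤ deg w * s.re := by gcongr; linarith
    linarith [hσ.arg_pos]
  have hnum : ∀ s : ℂ, σ ≤ s.re → stepNum w ξ s ≠ 0 := by
    intro s hs
    refine Finset.prod_ne_zero_iff.2 fun i _ h => hre s hs (i + 1) (by omega) ?_
    push_cast
    linear_combination h
  have hlab : ∀ M : ℕ, σ ≤ (c + (M : ℤ)).re := fun M => by
    simp; linarith [hσ.lt_re, Nat.cast_nonneg (α := ℝ) M]
  have key := tendsto_sum_residues (g := mbIntegrand w ξ l c t)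
    (q := fun s => stepNum w ξ s / stepDen w s * exp t) (σ := σ) (C := C)
    (T := max T (|c.im| + 1)) (ε := δ) (ι := Unit) (c := fun M _ => c + (M : ℤ))
    (r := fun M _ => (2 * Real.pi * I)⁻¹ * gammaTerm w ξ t (c + (M : ℤ))) hδ
    (norm_exp_mul_lt_one (vc_pos hpos hN) htv)
    ((tendsto_stepNum_div_stepDen hpos hN ξ).mul_const _)
    (fun M => Function.injective_of_subsingleton _)
    (fun M _ => by simp; linarith [hσ.lt_re]) (fun M _ => by simp; linarith [hσ.re_lt])
    (fun M _ => by simp) ?_ ?_ ?_ ?_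
  · have hpi : (Real.pi : ℂ) ≠ 0 := by exact_mod_cast Real.pi_ne_zero
    have := key.const_mul (2 * Real.pi * I)
    refine (this.congr fun n => ?_).trans (le_of_eq ?_)
    · rw [Finset.mul_sum]
      refine Finset.sum_congr rfl fun M _ => ?_
      rw [Finset.sum_const, Finset.card_univ, Fintype.card_unit, one_smul,
        mul_inv_cancel_left₀ two_pi_I_ne_zero, Int.cast_natCast]
    · congr 1
      field_simp
  · intro s hs hne
    refine (differentiableAt_gammaTerm w (hre s hs)).mul (differentiableAt_kern l fun n hn => ?_)
    have h1 : s = c - n := by linear_combination -hn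
    have h2 := congrArg Complex.re h1
    simp at h2
    have h3 : (n : ℝ) < 1 := by linarith [hσ.re_lt]
    have h4 : n < 1 := by exact_mod_cast h3
    refine hne (-n).toNat () ?_
    rw [h1, Int.toNat_of_nonneg (by omega)]
    push_cast
    ring
  · intro M _
    exact tendsto_sub_mul_mbIntegrand l _ (hre _ (hlab M))
  · intro s hs _
    rw [mbIntegrand, mbIntegrand, gammaTerm_add_one (hnum s hs)
      (stepDen_ne_zero w fun j => neg_one_lt_zero.trans_le
        (mul_nonneg (Nat.cast_nonneg _) (by linarith [hσ.one_le]))),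
      kern_eq_of_sub_eq l (c := c) (s := s + 1) (c' := c) (s' := s) (-1) (by push_cast; ring),
      mul_assoc]
  · intro s h1 h2 h3
    exact hC c t s (le_max_left _ _) (le_max_right _ _) hδ1.le hδ2.le (by linarith) h2
      ((le_max_left _ _).trans h3)

/-- The first integer `k` such that `s_k` lies to the left of the line `Re s = σ`. -/
def poleStart (w : Fin N → ℕ) (ξ : ℂ) (σ : ℝ) : ℤ := -⌊deg w * σ + ξ.re⌋

/-- Closing to the left, for `|v| > v_c`: there are two families of residues, at the points
`c - 1, c - 2, …` and at the poles of `gammaRatio`. -/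
theorem tendsto_sum_gammaRes {w : Fin N → ℕ} (hpos : ∀ j, 0 < w j) (hN : 0 < N) {ξ c t : ℂ}
    {l : ℤ} {σ : ℝ} (hσ : IsSeparating w ξ c σ) (htw : InWindow l t)
    (htv : Real.log (vc w) < t.re) :
    Tendsto (fun n => ∑ M ∈ Finset.range n, (gammaTerm w ξ t (c - 1 - M) + 2 * Real.pi * I *
        ∑ i : Fin (deg w), gammaRes w ξ (deg w * M + poleStart w ξ σ + i) *
          exp (t * gammaPole w ξ (deg w * M + poleStart w ξ σ + i)) *
          kern l c (gammaPole w ξ (deg w * M + poleStart w ξ σ + i)))) atTop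
      (𝓝 (I * ∫ τ : ℝ, mbIntegrand w ξ l c t (σ + τ * I))) := by
  have hd' := deg_pos hpos hN
  have hd : (0 : ℝ) < deg w := by exact_mod_cast hd'
  have hdc : (deg w : ℂ) ≠ 0 := by exact_mod_cast hd'.ne'
  set y : ℝ := deg w * σ + ξ.re with hy
  have hfl : (⌊y⌋ : ℝ) < y := lt_of_le_of_ne (Int.floor_le y) fun h => hσ.avoid ⌊y⌋ h.symm
  have hfl' : y < ⌊y⌋ + 1 := Int.lt_floor_add_one y
  let K : ℕ → Fin (deg w) → ℤ := fun M i => deg w * M + poleStart w ξ σ + i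
  have hK : ∀ M i, (K M i : ℝ) = deg w * M - ⌊y⌋ + (i : ℕ) := fun M i => by
    simp only [K, poleStart, ← hy]; push_cast; ring
  have hpre : ∀ k, (gammaPole w ξ k).re = -(ξ.re + k) / deg w := fun k => by
    rw [gammaPole, div_natCast_re]; simp
  have hpim : ∀ k, (gammaPole w ξ k).im = -ξ.im / deg w := fun k => by
    rw [gammaPole, div_natCast_im]; simp
  -- the points `s_k` with `Re s_k ≤ σ` are exactly the listed ones
  have hlist : ∀ k : ℤ, (gammaPole w ξ k).re ≤ σ → ∃ M i, k = K M i := by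
    intro k hk
    rw [hpre, div_le_iff₀ hd] at hk
    have h1 : (-⌊y⌋ - 1 : ℝ) < k := by linarith
    have h2 : -⌊y⌋ - 1 < k := by exact_mod_cast h1
    obtain ⟨j, hj⟩ := Int.eq_ofNat_of_zero_le (show 0 ≤ k + ⌊y⌋ by omega)
    refine ⟨j / deg w, ⟨j % deg w, Nat.mod_lt _ hd'⟩, ?_⟩
    have h3 : (deg w : ℤ) * ((j / deg w : ℕ) : ℤ) + ((j % deg w : ℕ) : ℤ) = j := by
      exact_mod_cast Nat.div_add_mod j (deg w)
    simp only [K, poleStart, ← hy]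
    omega
  obtain ⟨δ, hδ, hδ1, hδ2⟩ := htw.exists_gap
  obtain ⟨C, T, hC⟩ := exists_norm_mbIntegrand_le hpos hN (ξ := ξ) l (a := σ - 1) (b := σ + 1)
    (by linarith [hσ.one_le]) hσ.arg_pos hδ (max |c.im| |t.re|)
  let P : ℕ → Option (Fin (deg w)) → ℂ := fun M o =>
    o.elim (c + (-(M + 1 : ℤ) : ℤ)) fun i => gammaPole w ξ (K M i)
  let r : ℕ → Option (Fin (deg w)) → ℂ := fun M o =>
    o.elim ((2 * Real.pi * I)⁻¹ * gammaTerm w ξ t (c + (-(M + 1 : ℤ) : ℤ))) fun i =>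
      gammaRes w ξ (K M i) * exp (t * gammaPole w ξ (K M i)) * kern l c (gammaPole w ξ (K M i))
  have hcp : ∀ m k : ℤ, c + m ≠ gammaPole w ξ k := by
    intro m k h
    rw [gammaPole, eq_div_iff hdc] at h
    refine hσ.generic (-(k + deg w * m)) ?_
    push_cast
    linear_combination h
  -- the closing lemma is stated for the right half-plane, whence the substitution `s ↦ -s`
  have hneg : ∀ p : ℂ, Tendsto (fun s : ℂ => -s) (𝓝[≠] (-p)) (𝓝[≠] p) := by
    intro p
    refine tendsto_nhdsWithin_iff.2 ⟨?_, ?_⟩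
    · have : Tendsto (fun s : ℂ => -s) (𝓝 (-p)) (𝓝 (- -p)) := Continuous.tendsto (by fun_prop) _
      rw [neg_neg] at this
      exact this.mono_left nhdsWithin_le_nhds
    · filter_upwards [self_mem_nhdsWithin] with s hs h
      exact hs (by rw [mem_singleton_iff] at h ⊢; rw [← h, neg_neg])
  have hres : ∀ M o, Tendsto (fun s => (s - P M o) * mbIntegrand w ξ l c t s) (𝓝[≠] P M o)
      (𝓝 (r M o)) := by
    rintro M (_ | i)
    · refine tendsto_sub_mul_mbIntegrand l _ fun k _ h => ?_
      exact hcp _ k (eq_gammaPole_of hdc h)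
    · have h1 : ContinuousAt (fun s => exp (t * s) * kern l c s) (gammaPole w ξ (K M i)) :=
        ContinuousAt.mul (by fun_prop) (differentiableAt_kern l fun n hn =>
          hcp (-n) (K M i) (by push_cast; linear_combination hn)).continuousAt
      have h2 := (tendsto_sub_mul_gammaRatio hpos hN ξ (K M i)).mul
        (h1.tendsto.mono_left nhdsWithin_le_nhds)
      refine (h2.congr fun s => ?_).trans (le_of_eq ?_)
      · simp only [mbIntegrand, gammaTerm, P, Option.elim]; ring
      · simp only [r, Option.elim, mul_assoc]
  have hne1 : ∀ s : ℂ, -σ ≤ s.re → (∀ M o, s ≠ -P M o) → ∀ k : ℤ, ξ + deg w * -s ≠ -k := by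
    intro s hs hne k h
    have h1 := eq_gammaPole_of hdc h
    obtain ⟨M, i, hMi⟩ := hlist k (by rw [← h1, neg_re]; linarith)
    refine hne M (some i) ?_
    simp only [P, Option.elim, ← hMi, ← h1, neg_neg]
  have key := tendsto_sum_residues (g := fun s => mbIntegrand w ξ l c t (-s))
    (q := fun s => stepDen w (-1 - s) / stepNum w ξ (-1 - s) * exp (-t)) (σ := -σ) (C := C)
    (T := max T (|c.im| + |ξ.im| + 1)) (ε := δ) (ι := Option (Fin (deg w)))
    (c := fun M o => -P M o) (r := fun M o => -r M o) (L := vc w * exp (-t)) hδ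
    (norm_mul_exp_neg_lt_one (vc_pos hpos hN) htv)
    (((tendsto_stepDen_div_stepNum hpos hN ξ).comp (tendsto_const_sub_cobounded _)).mul_const _)
    ?_ ?_ ?_ ?_ ?_ ?_ ?_ ?_
  · have hpi : (Real.pi : ℂ) ≠ 0 := by exact_mod_cast Real.pi_ne_zero
    have h1 : ∫ τ : ℝ, mbIntegrand w ξ l c t (-((-σ : ℝ) + τ * I)) =
        ∫ τ : ℝ, mbIntegrand w ξ l c t (σ + τ * I) := by
      rw [← integral_neg_eq_self]
      congr 1
      ext τ
      congr 1
      push_cast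
      ring
    rw [h1] at key
    have := key.const_mul (-(2 * Real.pi * I))
    refine (this.congr fun n => ?_).trans (le_of_eq ?_)
    · rw [Finset.mul_sum]
      refine Finset.sum_congr rfl fun M _ => ?_
      rw [Fintype.sum_option, mul_add]
      simp only [r, Option.elim, K]
      rw [Finset.sum_neg_distrib, neg_mul_neg, neg_mul_neg, mul_inv_cancel_left₀ two_pi_I_ne_zero]
      congr 2
      push_cast
      ring
    · congr 1
      field_simp
  · intro M
    rintro (_ | i) (_ | i') h
    · rfl
    · exact absurd (neg_injective h) (hcp _ _)
    · exact absurd (neg_injective h).symm (hcp _ _)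
    · have h1 : gammaPole w ξ (K M i) = gammaPole w ξ (K M i') := neg_injective h
      rw [gammaPole, gammaPole, div_left_inj' hdc] at h1
      have h2 : (K M i : ℂ) = K M i' := by linear_combination -h1
      have h3 : K M i = K M i' := by exact_mod_cast h2
      simp only [K] at h3
      congr 1
      ext
      omega
  · rintro M (_ | i)
    · simp only [P, Option.elim]
      push_cast
      simp
      linarith [hσ.re_lt]
    · simp only [P, Option.elim, neg_re, hpre, hK]
      rw [neg_div, neg_neg, lt_div_iff₀ hd]
      have : (0 : ℝ) ≤ (i : ℕ) := Nat.cast_nonneg _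
      nlinarith
  · rintro M (_ | i)
    · simp only [P, Option.elim]
      push_cast
      simp
      linarith [hσ.lt_re]
    · simp only [P, Option.elim, neg_re, hpre, hK]
      rw [neg_div, neg_neg, div_lt_iff₀ hd]
      have : ((i : ℕ) : ℝ) + 1 ≤ deg w := by exact_mod_cast i.2
      nlinarith
  · rintro M (_ | i)
    · simp only [P, Option.elim]
      push_cast
      simp
      right
      linarith [abs_nonneg ξ.im]
    · simp only [P, Option.elim, neg_im, hpim]
      refine lt_of_lt_of_le ?_ (le_max_right _ _)
      have h1 : (1 : ℝ) ≤ deg w := by exact_mod_cast hd'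
      rw [neg_div, neg_neg, abs_div, Nat.abs_cast]
      have := div_le_self (abs_nonneg ξ.im) h1
      linarith [abs_nonneg c.im]
  · intro s hs hne
    refine DifferentiableAt.comp (g := mbIntegrand w ξ l c t) s ?_ (by fun_prop)
    refine (differentiableAt_gammaTerm w fun k _ => hne1 s hs hne k).mul
      (differentiableAt_kern l fun n hn => ?_)
    have h1 : s = n - c := by linear_combination hn
    have h2 := congrArg Complex.re h1
    simp at h2
    have h3 : (0 : ℝ) < n := by linarith [hσ.lt_re]
    have h4 : 0 < n := by exact_mod_cast h3
    refine hne (n - 1).toNat none ?_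
    simp only [P, Option.elim]
    rw [h1, Int.toNat_of_nonneg (by omega)]
    push_cast
    ring
  · intro M o
    refine ((hres M o).neg.comp (hneg (P M o))).congr fun s => ?_
    simp only [Function.comp]
    ring
  · intro s hs hne
    have h1 : stepNum w ξ (-1 - s) ≠ 0 := by
      refine stepNum_ne_zero w fun k _ h => hne1 s hs hne (k - deg w) ?_
      push_cast
      linear_combination h
    have h2 : -(s + 1) = -1 - s := by ring
    rw [h2, mbIntegrand, mbIntegrand, gammaTerm_sub_one h1, mul_assoc,
      kern_eq_of_sub_eq l (c := c) (s := -1 - s) (c' := c) (s' := -s) 1 (by push_cast; ring)]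
    congr 3
    ring
  · intro s h1 h2 h3
    have := hC c t (-s) (le_max_left _ _) (le_max_right _ _) hδ1.le hδ2.le
      (by rw [neg_re]; linarith) (by rw [neg_re]; linarith)
      (by rw [neg_im, abs_neg]; exact (le_max_left _ _).trans h3)
    rwa [neg_im, abs_neg] at this

/-! ### Holomorphic dependence on parameters -/

/-- An integral depends holomorphically on a parameter if the integrand does and is locally
uniformly dominated. -/
theorem differentiableOn_integral {α : Type*} [MeasurableSpace α] {μ : Measure α} {F : ℂ → α → ℂ}
    {U : Set ℂ} (hU : IsOpen U) (hm : ∀ t ∈ U, AEStronglyMeasurable (F t) μ)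
    (hd : ∀ a, DifferentiableOn ℂ (fun t => F t a) U)
    (hb : ∀ t₀ ∈ U, ∃ bound : α → ℝ, Integrable bound μ ∧ ∀ᶠ t in 𝓝 t₀, ∀ a, ‖F t a‖ ≤ bound a) :
    DifferentiableOn ℂ (fun t => ∫ a, F t a ∂μ) U := by
  intro t₀ ht₀
  obtain ⟨bound, hbi, hbe⟩ := hb t₀ ht₀
  obtain ⟨R, hR, hRs⟩ := Metric.mem_nhds_iff.1 (inter_mem (hU.mem_nhds ht₀) hbe)
  set r : ℝ := R / 2 with hr
  have hr0 : 0 < r := by positivity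
  have hball : ∀ t ∈ Metric.ball t₀ r, Metric.closedBall t r ⊆ Metric.ball t₀ R := by
    intro t ht x hx
    rw [Metric.mem_ball] at ht ⊢
    rw [Metric.mem_closedBall] at hx
    calc dist x t₀ ≤ dist x t + dist t t₀ := dist_triangle _ _ _
      _ < R := by linarith
  have hdiff : ∀ a, ∀ t ∈ Metric.ball t₀ r,
      HasDerivAt (fun t => F t a) (deriv (fun t => F t a) t) t :=
    fun a t ht => ((hd a).differentiableAt (hU.mem_nhds
      (hRs (hball t ht (Metric.mem_closedBall_self hr0.le))).1)).hasDerivAt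
  have hderb : ∀ a, ∀ t ∈ Metric.ball t₀ r, ‖deriv (fun t => F t a) t‖ ≤ bound a / r := by
    intro a t ht
    refine norm_deriv_le_of_forall_mem_sphere_norm_le hr0 ?_ fun x hx =>
      (hRs (hball t ht (Metric.sphere_subset_closedBall hx))).2 a
    exact ((hd a).mono fun x hx => (hRs (hball t ht hx)).1).diffContOnCl_ball subset_rfl
  have hmem : t₀ ∈ Metric.ball t₀ r := Metric.mem_ball_self hr0
  -- the derivative is measurable as a limit of difference quotients
  have hmeas : AEStronglyMeasurable (fun a => deriv (fun t => F t a) t₀) μ := by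
    let x : ℕ → ℂ := fun n => t₀ + ((r / (n + 2) : ℝ) : ℂ)
    have hx0 : ∀ n : ℕ, 0 < r / (n + 2) := fun n => by positivity
    have hxr : ∀ n : ℕ, r / (n + 2) < r := fun n =>
      div_lt_self hr0 (by linarith [Nat.cast_nonneg (α := ℝ) n])
    have hxU : ∀ n, x n ∈ U := fun n => by
      refine (hRs (hball t₀ hmem ?_)).1
      rw [Metric.mem_closedBall, dist_eq_norm, add_sub_cancel_left, norm_real,
        Real.norm_of_nonneg (hx0 n).le]
      exact (hxr n).le
    have hxl : Tendsto x atTop (𝓝[≠] t₀) := by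
      refine tendsto_nhdsWithin_iff.2 ⟨?_, Eventually.of_forall fun n h => ?_⟩
      · have h1 : Tendsto (fun n : ℕ => r / ((n : ℝ) + 2)) atTop (𝓝 0) :=
          Tendsto.div_atTop tendsto_const_nhds
            (tendsto_atTop_add_const_right _ _ tendsto_natCast_atTop_atTop)
        have h2 := ((continuous_ofReal.tendsto 0).comp h1).const_add t₀
        rw [ofReal_zero, add_zero] at h2
        exact h2
      · have h1 : ((r / (n + 2) : ℝ) : ℂ) = 0 := by
          have : t₀ + ((r / (n + 2) : ℝ) : ℂ) = t₀ := h
          exact add_eq_left.1 this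
        exact (hx0 n).ne' (ofReal_eq_zero.1 h1)
    refine aestronglyMeasurable_of_tendsto_ae (u := atTop)
      (f := fun n a => (x n - t₀)⁻¹ * (F (x n) a - F t₀ a)) (fun n => ?_) ?_
    · exact ((hm _ (hxU n)).sub (hm _ ht₀)).const_mul _
    · refine Eventually.of_forall fun a => ?_
      refine ((hdiff a t₀ hmem).tendsto_slope.comp hxl).congr fun n => ?_
      simp [Function.comp, slope_def_field, div_eq_inv_mul]
  have hint : Integrable (F t₀) μ :=
    hbi.mono' (hm t₀ ht₀) (Eventually.of_forall fun a => (hRs (Metric.mem_ball_self hR)).2 a)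
  exact (hasDerivAt_integral_of_dominated_loc_of_deriv_le (Metric.ball_mem_nhds t₀ hr0)
    ((hU.eventually_mem ht₀).mono hm) hint hmeas
    (Eventually.of_forall fun a t ht => hderb a t ht) (hbi.div_const r)
    (Eventually.of_forall fun a t ht => hdiff a t ht)).2.differentiableAt.differentiableWithinAt

/-- The ratio test, uniformly on a compact set. -/
theorem exists_summable_bound {X : Type*} [TopologicalSpace X] {K : Set X} (hK : IsCompact K)
    {F q : ℕ → X → ℂ} {θ : ℝ} (hF : ∀ m, ContinuousOn (F m) K)
    (hstep : ∀ m, ∀ x ∈ K, F (m + 1) x = q m x * F m x) (hθ : θ < 1)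
    (hq : ∀ᶠ m in atTop, ∀ x ∈ K, ‖q m x‖ ≤ θ) :
    ∃ u : ℕ → ℝ, Summable u ∧ ∀ m, ∀ x ∈ K, ‖F m x‖ ≤ u m := by
  rcases K.eq_empty_or_nonempty with rfl | ⟨x₀, hx₀⟩
  · exact ⟨0, summable_zero, fun m x hx => hx.elim⟩
  obtain ⟨M, hM⟩ := eventually_atTop.1 hq
  have hθ0 : 0 ≤ θ := (norm_nonneg _).trans (hM M le_rfl x₀ hx₀)
  choose B hB using fun m => hK.exists_bound_of_continuousOn (hF m)
  have hge : ∀ j : ℕ, ∀ x ∈ K, ‖F (j + M) x‖ ≤ θ ^ j * B M := by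
    intro j x hx
    induction j with
    | zero => simpa using hB M x hx
    | succ j ih =>
      rw [show j + 1 + M = j + M + 1 by ring, hstep _ x hx, norm_mul, pow_succ', mul_assoc]
      exact mul_le_mul (hM _ (by omega) x hx) ih (norm_nonneg _) hθ0
  refine ⟨fun m => if m < M then B m else θ ^ (m - M) * B M, ?_, fun m x hx => ?_⟩
  · rw [← summable_nat_add_iff M]
    simpa using (summable_geometric_of_lt_one hθ0 hθ).mul_right (B M)
  · change ‖F m x‖ ≤ if m < M then B m else θ ^ (m - M) * B M
    split_ifs with h
    · exact hB m x hx
    · have := hge (m - M) x hx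
      rwa [Nat.sub_add_cancel (not_lt.1 h)] at this

/-! ### Taylor expansions at the hyperplane class -/

/-- The coefficient of `p ^ i` in the Taylor expansion of `G` at `0`, as a Cauchy integral. It only
depends on the values of `G` on the circle of radius `ρ`. -/
def taylorCoeff (ρ : ℝ) (i : ℕ) (G : ℂ → ℂ) : ℂ :=
  (2 * Real.pi * I)⁻¹ * ∮ p in C(0, ρ), (p⁻¹) ^ (i + 1) * G p

/-- The class in `ℂ[p] / (p ^ n)` of the Taylor expansion of `G` at `0`, for `G` holomorphic on the
disc of radius `ρ`. It is defined for all functions that are integrable on the circle, so that sums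
and integrals can be moved through it before their holomorphy in `p` is known. -/
def jet (n : ℕ) (ρ : ℝ) (G : ℂ → ℂ) : ProjCohomology n :=
  ∑ i ∈ Finset.range n, taylorCoeff ρ i G •
    (AdjoinRoot.root (Polynomial.X ^ n : Polynomial ℂ)) ^ i

theorem taylorCoeff_eq_iteratedDeriv {ρ : ℝ} (hρ : 0 < ρ) {G : ℂ → ℂ}
    (hG : DiffContOnCl ℂ G (Metric.ball 0 ρ)) (i : ℕ) :
    taylorCoeff ρ i G = iteratedDeriv i G 0 / i.factorial := by
  have h := DiffContOnCl.circleIntegral_one_div_sub_center_pow_smul hρ i hG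
  have h1 : (∮ p in C(0, ρ), (p⁻¹) ^ (i + 1) * G p) =
      ∮ z in C(0, ρ), (1 / (z - 0) ^ (i + 1)) • G z := by
    congr 1
    ext p
    simp
  rw [taylorCoeff, h1, h, smul_eq_mul]
  have : (i.factorial : ℂ) ≠ 0 := Nat.cast_ne_zero.2 i.factorial_ne_zero
  have hpi : (Real.pi : ℂ) ≠ 0 := by exact_mod_cast Real.pi_ne_zero
  field_simp

theorem ofHyperplane_eq_jet (w : Fin N → ℕ) {ρ : ℝ} (hρ : 0 < ρ) {G : ℂ → ℂ}
    (hG : DiffContOnCl ℂ G (Metric.ball 0 ρ)) (f : sectors w) :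
    ofHyperplane w G f = jet (sectorRank w f) ρ G := by
  refine Finset.sum_congr rfl fun i _ => ?_
  rw [taylorCoeff_eq_iteratedDeriv hρ hG]

theorem jet_congr {n : ℕ} {ρ : ℝ} (hρ : 0 < ρ) {G H : ℂ → ℂ}
    (h : ∀ p ∈ Metric.sphere (0 : ℂ) ρ, G p = H p) : jet n ρ G = jet n ρ H := by
  refine Finset.sum_congr rfl fun i _ => ?_
  have h1 : (∮ p in C(0, ρ), (p⁻¹) ^ (i + 1) * G p) = ∮ p in C(0, ρ), (p⁻¹) ^ (i + 1) * H p :=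
    circleIntegral.integral_congr hρ.le fun p hp => by rw [h p hp]
  rw [taylorCoeff, taylorCoeff, h1]

theorem continuousOn_inv_pow_mul {ρ : ℝ} (hρ : 0 < ρ) {G : ℂ → ℂ}
    (hG : ContinuousOn G (Metric.sphere 0 ρ)) (i : ℕ) :
    ContinuousOn (fun p : ℂ => (p⁻¹) ^ (i + 1) * G p) (Metric.sphere 0 ρ) := by
  refine ContinuousOn.mul (ContinuousOn.pow (continuousOn_id.inv₀ fun p hp => ?_) _) hG
  rintro rfl
  simp at hp
  exact hρ.ne hp

theorem jet_add {n : ℕ} {ρ : ℝ} (hρ : 0 < ρ) {G H : ℂ → ℂ}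
    (hG : ContinuousOn G (Metric.sphere 0 ρ)) (hH : ContinuousOn H (Metric.sphere 0 ρ)) :
    jet n ρ (fun p => G p + H p) = jet n ρ G + jet n ρ H := by
  rw [jet, jet, jet, ← Finset.sum_add_distrib]
  refine Finset.sum_congr rfl fun i _ => ?_
  rw [← add_smul, taylorCoeff, taylorCoeff, taylorCoeff, ← mul_add, ← circleIntegral.integral_add
    ((continuousOn_inv_pow_mul hρ hG i).circleIntegrable hρ.le)
    ((continuousOn_inv_pow_mul hρ hH i).circleIntegrable hρ.le)]
  simp_rw [mul_add]

theorem jet_const_mul {n : ℕ} {ρ : ℝ} (a : ℂ) (G : ℂ → ℂ) :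
    jet n ρ (fun p => a * G p) = a • jet n ρ G := by
  rw [jet, jet, Finset.smul_sum]
  refine Finset.sum_congr rfl fun i _ => ?_
  have h1 : (∮ p in C(0, ρ), (p⁻¹) ^ (i + 1) * (a * G p)) =
      a * ∮ p in C(0, ρ), (p⁻¹) ^ (i + 1) * G p := by
    rw [← circleIntegral.integral_const_mul]
    congr 1
    ext p
    ring
  rw [smul_smul, taylorCoeff, taylorCoeff, h1, mul_left_comm]

theorem jet_zero {n : ℕ} {ρ : ℝ} : jet n ρ (fun _ => 0) = 0 := by
  simpa using jet_const_mul (n := n) (ρ := ρ) 0 fun _ => 0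

theorem jet_sum {n : ℕ} {ρ : ℝ} (hρ : 0 < ρ) {ι : Type*} (s : Finset ι) {G : ι → ℂ → ℂ}
    (hG : ∀ i, ContinuousOn (G i) (Metric.sphere 0 ρ)) :
    jet n ρ (fun p => ∑ i ∈ s, G i p) = ∑ i ∈ s, jet n ρ (G i) := by
  classical
  induction s using Finset.induction_on with
  | empty => simpa using jet_zero
  | insert a s ha ih =>
    simp only [Finset.sum_insert ha]
    rw [jet_add hρ (hG a) (continuousOn_finsetSum s fun i _ => hG i), ih]

theorem continuous_deriv_circleMap_smul {ρ : ℝ} (hρ : 0 < ρ) {G : ℂ → ℂ}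
    (hG : ContinuousOn G (Metric.sphere 0 ρ)) (i : ℕ) :
    Continuous fun θ : ℝ => deriv (circleMap 0 ρ) θ •
      ((circleMap 0 ρ θ)⁻¹ ^ (i + 1) * G (circleMap 0 ρ θ)) := by
  have h1 : Continuous fun θ : ℝ => deriv (circleMap 0 ρ) θ := by
    simp only [deriv_circleMap]
    fun_prop
  exact h1.smul ((continuousOn_inv_pow_mul hρ hG i).comp_continuous (continuous_circleMap 0 ρ)
    (circleMap_mem_sphere 0 hρ.le))

theorem hasSum_jet {n : ℕ} {ρ : ℝ} (hρ : 0 < ρ) {G : ℕ → ℂ → ℂ}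
    (hG : ∀ m, ContinuousOn (G m) (Metric.sphere 0 ρ)) {u : ℕ → ℝ} (hu : Summable u)
    (hGu : ∀ m, ∀ p ∈ Metric.sphere (0 : ℂ) ρ, ‖G m p‖ ≤ u m) :
    HasSum (fun m => jet n ρ (G m)) (jet n ρ fun p => ∑' m, G m p) := by
  refine hasSum_sum fun i _ => ?_
  refine HasSum.smul_const ?_ _
  refine HasSum.mul_left _ ?_
  have hmem : ∀ θ : ℝ, circleMap 0 ρ θ ∈ Metric.sphere (0 : ℂ) ρ := circleMap_mem_sphere 0 hρ.le
  have hρn : ∀ θ : ℝ, ‖circleMap 0 ρ θ‖ = ρ := fun θ => by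
    rw [norm_circleMap_zero, abs_of_pos hρ]
  refine intervalIntegral.hasSum_integral_of_dominated_convergence
    (fun m _ => ρ * ((ρ⁻¹) ^ (i + 1) * u m))
    (fun m => (continuous_deriv_circleMap_smul hρ (hG m) i).aestronglyMeasurable)
    (fun m => Eventually.of_forall fun θ _ => ?_) (Eventually.of_forall fun θ _ =>
      (hu.mul_left _).mul_left _) (by simp) (Eventually.of_forall fun θ _ => ?_)
  · rw [norm_smul, deriv_circleMap, norm_mul, norm_I, mul_one, norm_mul, norm_pow, norm_inv, hρn]
    have := hGu m _ (hmem θ)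
    gcongr
  · have h1 : Summable fun m => G m (circleMap 0 ρ θ) :=
      Summable.of_norm_bounded hu fun m => hGu m _ (hmem θ)
    exact (h1.hasSum.mul_left _).const_smul _

theorem differentiableOn_jet {n : ℕ} {ρ : ℝ} (hρ : 0 < ρ) {U : Set ℂ} (hU : IsOpen U)
    {G : ℂ → ℂ → ℂ} (hc : ∀ t ∈ U, ContinuousOn (G t) (Metric.sphere 0 ρ))
    (hd : ∀ p ∈ Metric.sphere (0 : ℂ) ρ, DifferentiableOn ℂ (fun t => G t p) U)
    (hb : ∀ t₀ ∈ U, ∃ C, ∀ᶠ t in 𝓝 t₀, ∀ p ∈ Metric.sphere (0 : ℂ) ρ, ‖G t p‖ ≤ C) :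
    DifferentiableOn ℂ (fun t => jet n ρ (G t)) U := by
  refine DifferentiableOn.fun_sum fun i _ => DifferentiableOn.smul_const ?_ _
  refine DifferentiableOn.const_mul ?_ _
  have hmem : ∀ θ : ℝ, circleMap 0 ρ θ ∈ Metric.sphere (0 : ℂ) ρ := circleMap_mem_sphere 0 hρ.le
  have hρn : ∀ θ : ℝ, ‖circleMap 0 ρ θ‖ = ρ := fun θ => by
    rw [norm_circleMap_zero, abs_of_pos hρ]
  simp only [circleIntegral, intervalIntegral.integral_of_le Real.two_pi_pos.le]
  refine differentiableOn_integral hU (fun t ht => ?_) (fun θ => ?_) fun t₀ ht₀ => ?_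
  · exact (continuous_deriv_circleMap_smul hρ (hc t ht) i).aestronglyMeasurable
  · exact ((hd _ (hmem θ)).const_mul _).fun_const_smul _
  · obtain ⟨C, hC⟩ := hb t₀ ht₀
    refine ⟨fun _ => ρ * ((ρ⁻¹) ^ (i + 1) * C), integrable_const _, ?_⟩
    filter_upwards [hC] with t ht θ
    rw [norm_smul, deriv_circleMap, norm_mul, norm_I, mul_one, norm_mul, norm_pow, norm_inv, hρn]
    have := ht _ (hmem θ)
    gcongr

/-- A function vanishing to order `n` at the origin has trivial class in `ℂ[p] / (p ^ n)`. -/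
theorem jet_pow_mul_eq_zero {n : ℕ} {ρ : ℝ} (hρ : 0 < ρ) {h : ℂ → ℂ}
    (hh : DiffContOnCl ℂ h (Metric.ball 0 ρ)) : jet n ρ (fun p => p ^ n * h p) = 0 := by
  refine Finset.sum_eq_zero fun i hi => ?_
  have hin := Finset.mem_range.1 hi
  have h1 : (∮ p in C(0, ρ), (p⁻¹) ^ (i + 1) * (p ^ n * h p)) =
      ∮ p in C(0, ρ), p ^ (n - (i + 1)) * h p := by
    refine circleIntegral.integral_congr hρ.le fun p hp => ?_
    have hp0 : p ≠ 0 := by rintro rfl; simp at hp; exact hρ.ne hp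
    obtain ⟨e, rfl⟩ := Nat.exists_eq_add_of_lt hin
    have : i + e + 1 - (i + 1) = e := by omega
    rw [this, show i + e + 1 = i + 1 + e by ring, pow_add p, ← mul_assoc, ← mul_assoc, ← mul_pow,
      inv_mul_cancel₀ hp0, one_pow, one_mul]
  have h2 : DiffContOnCl ℂ (fun p : ℂ => p ^ (n - (i + 1)) * h p) (Metric.ball 0 ρ) :=
    ((differentiable_id.pow _).diffContOnCl).smul hh
  rw [taylorCoeff, h1, h2.circleIntegral_eq_zero hρ.le, mul_zero, zero_smul]

theorem exists_eq_mul_of_apply_zero {F : ℂ → ℂ} (hF : Differentiable ℂ F) (h0 : F 0 = 0) :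
    ∃ h : ℂ → ℂ, Differentiable ℂ h ∧ ∀ p, F p = p * h p := by
  refine ⟨dslope F 0, ?_, fun p => ?_⟩
  · rw [← differentiableOn_univ] at hF ⊢
    exact (differentiableOn_dslope univ_mem).2 hF
  · have := sub_smul_dslope F 0 p
    rw [sub_zero, h0, sub_zero, smul_eq_mul] at this
    exact this.symm

/-! ### Convergence of the series -/

/-- Locally uniform convergence in `t` of a series whose ratios of consecutive summands are the
values of a function with a limit at infinity, multiplied by `e t`. -/
theorem exists_locally_summable_bound {X : Type*} [TopologicalSpace X] {K : Set X}
    (hK : IsCompact K) {F : ℕ → ℂ → X → ℂ} {A e : ℂ → ℂ} {s : ℕ → X → ℂ} {L t₀ : ℂ} {B : ℝ}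
    (he : Continuous e)
    (hF : ∀ m, ContinuousOn (fun y : ℂ × X => F m y.1 y.2) (univ ×ˢ K))
    (hstep : ∀ m t, ∀ x ∈ K, F (m + 1) t x = A (s m x) * e t * F m t x)
    (hA : Tendsto A (Bornology.cobounded ℂ) (𝓝 L)) (hs : ∀ m : ℕ, ∀ x ∈ K, (m : ℝ) - B ≤ ‖s m x‖)
    (hlt : ‖L * e t₀‖ < 1) :
    ∃ u : ℕ → ℝ, Summable u ∧ ∀ᶠ t in 𝓝 t₀, ∀ m, ∀ x ∈ K, ‖F m t x‖ ≤ u m := by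
  obtain ⟨θ, hLθ, hθ⟩ := exists_between hlt
  have h1 : Tendsto (fun y : ℂ × ℂ => ‖A y.1 * e y.2‖) (Bornology.cobounded ℂ ×ˢ 𝓝 t₀)
      (𝓝 ‖L * e t₀‖) :=
    ((hA.comp tendsto_fst).mul ((he.tendsto t₀).comp tendsto_snd)).norm
  obtain ⟨pa, hpa, pb, hpb, hab⟩ := eventually_prod_iff.1 (h1.eventually (gt_mem_nhds hLθ))
  rw [← comap_norm_atTop, eventually_comap] at hpa
  obtain ⟨R, hR⟩ := eventually_atTop.1 hpa
  obtain ⟨r, hr, hrb⟩ := Metric.nhds_basis_closedBall.mem_iff.1 hpb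
  obtain ⟨u, hu, hub⟩ := exists_summable_bound ((isCompact_closedBall t₀ r).prod hK)
    (F := fun m y => F m y.1 y.2) (q := fun m y => A (s m y.2) * e y.1) (θ := θ)
    (fun m => (hF m).mono (prod_mono_left (subset_univ _)))
    (fun m y hy => hstep m y.1 y.2 hy.2) hθ (by
      obtain ⟨M, hM⟩ := exists_nat_ge (R + B)
      filter_upwards [eventually_ge_atTop M] with m hm y hy
      have h2 : (M : ℝ) ≤ m := by exact_mod_cast hm
      exact (hab (hR _ (by linarith [hs m y.2 hy.2]) _ rfl) (hrb hy.1)).le)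
  refine ⟨u, hu, ?_⟩
  filter_upwards [Metric.closedBall_mem_nhds t₀ hr] with t ht m x hx
  exact hub m (t, x) ⟨ht, hx⟩

theorem differentiableOn_tsum_of_locally_bounded {F : ℕ → ℂ → ℂ} {U : Set ℂ}
    (hF : ∀ m, Differentiable ℂ (F m))
    (h : ∀ t₀ ∈ U, ∃ u : ℕ → ℝ, Summable u ∧ ∀ᶠ t in 𝓝 t₀, ∀ m, ‖F m t‖ ≤ u m) :
    DifferentiableOn ℂ (fun t => ∑' m, F m t) U := by
  intro t₀ ht₀
  obtain ⟨u, hu, hub⟩ := h t₀ ht₀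
  obtain ⟨r, hr, hrb⟩ := Metric.mem_nhds_iff.1 hub
  have := differentiableOn_tsum_of_summable_norm hu (fun m => (hF m).differentiableOn)
    Metric.isOpen_ball fun m t ht => hrb ht m
  exact (this.differentiableAt (Metric.ball_mem_nhds t₀ hr)).differentiableWithinAt

/-- A series can be summed over the residue classes modulo `d`. -/
theorem hasSum_of_residueClasses {E : Type*} [AddCommMonoid E] [TopologicalSpace E]
    [ContinuousAdd E] {f : ℕ → E} {d : ℕ} (hd : 0 < d) {h : Fin d → E}
    (H : ∀ i : Fin d, HasSum (fun m : ℕ => f (i + d * m)) (h i)) : HasSum f (∑ i, h i) := by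
  have h1 : ∀ i : Fin d, HasSum (fun j : ℕ => if j % d = i then f j else 0) (h i) := by
    intro i
    have hinj : Function.Injective fun m : ℕ => (i : ℕ) + d * m := fun m m' hm =>
      Nat.eq_of_mul_eq_mul_left hd (Nat.add_left_cancel hm)
    refine (hinj.hasSum_iff fun j hj => if_neg fun h => hj ⟨j / d, ?_⟩).1 ?_
    · change (i : ℕ) + d * (j / d) = j
      rw [← h, Nat.mod_add_div]
    · refine (H i).congr_fun fun m => ?_
      simp [Function.comp, Nat.mod_eq_of_lt i.2]
  refine (hasSum_sum fun i (_ : i ∈ Finset.univ) => h1 i).congr_fun fun j => ?_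
  rw [Finset.sum_eq_single (⟨j % d, Nat.mod_lt _ hd⟩ : Fin d)]
  · simp
  · intro i _ hi
    exact if_neg fun h => hi (Fin.ext h.symm)
  · simp

/-! ### The points of a sector -/

/-- The point `p / 2πi + f̄`; the exponents in the sector of `f` are its translates by
`0, 1, 2, …`. -/
def sectorPoint (g : ℚ) (p : ℂ) : ℂ := p / (2 * Real.pi * I) + g

/-- A radius such that, for `|p| ≤ ρ`, the points `sectorPoint g p` stay close to `g` and no
integral translate of them is a pole of `gammaRatio`. -/
structure IsRadius (w : Fin N → ℕ) (ξ : ℂ) (ρ : ℝ) : Prop where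
  pos : 0 < ρ
  le : deg w * ρ ≤ 1
  generic : ∀ p : ℂ, ‖p‖ ≤ ρ → ∀ n : ℤ, ξ + deg w * (p / (2 * Real.pi * I)) ≠ n

/-- A number `g` such that `g d` is an integer and `0 ≤ g < 1`, for instance `f̄` for a
sector `f`. -/
structure IsSectorShift (w : Fin N → ℕ) (g : ℚ) : Prop where
  nonneg : 0 ≤ g
  lt_one : g < 1
  integral : ∃ a : ℤ, (deg w : ℚ) * g = a

theorem exists_isRadius {w : Fin N → ℕ} (hpos : ∀ j, 0 < w j) (hN : 0 < N) {ξ : ℂ}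
    (hξ : ∀ m : ℤ, ξ ≠ m) : ∃ ρ, IsRadius w ξ ρ := by
  have hd : (0 : ℝ) < deg w := by exact_mod_cast deg_pos hpos hN
  have h1 : IsOpen {x : ℂ | ∀ n : ℤ, x ≠ n} := by
    have := isOpen_compl_range_intCast
    convert this using 1
    ext x
    simp [eq_comm]
  have h2 : {p : ℂ | ∀ n : ℤ, ξ + deg w * (p / (2 * Real.pi * I)) ≠ n} ∈ 𝓝 (0 : ℂ) := by
    have hc : Continuous fun p : ℂ => ξ + deg w * (p / (2 * Real.pi * I)) := by fun_prop
    exact (h1.preimage hc).mem_nhds (by simpa using hξ)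
  obtain ⟨r, hr, hrb⟩ := Metric.nhds_basis_closedBall.mem_iff.1 h2
  refine ⟨min r (deg w : ℝ)⁻¹, lt_min hr (inv_pos.2 hd), ?_, fun p hp => ?_⟩
  · calc (deg w : ℝ) * min r (deg w : ℝ)⁻¹ ≤ deg w * (deg w : ℝ)⁻¹ := by
          gcongr; exact min_le_right _ _
      _ = 1 := mul_inv_cancel₀ hd.ne'
  · exact hrb (by simpa using hp.trans (min_le_left _ _))

theorem sectorPoint_re (g : ℚ) (p : ℂ) : (sectorPoint g p).re = p.im / (2 * Real.pi) + g := by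
  have : p / (2 * Real.pi * I) = ((2 * Real.pi : ℝ) : ℂ)⁻¹ * (p * -I) := by
    rw [div_eq_mul_inv, mul_inv, inv_I]; push_cast; ring
  rw [sectorPoint, this, ← ofReal_inv, add_re, re_ofReal_mul]
  simp
  ring

theorem IsRadius.abs_sectorPoint_re_sub_lt {w : Fin N → ℕ} {ξ : ℂ} {ρ : ℝ} (hρ : IsRadius w ξ ρ)
    (g : ℚ) {p : ℂ} (hp : ‖p‖ ≤ ρ) : deg w * |(sectorPoint g p).re - g| < 1 / 3 := by
  have hpi := Real.pi_gt_three
  rw [sectorPoint_re, add_sub_cancel_right, abs_div, abs_of_pos (by positivity : 0 < 2 * Real.pi),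
    mul_div_assoc', div_lt_iff₀ (by positivity)]
  calc (deg w : ℝ) * |p.im| ≤ deg w * ρ := by gcongr; exact (abs_im_le_norm p).trans hp
    _ ≤ 1 := hρ.le
    _ < _ := by linarith

theorem IsRadius.generic_sectorPoint {w : Fin N → ℕ} {ξ : ℂ} {ρ : ℝ} (hρ : IsRadius w ξ ρ)
    {g : ℚ} (hg : IsSectorShift w g) {p : ℂ} (hp : ‖p‖ ≤ ρ) (m n : ℤ) :
    ξ + deg w * (sectorPoint g p + m) ≠ n := by
  obtain ⟨a, ha⟩ := hg.integral
  have ha' : (deg w : ℂ) * g = a := by exact_mod_cast congrArg (Rat.cast (K := ℂ)) ha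
  intro h
  refine hρ.generic p hp (n - a - deg w * m) ?_
  rw [sectorPoint] at h
  push_cast
  linear_combination h - ha'

theorem norm_sectorPoint_le {w : Fin N → ℕ} (hpos : ∀ j, 0 < w j) (hN : 0 < N) {ξ : ℂ} {ρ : ℝ}
    (hρ : IsRadius w ξ ρ) {g : ℚ} (hg : IsSectorShift w g) {p : ℂ} (hp : ‖p‖ ≤ ρ) :
    ‖sectorPoint g p‖ ≤ 2 := by
  have hd : (1 : ℝ) ≤ deg w := by exact_mod_cast deg_pos hpos hN
  have hρ1 : ρ ≤ 1 := le_trans (le_mul_of_one_le_left hρ.pos.le hd) hρ.le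
  have hg0 : (0 : ℝ) ≤ g := by exact_mod_cast hg.nonneg
  have hg1 : (g : ℝ) ≤ 1 := by exact_mod_cast hg.lt_one.le
  have h1 : ‖(g : ℂ)‖ = g := by
    rw [← ofReal_ratCast, norm_real, Real.norm_of_nonneg hg0]
  have h2 : ‖p / (2 * Real.pi * I)‖ ≤ ‖p‖ := by
    rw [norm_div]
    refine div_le_self (norm_nonneg p) ?_
    rw [norm_mul, norm_I, mul_one, norm_mul, norm_real, Real.norm_of_nonneg Real.pi_pos.le,
      Complex.norm_ofNat]
    linarith [Real.pi_gt_three]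
  exact (norm_add_le _ _).trans (by linarith)

theorem continuous_sectorPoint (g : ℚ) : Continuous (sectorPoint g) := by
  unfold sectorPoint
  fun_prop

/-- The same line serves all `p` in the disc. The pole-free lines are those with
`d σ + Re ξ ∉ ℤ`, and after multiplication by `d` the points `sectorPoint g p` move by less than
`1 / 3`. -/
theorem exists_isSeparating {w : Fin N → ℕ} (hpos : ∀ j, 0 < w j) (hN : 0 < N) {ξ : ℂ} {ρ : ℝ}
    (hρ : IsRadius w ξ ρ) {g : ℚ} (hg : IsSectorShift w g) :
    ∃ (m₀ : ℕ) (σ : ℝ), ∀ p : ℂ, ‖p‖ ≤ ρ → IsSeparating w ξ (sectorPoint g p + m₀) σ := by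
  have hd : (1 : ℝ) ≤ deg w := by exact_mod_cast deg_pos hpos hN
  have hd0 : (0 : ℝ) < deg w := by linarith
  obtain ⟨a, ha⟩ := hg.integral
  have ha' : (deg w : ℝ) * g = a := by exact_mod_cast congrArg (Rat.cast (K := ℝ)) ha
  have hg0 : (0 : ℝ) ≤ g := by exact_mod_cast hg.nonneg
  -- at most one of the two candidates `1 / 3`, `2 / 3` is congruent to `Re ξ` modulo one
  obtain ⟨η, hη1, hη2, hη⟩ : ∃ η : ℝ, 1 / 3 ≤ η ∧ η ≤ 2 / 3 ∧ ∀ k : ℤ, ξ.re - η ≠ k := by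
    by_cases h : ∀ k : ℤ, ξ.re - 1 / 3 ≠ k
    · exact ⟨1 / 3, le_rfl, by norm_num, h⟩
    · push Not at h
      obtain ⟨k, hk⟩ := h
      refine ⟨2 / 3, by norm_num, le_rfl, fun k' hk' => ?_⟩
      have h1 : (3 * (k - k') : ℝ) = 1 := by linarith
      have h2 : 3 * (k - k') = 1 := by exact_mod_cast h1
      omega
  obtain ⟨m₀, hm₀⟩ := exists_nat_ge (3 + |ξ.re|)
  have hηd : η / deg w ≤ 1 := by rw [div_le_one hd0]; linarith
  have hηd' : deg w * (η / deg w) = η := by field_simp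
  refine ⟨m₀, g + m₀ - η / deg w, fun p hp => ?_⟩
  have habs := hρ.abs_sectorPoint_re_sub_lt g hp
  have hx1 : (deg w : ℝ) * ((sectorPoint g p).re - g) < 1 / 3 :=
    lt_of_le_of_lt (mul_le_mul_of_nonneg_left (le_abs_self _) hd0.le) habs
  have hx2 : -(1 / 3) < (deg w : ℝ) * ((sectorPoint g p).re - g) := by
    have := mul_le_mul_of_nonneg_left (neg_abs_le ((sectorPoint g p).re - g)) hd0.le
    linarith
  refine ⟨?_, ?_, fun k hk => ?_, ?_, ?_, fun n hn => ?_⟩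
  · linarith [abs_nonneg ξ.re]
  · have h1 : 1 + |ξ.re| ≤ g + m₀ - η / deg w - 1 := by linarith
    have h2 : 1 + |ξ.re| ≤ deg w * (g + m₀ - η / deg w - 1) :=
      h1.trans (le_mul_of_one_le_left (by linarith [abs_nonneg ξ.re]) hd)
    linarith [neg_abs_le ξ.re]
  · refine hη (k - a - deg w * m₀) ?_
    push_cast
    linear_combination hk - ha' + hηd'
  · rw [add_re, natCast_re]
    refine lt_of_mul_lt_mul_left ?_ hd0.le
    linarith
  · rw [add_re, natCast_re]
    refine lt_of_mul_lt_mul_left ?_ hd0.le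
    linarith
  · exact hρ.generic_sectorPoint hg hp m₀ n (by exact_mod_cast hn)

/-! ### Summability in each sector -/

theorem continuousOn_gammaTerm {w : Fin N → ℕ} {ξ : ℂ} {ρ : ℝ} (hρ : IsRadius w ξ ρ) {g : ℚ}
    (hg : IsSectorShift w g) (m : ℤ) :
    ContinuousOn (fun y : ℂ × ℂ => gammaTerm w ξ y.1 (sectorPoint g y.2 + m))
      (univ ×ˢ Metric.closedBall 0 ρ) := by
  rintro ⟨t, p⟩ ⟨-, hp⟩
  have hp' : ‖p‖ ≤ ρ := by simpa using hp
  have h1 : ContinuousAt (gammaRatio w ξ) (sectorPoint g p + m) :=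
    (differentiableAt_gammaRatio w fun k hk => hρ.generic_sectorPoint hg hp' m (-(k + 1 : ℤ)) (by
      push_cast; linear_combination hk)).continuousAt
  have h2 : ContinuousAt (fun y : ℂ × ℂ => sectorPoint g y.2 + m) (t, p) :=
    (((continuous_sectorPoint g).comp continuous_snd).add continuous_const).continuousAt
  have h3 : ContinuousAt (fun y : ℂ × ℂ => gammaRatio w ξ (sectorPoint g y.2 + m)) (t, p) :=
    ContinuousAt.comp (g := gammaRatio w ξ) (f := fun y : ℂ × ℂ => sectorPoint g y.2 + m)
      (x := (t, p)) h1 h2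
  exact (h3.mul ((continuousAt_fst.mul h2).cexp)).continuousWithinAt

theorem continuousOn_gammaTerm_sectorPoint {w : Fin N → ℕ} {ξ : ℂ} {ρ : ℝ} (hρ : IsRadius w ξ ρ)
    {g : ℚ} (hg : IsSectorShift w g) (t : ℂ) (m : ℤ) :
    ContinuousOn (fun p => gammaTerm w ξ t (sectorPoint g p + m)) (Metric.closedBall 0 ρ) :=
  (continuousOn_gammaTerm hρ hg m).comp (f := fun p => (t, p)) (by fun_prop)
    fun p hp => ⟨mem_univ _, hp⟩

theorem exists_bound_gammaTerm {w : Fin N → ℕ} (hpos : ∀ j, 0 < w j) (hN : 0 < N) {ξ : ℂ} {ρ : ℝ}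
    (hρ : IsRadius w ξ ρ) {g : ℚ} (hg : IsSectorShift w g) {t₀ : ℂ}
    (ht₀ : t₀.re < Real.log (vc w)) :
    ∃ u : ℕ → ℝ, Summable u ∧ ∀ᶠ t in 𝓝 t₀, ∀ m : ℕ, ∀ p ∈ Metric.closedBall (0 : ℂ) ρ,
      ‖gammaTerm w ξ t (sectorPoint g p + m)‖ ≤ u m := by
  have hg0 : (0 : ℝ) ≤ g := by exact_mod_cast hg.nonneg
  refine exists_locally_summable_bound (isCompact_closedBall (0 : ℂ) ρ)
    (F := fun m t p => gammaTerm w ξ t (sectorPoint g p + m))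
    (A := fun s => stepNum w ξ s / stepDen w s) (e := exp)
    (s := fun m p => sectorPoint g p + m) (B := 2)
    continuous_exp (fun m => by simpa using continuousOn_gammaTerm hρ hg m) (fun m t p hp => ?_)
    (tendsto_stepNum_div_stepDen hpos hN ξ) (fun m p hp => ?_)
    (norm_exp_mul_lt_one (vc_pos hpos hN) ht₀)
  · have hp' : ‖p‖ ≤ ρ := by simpa using hp
    rw [← gammaTerm_add_one]
    · push_cast
      ring_nf
    · exact stepNum_ne_zero w fun k _ h => hρ.generic_sectorPoint hg hp' m (-k) (by
        push_cast; exact h)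
    · refine stepDen_ne_zero w fun j => ?_
      have hwd : (w j : ℝ) ≤ deg w := by
        exact_mod_cast Finset.single_le_sum (f := w) (fun _ _ => Nat.zero_le _) (Finset.mem_univ j)
      have h1 := hρ.abs_sectorPoint_re_sub_lt g hp'
      have h2 : (w j : ℝ) * |(sectorPoint g p).re - g| ≤ deg w * |(sectorPoint g p).re - g| := by
        gcongr
      have h3 := mul_le_mul_of_nonneg_left (neg_abs_le ((sectorPoint g p).re - g))
        (Nat.cast_nonneg (α := ℝ) (w j))
      have h4 : (0 : ℝ) ≤ w j * (g + m) := by positivity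
      rw [add_re, natCast_re]
      linarith
  · have h1 := norm_sectorPoint_le hpos hN hρ hg (p := p) (by simpa using hp)
    have h2 := norm_sub_le_norm_add (m : ℂ) (sectorPoint g p)
    rw [Complex.norm_natCast, add_comm] at h2
    linarith

theorem exists_bound_gammaTerm_left {w : Fin N → ℕ} (hpos : ∀ j, 0 < w j) (hN : 0 < N) {ξ : ℂ}
    {ρ : ℝ} (hρ : IsRadius w ξ ρ) {g : ℚ} (hg : IsSectorShift w g) {t : ℂ}
    (ht : Real.log (vc w) < t.re) :
    ∃ u : ℕ → ℝ, Summable u ∧ ∀ m : ℕ, ∀ p ∈ Metric.closedBall (0 : ℂ) ρ,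
      ‖gammaTerm w ξ t (sectorPoint g p - 1 - m)‖ ≤ u m := by
  have hcast : ∀ (p : ℂ) (m : ℕ), sectorPoint g p - 1 - m =
      sectorPoint g p + ((-(m + 1 : ℤ) : ℤ) : ℂ) := fun p m => by push_cast; ring
  refine (exists_locally_summable_bound (isCompact_closedBall (0 : ℂ) ρ)
    (F := fun m t p => gammaTerm w ξ t (sectorPoint g p - 1 - m)) (t₀ := t)
    (A := fun s => stepDen w s / stepNum w ξ s) (e := fun t => exp (-t))
    (s := fun m p => sectorPoint g p - 1 - (m + 1)) (B := 2)
    (by fun_prop) (fun m => by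
      simp only [hcast]; exact continuousOn_gammaTerm hρ hg _) (fun m t p hp => ?_)
    (tendsto_stepDen_div_stepNum hpos hN ξ) (fun m p hp => ?_)
    (norm_mul_exp_neg_lt_one (vc_pos hpos hN) ht)).imp fun u hu => ⟨hu.1, hu.2.self_of_nhds⟩
  · have hp' : ‖p‖ ≤ ρ := by simpa using hp
    push_cast
    rw [gammaTerm_sub_one]
    · congr 2
      ring
    · refine stepNum_ne_zero w fun k _ h => hρ.generic_sectorPoint hg hp' (-(m + 2)) (-k) ?_
      push_cast
      linear_combination h
  · have h1 := norm_sectorPoint_le hpos hN hρ hg (p := p) (by simpa using hp)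
    have h2 := norm_sub_norm_le ((m : ℂ) + 2) (sectorPoint g p)
    have h3 : ‖(m : ℂ) + 2‖ = m + 2 := by
      have := Complex.norm_natCast (m + 2)
      push_cast at this
      exact this
    rw [h3, norm_sub_rev] at h2
    have h4 : sectorPoint g p - 1 - (m + 1) = sectorPoint g p - (m + 2) := by ring
    rw [h4]
    linarith

theorem gammaPole_add_deg_mul {w : Fin N → ℕ} (hd : (deg w : ℂ) ≠ 0) (ξ : ℂ) (k m : ℤ) :
    gammaPole w ξ (k + deg w * m) = gammaPole w ξ k - m := by
  rw [gammaPole, gammaPole]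
  push_cast
  field_simp
  ring

theorem gammaRes_of_nonpos (w : Fin N → ℕ) (ξ : ℂ) {k : ℤ} (hk : k ≤ 0) : gammaRes w ξ k = 0 := by
  obtain ⟨n, rfl⟩ : ∃ n : ℕ, k = -n := ⟨(-k).toNat, by omega⟩
  simp [gammaRes, Gamma_neg_nat_eq_zero]

theorem continuous_stepNum (w : Fin N → ℕ) (ξ : ℂ) : Continuous (stepNum w ξ) := by
  unfold stepNum
  fun_prop

theorem continuous_stepDen (w : Fin N → ℕ) : Continuous (stepDen w) := by
  unfold stepDen
  fun_prop

/-- The residues satisfy the difference equation of `gammaRatio`. -/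
theorem gammaRes_add_deg {w : Fin N → ℕ} (hpos : ∀ j, 0 < w j) (hN : 0 < N) (ξ : ℂ) {k : ℤ}
    (hk : 1 ≤ k) : stepNum w ξ (gammaPole w ξ (k + deg w)) ≠ 0 ∧
      gammaRes w ξ (k + deg w) = stepDen w (gammaPole w ξ (k + deg w)) /
        stepNum w ξ (gammaPole w ξ (k + deg w)) * gammaRes w ξ k := by
  have hd : (deg w : ℂ) ≠ 0 := by exact_mod_cast (deg_pos hpos hN).ne'
  set a := gammaPole w ξ (k + deg w) with ha
  have hak : a + 1 = gammaPole w ξ k := by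
    have := gammaPole_add_deg_mul hd ξ k 1
    rw [mul_one] at this
    rw [ha, this]
    push_cast
    ring
  have hnum : stepNum w ξ a ≠ 0 := by
    refine stepNum_ne_zero w fun k' hk' h => ?_
    have h1 : ξ + deg w * a = -(k + deg w) := by
      rw [ha, gammaPole]; push_cast; field_simp; ring
    rw [h1] at h
    have : k + deg w = k' := by exact_mod_cast neg_injective h
    omega
  refine ⟨hnum, ?_⟩
  have h1 : Tendsto (fun s : ℂ => s + 1) (𝓝[≠] a) (𝓝[≠] (gammaPole w ξ k)) := by
    refine tendsto_nhdsWithin_iff.2 ⟨?_, ?_⟩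
    · have : Tendsto (fun s : ℂ => s + 1) (𝓝 a) (𝓝 (a + 1)) := Continuous.tendsto (by fun_prop) _
      rw [hak] at this
      exact this.mono_left nhdsWithin_le_nhds
    · filter_upwards [self_mem_nhdsWithin] with s hs h
      rw [mem_singleton_iff, ← hak] at h
      exact hs (add_right_cancel h)
  have h2 : Tendsto (fun s => stepDen w s / stepNum w ξ s) (𝓝[≠] a)
      (𝓝 (stepDen w a / stepNum w ξ a)) :=
    ((continuous_stepDen w).continuousAt.div (continuous_stepNum w ξ).continuousAt
      hnum).tendsto.mono_left nhdsWithin_le_nhds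
  have h3 := h2.mul ((tendsto_sub_mul_gammaRatio hpos hN ξ k).comp h1)
  refine tendsto_nhds_unique (tendsto_sub_mul_gammaRatio hpos hN ξ (k + deg w)) (h3.congr' ?_)
  have h4 : ∀ᶠ s in 𝓝[≠] a, stepNum w ξ s ≠ 0 :=
    nhdsWithin_le_nhds ((continuous_stepNum w ξ).continuousAt.eventually_ne hnum)
  filter_upwards [h4] with s hs
  have h5 := gammaRatio_add_one w hs
  simp only [Function.comp, ← hak]
  rw [← ha, div_mul_eq_mul_div, div_eq_iff hs]
  linear_combination -(s - a) * h5

theorem exists_bound_gammaRes {w : Fin N → ℕ} (hpos : ∀ j, 0 < w j) (hN : 0 < N) (ξ : ℂ) {k : ℤ}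
    (hk : 1 ≤ k) {t₀ : ℂ} (ht₀ : Real.log (vc w) < t₀.re) :
    ∃ u : ℕ → ℝ, Summable u ∧ ∀ᶠ t in 𝓝 t₀, ∀ m : ℕ,
      ‖gammaRes w ξ (k + deg w * m) * exp (t * gammaPole w ξ (k + deg w * m))‖ ≤ u m := by
  have hd : (deg w : ℂ) ≠ 0 := by exact_mod_cast (deg_pos hpos hN).ne'
  have hstep : ∀ m : ℕ, k + (deg w : ℤ) * (m + 1 : ℕ) = (k + deg w * m) + deg w := fun m => by
    push_cast; ring
  refine (exists_locally_summable_bound (isCompact_univ (X := Unit))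
    (F := fun m t _ => gammaRes w ξ (k + deg w * m) * exp (t * gammaPole w ξ (k + deg w * m)))
    (A := fun s => stepDen w s / stepNum w ξ s) (e := fun t => exp (-t)) (t₀ := t₀)
    (s := fun m _ => gammaPole w ξ (k + deg w * (m + 1 : ℕ))) (B := ‖gammaPole w ξ k‖)
    (by fun_prop) (fun m => by fun_prop) (fun m t _ _ => ?_)
    (tendsto_stepDen_div_stepNum hpos hN ξ) (fun m _ _ => ?_)
    (norm_mul_exp_neg_lt_one (vc_pos hpos hN) ht₀)).imp fun u hu =>
      ⟨hu.1, hu.2.mono fun t ht m => ht m () (mem_univ _)⟩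
  · have h0 : (0 : ℤ) ≤ deg w * m := by positivity
    have h1 := (gammaRes_add_deg hpos hN ξ (k := k + deg w * m) (by omega)).2
    have h2 : gammaPole w ξ (k + deg w * m + deg w) = gammaPole w ξ (k + deg w * m) - 1 := by
      have := gammaPole_add_deg_mul hd ξ (k + deg w * m) 1
      simpa using this
    rw [hstep, h1, h2, mul_sub, mul_one, exp_sub, exp_neg]
    ring
  · rw [gammaPole_add_deg_mul hd]
    have h1 := norm_sub_norm_le (((m + 1 : ℕ) : ℤ) : ℂ) (gammaPole w ξ k)
    rw [norm_sub_rev] at h1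
    have h2 : ‖(((m + 1 : ℕ) : ℤ) : ℂ)‖ = m + 1 := by
      rw [Int.cast_natCast, Complex.norm_natCast]; push_cast; rfl
    linarith

/-! ### Analytic continuation in a sector, at a nonzero value of the hyperplane class -/

/-- The Gromov-Witten series of a sector, with the hyperplane class replaced by a number `p`. -/
def gwSum (w : Fin N → ℕ) (ξ : ℂ) (g : ℚ) (t p : ℂ) : ℂ :=
  ∑' m : ℕ, gammaTerm w ξ t (sectorPoint g p + m)

/-- The Mellin-Barnes representation of `gwSum`, which makes sense for all `t` in the window. -/
def mbSum (w : Fin N → ℕ) (ξ : ℂ) (l : ℤ) (g : ℚ) (m₀ : ℕ) (σ : ℝ) (t p : ℂ) : ℂ :=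
  (∑ m ∈ Finset.range m₀, gammaTerm w ξ t (sectorPoint g p + m)) +
    -I * ∫ τ : ℝ, mbIntegrand w ξ l (sectorPoint g p + m₀) t (σ + τ * I)

/-- The sum of the residues of `v^s` times `gammaRatio` at the poles `s_k` with
`k ≡ i + 1` modulo `d`. -/
def resSum (w : Fin N → ℕ) (ξ t : ℂ) (i : ℕ) : ℂ :=
  ∑' m : ℕ, gammaRes w ξ (i + 1 + deg w * m) * exp (t * gammaPole w ξ (i + 1 + deg w * m))

/-- The contour closed to the right. -/
theorem gwSum_eq_mbSum {w : Fin N → ℕ} (hpos : ∀ j, 0 < w j) (hN : 0 < N) {ξ : ℂ} {ρ : ℝ}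
    (hρ : IsRadius w ξ ρ) {g : ℚ} (hg : IsSectorShift w g) {l : ℤ} {m₀ : ℕ} {σ : ℝ} {t p : ℂ}
    (hp : ‖p‖ ≤ ρ) (hσ : IsSeparating w ξ (sectorPoint g p + m₀) σ) (htw : InWindow l t)
    (ht : t.re < Real.log (vc w)) : gwSum w ξ g t p = mbSum w ξ l g m₀ σ t p := by
  obtain ⟨u, hu, hub⟩ := exists_bound_gammaTerm hpos hN hρ hg ht
  have hsum : Summable fun m : ℕ => gammaTerm w ξ t (sectorPoint g p + m) :=
    Summable.of_norm_bounded hu fun m => hub.self_of_nhds m p (by simpa using hp)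
  have h1 := ((summable_nat_add_iff m₀).2 hsum).hasSum.tendsto_sum_nat
  have h2 := tendsto_sum_gammaTerm hpos hN hσ htw ht
  have h3 : ∀ m : ℕ, sectorPoint g p + ((m + m₀ : ℕ) : ℂ) = sectorPoint g p + m₀ + m :=
    fun m => by push_cast; ring
  simp_rw [h3] at h1
  rw [gwSum, mbSum, ← hsum.sum_add_tsum_nat_add m₀]
  simp_rw [h3]
  rw [tendsto_nhds_unique h1 h2]

theorem hasSum_resSum {w : Fin N → ℕ} (hpos : ∀ j, 0 < w j) (hN : 0 < N) (ξ : ℂ) (i : ℕ) {t : ℂ}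
    (ht : Real.log (vc w) < t.re) :
    HasSum (fun m : ℕ => gammaRes w ξ (i + 1 + deg w * m) *
      exp (t * gammaPole w ξ (i + 1 + deg w * m))) (resSum w ξ t i) := by
  obtain ⟨u, hu, hub⟩ := exists_bound_gammaRes hpos hN ξ (k := i + 1) (by omega) ht
  exact (Summable.of_norm_bounded hu hub.self_of_nhds).hasSum

/-- The contour closed to the left. The kernel is periodic, so its values at the poles of
`gammaRatio` only depend on `k` modulo `d`; the points `s_k` with `k ≤ 0` that lie to the left
of the line are no poles, in accordance with the vanishing of `gammaRes` there. -/
theorem mbSum_eq {w : Fin N → ℕ} (hpos : ∀ j, 0 < w j) (hN : 0 < N) {ξ : ℂ} {ρ : ℝ}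
    (hρ : IsRadius w ξ ρ) {g : ℚ} (hg : IsSectorShift w g) {l : ℤ} {m₀ : ℕ} {σ : ℝ} {t p : ℂ}
    (hp : ‖p‖ ≤ ρ) (hσ : IsSeparating w ξ (sectorPoint g p + m₀) σ) (htw : InWindow l t)
    (ht : Real.log (vc w) < t.re) :
    mbSum w ξ l g m₀ σ t p = -1 * (∑' m : ℕ, gammaTerm w ξ t (sectorPoint g p - 1 - m)) +
      ∑ i : Fin (deg w), -(2 * Real.pi * I) * resSum w ξ t i *
        kern l (sectorPoint g p) (gammaPole w ξ (i + 1)) := by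
  have hd' := deg_pos hpos hN
  have hd : (deg w : ℂ) ≠ 0 := by exact_mod_cast hd'.ne'
  set c₀ := sectorPoint g p with hc₀
  set c := c₀ + m₀ with hc
  -- the residues at the points `c - 1, c - 2, …`
  obtain ⟨u, hu, hub⟩ := exists_bound_gammaTerm_left hpos hN hρ hg ht
  have hT : HasSum (fun M : ℕ => gammaTerm w ξ t (c - 1 - M))
      ((∑' m : ℕ, gammaTerm w ξ t (c₀ - 1 - m)) +
        ∑ m ∈ Finset.range m₀, gammaTerm w ξ t (c₀ + m)) := by
    have h1 : HasSum (fun m : ℕ => gammaTerm w ξ t (c₀ - 1 - m))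
        (∑' m : ℕ, gammaTerm w ξ t (c₀ - 1 - m)) :=
      (Summable.of_norm_bounded hu fun m => hub m p (by simpa using hp)).hasSum
    have h2 : ∑ m ∈ Finset.range m₀, gammaTerm w ξ t (c₀ + m) =
        ∑ M ∈ Finset.range m₀, gammaTerm w ξ t (c - 1 - M) := by
      rw [← Finset.sum_range_reflect]
      refine Finset.sum_congr rfl fun M hM => ?_
      have h3 := Finset.mem_range.1 hM
      rw [hc, Nat.sub_sub, Nat.cast_sub (by omega)]
      push_cast
      congr 1
      ring
    rw [h2]
    refine (hasSum_nat_add_iff m₀).1 (h1.congr_fun fun m => ?_)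
    rw [hc]
    push_cast
    congr 1
    ring
  -- the residues at the poles of the Gamma ratio
  let G : ℤ → ℂ := fun k => gammaRes w ξ k * exp (t * gammaPole w ξ k) * kern l c (gammaPole w ξ k)
  set S : ℂ := ∑ i : Fin (deg w), resSum w ξ t i * kern l c₀ (gammaPole w ξ (i + 1)) with hS
  have hG1 : HasSum (fun j : ℕ => G (1 + j)) S := by
    refine hasSum_of_residueClasses hd' fun i => ?_
    refine ((hasSum_resSum hpos hN ξ i ht).mul_right _).congr_fun fun m => ?_
    have h1 : (1 + ((i + deg w * m : ℕ) : ℤ)) = i + 1 + deg w * m := by push_cast; ring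
    simp only [G, h1]
    congr 1
    refine kern_eq_of_sub_eq l (m₀ + m) ?_
    have := gammaPole_add_deg_mul hd ξ (i + 1) m
    rw [this, hc]
    push_cast
    ring
  obtain ⟨e, he⟩ : ∃ e : ℕ, poleStart w ξ σ = 1 - e := by
    have h1 : (0 : ℝ) ≤ deg w * σ + ξ.re := by
      have h2 : (1 : ℝ) ≤ deg w := by exact_mod_cast hd'
      linarith [hσ.arg_pos]
    have h3 : 0 ≤ ⌊deg w * σ + ξ.re⌋ := Int.floor_nonneg.2 h1
    exact ⟨(1 + ⌊deg w * σ + ξ.re⌋).toNat, by rw [poleStart, Int.toNat_of_nonneg (by omega)]; ring⟩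
  have hG2 : HasSum (fun j : ℕ => G (poleStart w ξ σ + j)) S := by
    rw [← hasSum_nat_add_iff' e, Finset.sum_eq_zero, sub_zero]
    · refine hG1.congr_fun fun j => ?_
      rw [he]
      push_cast
      congr 1
      ring
    · intro j hj
      have := Finset.mem_range.1 hj
      simp only [G]
      rw [gammaRes_of_nonpos w ξ (by omega), zero_mul, zero_mul]
  have hblock : ∀ n : ℕ, ∑ j ∈ Finset.range (deg w * n), G (poleStart w ξ σ + j) =
      ∑ M ∈ Finset.range n, ∑ i : Fin (deg w), G (deg w * M + poleStart w ξ σ + i) := by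
    intro n
    induction n with
    | zero => simp
    | succ n ih =>
      rw [Finset.sum_range_succ, ← ih, mul_add, mul_one, Finset.sum_range_add,
        Fin.sum_univ_eq_sum_range (fun i : ℕ => G (deg w * n + poleStart w ξ σ + i))]
      congr 1
      refine Finset.sum_congr rfl fun i _ => ?_
      push_cast
      congr 1
      ring
  have hG3 : Tendsto (fun n : ℕ => ∑ M ∈ Finset.range n, ∑ i : Fin (deg w),
      G (deg w * M + poleStart w ξ σ + i)) atTop (𝓝 S) := by
    refine (hG2.tendsto_sum_nat.comp (tendsto_id.const_mul_atTop' hd')).congr fun n => ?_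
    exact hblock n
  have hlim := hT.tendsto_sum_nat.add (hG3.const_mul (2 * Real.pi * I))
  have huniq := tendsto_nhds_unique (tendsto_sum_gammaRes hpos hN hσ htw ht)
    (hlim.congr fun n => by rw [Finset.mul_sum, ← Finset.sum_add_distrib])
  rw [mbSum, neg_mul, huniq, hS, Finset.mul_sum]
  simp only [mul_assoc, neg_mul, Finset.sum_neg_distrib]
  ring

/-! ### Regularity of the Mellin-Barnes integral -/

theorem continuousOn_mbIntegrand {w : Fin N → ℕ} {ξ : ℂ} {ρ : ℝ} {g : ℚ} (l : ℤ) {m₀ : ℕ} {σ : ℝ}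
    (hσ : ∀ p : ℂ, ‖p‖ ≤ ρ → IsSeparating w ξ (sectorPoint g p + m₀) σ) :
    ContinuousOn (fun y : ℂ × ℂ × ℝ =>
        mbIntegrand w ξ l (sectorPoint g y.2.1 + m₀) y.1 (σ + y.2.2 * I))
      (univ ×ˢ Metric.closedBall 0 ρ ×ˢ univ) := by
  rintro ⟨t, p, τ⟩ ⟨-, hp, -⟩
  have hs := hσ p (by simpa using hp)
  refine ContinuousAt.continuousWithinAt ?_
  have hline : Continuous fun y : ℂ × ℂ × ℝ => (σ : ℂ) + y.2.2 * I := by fun_prop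
  have hpt : Continuous fun y : ℂ × ℂ × ℝ => sectorPoint g y.2.1 + m₀ :=
    ((continuous_sectorPoint g).comp (continuous_fst.comp continuous_snd)).add continuous_const
  have h1 : ContinuousAt (gammaRatio w ξ) (σ + τ * I) := by
    refine (differentiableAt_gammaRatio w fun k hk => ?_).continuousAt
    have := congrArg Complex.re hk
    simp at this
    exact hs.avoid (-(k + 1)) (by push_cast; linarith)
  have h2 : ContinuousAt (kern l 0) ((σ + τ * I) - (sectorPoint g p + m₀)) := by
    refine (differentiableAt_kern l fun n hn => ?_).continuousAt
    have h := congrArg Complex.re hn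
    have h3 := hs.lt_re
    have h4 := hs.re_lt
    rw [add_re, natCast_re] at h3 h4
    simp at h
    have h5 : (0 : ℝ) < n := by linarith
    have h6 : (n : ℝ) < 1 := by linarith
    have h7 : 0 < n := by exact_mod_cast h5
    have h8 : n < 1 := by exact_mod_cast h6
    omega
  have h1' : ContinuousAt (fun y : ℂ × ℂ × ℝ => gammaRatio w ξ (σ + y.2.2 * I)) (t, p, τ) :=
    ContinuousAt.comp (g := gammaRatio w ξ) (f := fun y : ℂ × ℂ × ℝ => (σ : ℂ) + y.2.2 * I)
      (x := (t, p, τ)) h1 hline.continuousAt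
  have h2' : ContinuousAt (fun y : ℂ × ℂ × ℝ =>
      kern l 0 ((σ + y.2.2 * I) - (sectorPoint g y.2.1 + m₀))) (t, p, τ) :=
    ContinuousAt.comp (g := kern l 0)
      (f := fun y : ℂ × ℂ × ℝ => ((σ : ℂ) + y.2.2 * I) - (sectorPoint g y.2.1 + m₀))
      (x := (t, p, τ)) h2 (hline.sub hpt).continuousAt
  refine ((h1'.mul ((continuous_fst.mul hline).cexp).continuousAt).mul h2').congr
    (Eventually.of_forall fun y => ?_)
  have hk := kern_eq_of_sub_eq l (c := sectorPoint g y.2.1 + m₀) (s := (σ : ℂ) + y.2.2 * I)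
    (c' := 0) (s' := ((σ : ℂ) + y.2.2 * I) - (sectorPoint g y.2.1 + m₀)) 0 (by push_cast; ring)
  simp only [mbIntegrand, gammaTerm, hk]
  rfl

theorem exists_bound_mbIntegrand {w : Fin N → ℕ} (hpos : ∀ j, 0 < w j) (hN : 0 < N) {ξ : ℂ}
    {ρ : ℝ} (hρ : IsRadius w ξ ρ) {g : ℚ} (hg : IsSectorShift w g) {l : ℤ} {m₀ : ℕ} {σ : ℝ}
    (hσ : ∀ p : ℂ, ‖p‖ ≤ ρ → IsSeparating w ξ (sectorPoint g p + m₀) σ) {t₀ : ℂ}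
    (ht₀ : InWindow l t₀) : ∃ ε C : ℝ, 0 < ε ∧ ∀ᶠ t in 𝓝 t₀, ∀ p ∈ Metric.closedBall (0 : ℂ) ρ,
      ∀ τ : ℝ, ‖mbIntegrand w ξ l (sectorPoint g p + m₀) t (σ + τ * I)‖ ≤
        C * Real.exp (-ε * |τ|) := by
  have hs0 := hσ 0 (by simpa using hρ.pos.le)
  obtain ⟨δ, hδ, hδ1, hδ2⟩ := ht₀.exists_gap
  obtain ⟨C, T, hC⟩ := exists_norm_mbIntegrand_le hpos hN (ξ := ξ) l (a := σ - 1) (b := σ + 1)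
    (by linarith [hs0.one_le]) hs0.arg_pos hδ (2 + m₀ + |t₀.re| + 1)
  have hV : ∀ᶠ t : ℂ in 𝓝 t₀, |t.re| < 2 + m₀ + |t₀.re| + 1 ∧
      2 * ((l : ℝ) - 1) * Real.pi + 2 * δ < t.im ∧ t.im < 2 * (l : ℝ) * Real.pi - 2 * δ := by
    have h1 : Continuous fun t : ℂ => |t.re| := by fun_prop
    have h2 : |t₀.re| < 2 + m₀ + |t₀.re| + 1 := by linarith [Nat.cast_nonneg (α := ℝ) m₀]
    exact (h1.continuousAt.eventually (gt_mem_nhds h2)).and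
      ((continuous_im.continuousAt.eventually (lt_mem_nhds hδ1)).and
        (continuous_im.continuousAt.eventually (gt_mem_nhds hδ2)))
  obtain ⟨r, hr, hrV⟩ := Metric.nhds_basis_closedBall.mem_iff.1 hV
  obtain ⟨B, hB⟩ := ((isCompact_closedBall t₀ r).prod ((isCompact_closedBall (0 : ℂ) ρ).prod
    (isCompact_Icc (a := -T) (b := T)))).exists_bound_of_continuousOn
    ((continuousOn_mbIntegrand l hσ).mono (prod_mono (subset_univ _)
      (prod_mono subset_rfl (subset_univ _))))
  refine ⟨δ, |C| + |B| * Real.exp (δ * T), hδ, ?_⟩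
  filter_upwards [Metric.closedBall_mem_nhds t₀ hr] with t ht p hp τ
  have hsp := hσ p (by simpa using hp)
  rw [add_mul]
  by_cases hτ : T ≤ |τ|
  · obtain ⟨h1, h2, h3⟩ := hrV ht
    have h4 : |(sectorPoint g p + m₀).im| ≤ 2 + m₀ + |t₀.re| + 1 := by
      have h5 := norm_sectorPoint_le hpos hN hρ hg (p := p) (by simpa using hp)
      rw [add_im, natCast_im, add_zero]
      linarith [abs_im_le_norm (sectorPoint g p), abs_nonneg t₀.re,
        Nat.cast_nonneg (α := ℝ) m₀]
    have h6 := hC (sectorPoint g p + m₀) t (σ + τ * I) h4 h1.le h2.le h3.le (by simp) (by simp)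
      (by simpa using hτ)
    have him : ((σ : ℂ) + τ * I).im = τ := by simp
    rw [him] at h6
    have h7 : C * Real.exp (-δ * |τ|) ≤ |C| * Real.exp (-δ * |τ|) := by
      gcongr; exact le_abs_self C
    have h8 : 0 ≤ |B| * Real.exp (δ * T) * Real.exp (-δ * |τ|) := by positivity
    linarith
  · have h1 := hB (t, p, τ) ⟨ht, hp, abs_le.1 (not_le.1 hτ).le⟩
    have h2 : 1 ≤ Real.exp (δ * T) * Real.exp (-δ * |τ|) := by
      rw [← Real.exp_add, Real.one_le_exp_iff]
      nlinarith [not_le.1 hτ]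
    have h3 : |B| * 1 ≤ |B| * (Real.exp (δ * T) * Real.exp (-δ * |τ|)) := by gcongr
    have h4 : 0 ≤ |C| * Real.exp (-δ * |τ|) := by positivity
    have h5 := le_abs_self B
    simp only at h1
    linarith

theorem isOpen_inWindow (l : ℤ) : IsOpen {t : ℂ | InWindow l t} :=
  (isOpen_lt continuous_const continuous_im).inter (isOpen_lt continuous_im continuous_const)

theorem continuous_mbIntegrand_line {w : Fin N → ℕ} {ξ : ℂ} {ρ : ℝ} {g : ℚ} (l : ℤ) {m₀ : ℕ}
    {σ : ℝ} (hσ : ∀ p : ℂ, ‖p‖ ≤ ρ → IsSeparating w ξ (sectorPoint g p + m₀) σ) (t : ℂ) {p : ℂ}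
    (hp : p ∈ Metric.closedBall (0 : ℂ) ρ) :
    Continuous fun τ : ℝ => mbIntegrand w ξ l (sectorPoint g p + m₀) t (σ + τ * I) :=
  (continuousOn_mbIntegrand l hσ).comp_continuous (f := fun τ : ℝ => (t, p, τ)) (by fun_prop)
    fun _ => ⟨mem_univ _, hp, mem_univ _⟩

theorem continuousOn_mbSum {w : Fin N → ℕ} (hpos : ∀ j, 0 < w j) (hN : 0 < N) {ξ : ℂ}
    {ρ : ℝ} (hρ : IsRadius w ξ ρ) {g : ℚ} (hg : IsSectorShift w g) {l : ℤ} {m₀ : ℕ} {σ : ℝ}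
    (hσ : ∀ p : ℂ, ‖p‖ ≤ ρ → IsSeparating w ξ (sectorPoint g p + m₀) σ) {t : ℂ}
    (ht : InWindow l t) : ContinuousOn (mbSum w ξ l g m₀ σ t) (Metric.closedBall 0 ρ) := by
  obtain ⟨ε, C, hε, hC⟩ := exists_bound_mbIntegrand hpos hN hρ hg hσ ht
  refine ContinuousOn.add (continuousOn_finsetSum _ fun m _ => by
    exact_mod_cast continuousOn_gammaTerm_sectorPoint hρ hg t m) (continuousOn_const.mul ?_)
  refine continuousOn_of_dominated (fun p hp =>
    (continuous_mbIntegrand_line l hσ t hp).aestronglyMeasurable)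
    (fun p hp => Eventually.of_forall fun τ => hC.self_of_nhds p hp τ)
    ((integrable_exp_neg_mul_abs hε).const_mul C) (Eventually.of_forall fun τ => ?_)
  exact (continuousOn_mbIntegrand l hσ).comp (f := fun p : ℂ => (t, p, τ)) (by fun_prop)
    fun p hp => ⟨mem_univ _, hp, mem_univ _⟩

theorem differentiable_gammaTerm_left (w : Fin N → ℕ) (ξ s : ℂ) :
    Differentiable ℂ fun t => gammaTerm w ξ t s := by
  unfold gammaTerm
  fun_prop

theorem differentiableOn_jet_mbSum {w : Fin N → ℕ} (hpos : ∀ j, 0 < w j) (hN : 0 < N) {ξ : ℂ}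
    {ρ : ℝ} (hρ : IsRadius w ξ ρ) {g : ℚ} (hg : IsSectorShift w g) {l : ℤ} {m₀ : ℕ} {σ : ℝ}
    (hσ : ∀ p : ℂ, ‖p‖ ≤ ρ → IsSeparating w ξ (sectorPoint g p + m₀) σ) (n : ℕ) :
    DifferentiableOn ℂ (fun t => jet n ρ (mbSum w ξ l g m₀ σ t)) {t : ℂ | InWindow l t} := by
  refine differentiableOn_jet hρ.pos (isOpen_inWindow l) (fun t ht =>
    (continuousOn_mbSum hpos hN hρ hg hσ ht).mono Metric.sphere_subset_closedBall) (fun p hp => ?_)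
    fun t₀ ht₀ => ?_
  · have hp' := Metric.sphere_subset_closedBall hp
    refine DifferentiableOn.add (DifferentiableOn.fun_sum fun m _ =>
      (differentiable_gammaTerm_left w ξ _).differentiableOn) (DifferentiableOn.const_mul ?_ _)
    refine differentiableOn_integral (isOpen_inWindow l) (fun t _ =>
      (continuous_mbIntegrand_line l hσ t hp').aestronglyMeasurable) (fun τ => ?_) fun t₀ ht₀ => ?_
    · exact ((differentiable_gammaTerm_left w ξ _).mul_const _).differentiableOn
    · obtain ⟨ε, C, hε, hC⟩ := exists_bound_mbIntegrand hpos hN hρ hg hσ ht₀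
      exact ⟨_, (integrable_exp_neg_mul_abs hε).const_mul C, hC.mono fun t h τ => h p hp' τ⟩
  · obtain ⟨ε, C, hε, hC⟩ := exists_bound_mbIntegrand hpos hN hρ hg hσ ht₀
    have hsum : ∃ D, ∀ᶠ t in 𝓝 t₀, ∀ p ∈ Metric.closedBall (0 : ℂ) ρ,
        ‖∑ m ∈ Finset.range m₀, gammaTerm w ξ t (sectorPoint g p + m)‖ ≤ D := by
      have hc : ContinuousOn (fun y : ℂ × ℂ => ∑ m ∈ Finset.range m₀,
          gammaTerm w ξ y.1 (sectorPoint g y.2 + m))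
          (Metric.closedBall t₀ 1 ×ˢ Metric.closedBall 0 ρ) :=
        continuousOn_finsetSum _ fun m _ => by
          have := continuousOn_gammaTerm hρ hg m
          exact_mod_cast this.mono (prod_mono_left (subset_univ _))
      obtain ⟨D, hD⟩ := ((isCompact_closedBall t₀ 1).prod
        (isCompact_closedBall (0 : ℂ) ρ)).exists_bound_of_continuousOn hc
      refine ⟨D, ?_⟩
      filter_upwards [Metric.closedBall_mem_nhds t₀ one_pos] with t ht p hp
      exact hD (t, p) ⟨ht, hp⟩
    obtain ⟨D, hD⟩ := hsum
    refine ⟨D + ∫ τ : ℝ, C * Real.exp (-ε * |τ|), ?_⟩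
    filter_upwards [hC, hD] with t h1 h2 p hp
    have hp' := Metric.sphere_subset_closedBall hp
    refine (norm_add_le _ _).trans (add_le_add (h2 p hp') ?_)
    rw [norm_mul, norm_neg, norm_I, one_mul]
    exact norm_integral_le_of_norm_le ((integrable_exp_neg_mul_abs hε).const_mul C)
      (Eventually.of_forall fun τ => h1 p hp' τ)

theorem differentiableOn_jet_gwSum {w : Fin N → ℕ} (hpos : ∀ j, 0 < w j) (hN : 0 < N) {ξ : ℂ}
    {ρ : ℝ} (hρ : IsRadius w ξ ρ) {g : ℚ} (hg : IsSectorShift w g) (n : ℕ) :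
    DifferentiableOn ℂ (fun t => jet n ρ (gwSum w ξ g t)) {t : ℂ | t.re < Real.log (vc w)} := by
  refine differentiableOn_jet hρ.pos (isOpen_lt continuous_re continuous_const) (fun t ht => ?_)
    (fun p hp => ?_) fun t₀ ht₀ => ?_
  · obtain ⟨u, hu, hub⟩ := exists_bound_gammaTerm hpos hN hρ hg (t₀ := t) ht
    refine continuousOn_tsum (fun m => ?_) hu fun m p hp =>
      hub.self_of_nhds m p (Metric.sphere_subset_closedBall hp)
    exact_mod_cast (continuousOn_gammaTerm_sectorPoint hρ hg t m).mono
      Metric.sphere_subset_closedBall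
  · refine differentiableOn_tsum_of_locally_bounded
      (fun m => differentiable_gammaTerm_left w ξ _) fun t₀ ht₀ => ?_
    obtain ⟨u, hu, hub⟩ := exists_bound_gammaTerm hpos hN hρ hg (t₀ := t₀) ht₀
    exact ⟨u, hu, hub.mono fun t h m => h m p (Metric.sphere_subset_closedBall hp)⟩
  · obtain ⟨u, hu, hub⟩ := exists_bound_gammaTerm hpos hN hρ hg (t₀ := t₀) ht₀
    refine ⟨∑' m, u m, hub.mono fun t h p hp => ?_⟩
    exact tsum_of_norm_bounded hu.hasSum fun m => h m p (Metric.sphere_subset_closedBall hp)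

theorem differentiableOn_resSum {w : Fin N → ℕ} (hpos : ∀ j, 0 < w j) (hN : 0 < N) (ξ : ℂ)
    (i : ℕ) : DifferentiableOn ℂ (fun t => resSum w ξ t i) {t : ℂ | Real.log (vc w) < t.re} := by
  refine differentiableOn_tsum_of_locally_bounded (fun m => by fun_prop) fun t₀ ht₀ => ?_
  exact exists_bound_gammaRes hpos hN ξ (k := i + 1) (by omega) ht₀

/-! ### Restriction to the sectors -/

theorem isInt_iff {q : ℚ} : q.isInt ↔ ∃ m : ℤ, q = m := by
  constructor
  · intro h
    exact ⟨q.num, ((Rat.den_eq_one_iff q).1 (by simpa [Rat.isInt] using h)).symm⟩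
  · rintro ⟨m, rfl⟩
    simp [Rat.isInt]

theorem isSectorShift_fract {w : Fin N → ℕ} (hpos : ∀ j, 0 < w j)
    (hdvd : ∀ j, w j ∣ deg w) {f : ℚ} (hf : f ∈ sectors w) :
    IsSectorShift w (Int.fract (1 - f)) := by
  obtain ⟨-, -, j, m, hm⟩ := (mem_sectors hpos).1 hf
  obtain ⟨c, hc⟩ := hdvd j
  refine ⟨Int.fract_nonneg _, Int.fract_lt_one _, deg w * (1 - ⌊1 - f⌋) - c * m, ?_⟩
  have hc' : (deg w : ℚ) = w j * c := by exact_mod_cast hc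
  rw [Int.fract]
  push_cast
  rw [← hm]
  linear_combination -f * hc'

theorem diffContOnCl_of_forall_norm_le {ρ : ℝ} (hρ : 0 < ρ) {G : ℂ → ℂ}
    (h : ∀ p : ℂ, ‖p‖ ≤ ρ → DifferentiableAt ℂ G p) : DiffContOnCl ℂ G (Metric.ball 0 ρ) := by
  refine DifferentiableOn.diffContOnCl fun p hp => (h p ?_).differentiableWithinAt
  rw [closure_ball _ hρ.ne'] at hp
  simpa using hp

theorem differentiable_sectorPoint (g : ℚ) : Differentiable ℂ (sectorPoint g) := by
  unfold sectorPoint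
  fun_prop

theorem diffContOnCl_gammaTerm {w : Fin N → ℕ} {ξ : ℂ} {ρ : ℝ} (hρ : IsRadius w ξ ρ)
    {g : ℚ} (hg : IsSectorShift w g) (t : ℂ) (m : ℤ) :
    DiffContOnCl ℂ (fun p => gammaTerm w ξ t (sectorPoint g p + m)) (Metric.ball 0 ρ) := by
  refine diffContOnCl_of_forall_norm_le hρ.pos fun p hp => ?_
  have h1 : DifferentiableAt ℂ (gammaTerm w ξ t) (sectorPoint g p + m) :=
    differentiableAt_gammaTerm w fun k _ hk => hρ.generic_sectorPoint hg hp m (-k) (by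
      rw [hk]; push_cast; rfl)
  exact h1.comp p ((differentiable_sectorPoint g p).add_const _)

theorem diffContOnCl_kern {w : Fin N → ℕ} (hd : (deg w : ℂ) ≠ 0) {ξ : ℂ} {ρ : ℝ}
    (hρ : IsRadius w ξ ρ) {g : ℚ} (hg : IsSectorShift w g) (l k : ℤ) :
    DiffContOnCl ℂ (fun p => kern l (sectorPoint g p) (gammaPole w ξ k)) (Metric.ball 0 ρ) := by
  refine diffContOnCl_of_forall_norm_le hρ.pos fun p hp => ?_
  have h1 : DifferentiableAt ℂ (kern l 0) (gammaPole w ξ k - sectorPoint g p) := by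
    refine differentiableAt_kern l fun n hn => ?_
    refine hρ.generic_sectorPoint hg hp 0 (deg w * n - k) ?_
    have h2 : deg w * gammaPole w ξ k = -(ξ + k) := by
      rw [gammaPole]; field_simp
    push_cast
    linear_combination deg w * hn + h2
  have h2 : (fun p => kern l (sectorPoint g p) (gammaPole w ξ k)) =
      kern l 0 ∘ fun p => gammaPole w ξ k - sectorPoint g p := by
    funext p
    exact kern_eq_of_sub_eq l 0 (by push_cast; ring)
  rw [h2]
  exact h1.comp p ((differentiable_sectorPoint g p).const_sub _)

/-- At the points `f̄ - 1, f̄ - 2, …` at least `N_f` of the Gamma functions in the denominator have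
a pole, so that the residues there vanish modulo `p ^ N_f`. -/
theorem jet_gammaTerm_left_eq_zero {w : Fin N → ℕ} (hpos : ∀ j, 0 < w j) {ξ : ℂ} {ρ : ℝ}
    (hρ : IsRadius w ξ ρ) {f : ℚ} (hg : IsSectorShift w (Int.fract (1 - f))) (t : ℂ) (m : ℕ) :
    jet (sectorRank w f) ρ
      (fun p => gammaTerm w ξ t (sectorPoint (Int.fract (1 - f)) p - 1 - m)) = 0 := by
  set g := Int.fract (1 - f) with hgf
  have hfac : ∀ j, ∃ h : ℂ → ℂ, Differentiable ℂ h ∧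
      ∀ p, (Gamma (1 + w j * (sectorPoint g p - 1 - m)))⁻¹ =
        (if (f * (w j : ℚ)).isInt then p else 1) * h p := by
    intro j
    have hent : Differentiable ℂ fun p => (Gamma (1 + w j * (sectorPoint g p - 1 - m)))⁻¹ :=
      differentiable_one_div_Gamma.comp
        ((((differentiable_sectorPoint g).sub_const _).sub_const _).const_mul _ |>.const_add _)
    split_ifs with hj
    · refine exists_eq_mul_of_apply_zero hent ?_
      obtain ⟨a, ha⟩ := isInt_iff.1 hj
      have h1 : (1 + w j * (g - 1 - m) : ℚ) = ((1 - a - w j * (⌊1 - f⌋ + m) : ℤ) : ℚ) := by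
        rw [hgf, Int.fract]
        push_cast
        linear_combination -ha
      have h2 : (1 - a - w j * (⌊1 - f⌋ + m) : ℤ) < 1 := by
        have h3 : (0 : ℚ) < w j := by exact_mod_cast hpos j
        have h4 : (w j : ℚ) * (g - 1 - m) < 0 := by
          refine mul_neg_of_pos_of_neg h3 ?_
          linarith [hg.lt_one, Nat.cast_nonneg (α := ℚ) m]
        have h5 : (1 + w j * (g - 1 - m) : ℚ) < 1 := by linarith
        rw [h1] at h5
        exact_mod_cast h5
      obtain ⟨n, hn⟩ : ∃ n : ℕ, (1 - a - w j * (⌊1 - f⌋ + m) : ℤ) = -n :=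
        ⟨(-(1 - a - w j * (⌊1 - f⌋ + m) : ℤ)).toNat, by omega⟩
      have h6 : (1 + w j * (sectorPoint g 0 - 1 - m) : ℂ) = -n := by
        have := congrArg (Rat.cast (K := ℂ)) (h1.trans (by rw [hn]))
        rw [sectorPoint, zero_div, zero_add]
        push_cast at this ⊢
        exact this
      rw [h6, Gamma_neg_nat_eq_zero, inv_zero]
    · exact ⟨_, hent, fun p => (one_mul _).symm⟩
  choose h hd hh using hfac
  have hG : DiffContOnCl ℂ (fun p => Gamma (1 + ξ + deg w * (sectorPoint g p - 1 - m)) *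
      exp (t * (sectorPoint g p - 1 - m)) * ∏ j, h j p) (Metric.ball 0 ρ) := by
    have hs : Differentiable ℂ fun p => sectorPoint g p - 1 - (m : ℂ) :=
      ((differentiable_sectorPoint g).sub_const _).sub_const _
    refine diffContOnCl_of_forall_norm_le hρ.pos fun p hp => ?_
    refine DifferentiableAt.mul (DifferentiableAt.mul ?_ ((hs p).const_mul t).cexp)
      (DifferentiableAt.fun_finsetProd fun j _ => hd j p)
    refine DifferentiableAt.comp (g := Gamma) p (differentiableAt_Gamma _ fun n hn => ?_)
      (((hs p).const_mul _).const_add _)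
    refine hρ.generic_sectorPoint hg hp (-(m + 1)) (-(n + 1)) ?_
    push_cast
    linear_combination hn
  rw [← jet_pow_mul_eq_zero hρ.pos hG]
  congr 1
  funext p
  have hprod : (∏ j, Gamma (1 + w j * (sectorPoint g p - 1 - m)))⁻¹ =
      p ^ sectorRank w f * ∏ j, h j p := by
    rw [← Finset.prod_inv_distrib, Finset.prod_congr rfl fun j _ => hh j p, Finset.prod_mul_distrib,
      Finset.prod_ite, Finset.prod_const_one, mul_one, Finset.prod_const, sectorRank]
  rw [gammaTerm, gammaRatio, div_eq_mul_inv, hprod]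
  ring

/-- Modulo `p ^ N_f`, only the residues at the poles of `gammaRatio` remain. -/
theorem jet_mbSum_of_lt_re {w : Fin N → ℕ} (hpos : ∀ j, 0 < w j) (hN : 0 < N) {ξ : ℂ} {ρ : ℝ}
    (hρ : IsRadius w ξ ρ) {f : ℚ} (hg : IsSectorShift w (Int.fract (1 - f))) {l : ℤ} {m₀ : ℕ}
    {σ : ℝ} (hσ : ∀ p : ℂ, ‖p‖ ≤ ρ → IsSeparating w ξ (sectorPoint (Int.fract (1 - f)) p + m₀) σ)
    {t : ℂ} (htw : InWindow l t) (ht : Real.log (vc w) < t.re) :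
    jet (sectorRank w f) ρ (mbSum w ξ l (Int.fract (1 - f)) m₀ σ t) =
      ∑ i : Fin (deg w), (-(2 * Real.pi * I) * resSum w ξ t i) • jet (sectorRank w f) ρ
        (fun p => kern l (sectorPoint (Int.fract (1 - f)) p) (gammaPole w ξ (i + 1))) := by
  have hd : (deg w : ℂ) ≠ 0 := by exact_mod_cast (deg_pos hpos hN).ne'
  set g := Int.fract (1 - f) with hgf
  obtain ⟨u, hu, hub⟩ := exists_bound_gammaTerm_left hpos hN hρ hg ht
  have hub' : ∀ m : ℕ, ∀ p ∈ Metric.sphere (0 : ℂ) ρ,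
      ‖gammaTerm w ξ t (sectorPoint g p - 1 - m)‖ ≤ u m :=
    fun m p hp => hub m p (Metric.sphere_subset_closedBall hp)
  have hcont : ∀ m : ℕ, ContinuousOn (fun p => gammaTerm w ξ t (sectorPoint g p - 1 - m))
      (Metric.sphere 0 ρ) := fun m => by
    have := (continuousOn_gammaTerm_sectorPoint hρ hg t (-(m + 1))).mono
      (Metric.sphere_subset_closedBall (x := (0 : ℂ)) (ε := ρ))
    refine this.congr fun p _ => ?_
    push_cast
    congr 1
    ring
  have hzero : jet (sectorRank w f) ρ
      (fun p => ∑' m : ℕ, gammaTerm w ξ t (sectorPoint g p - 1 - m)) = 0 := by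
    exact (hasSum_jet hρ.pos hcont hu hub').unique
      (hasSum_zero.congr_fun fun m => jet_gammaTerm_left_eq_zero hpos hρ hg t m)
  have hk : ∀ i : Fin (deg w), ContinuousOn (fun p => -(2 * Real.pi * I) * resSum w ξ t i *
      kern l (sectorPoint g p) (gammaPole w ξ (i + 1))) (Metric.sphere 0 ρ) := fun i => by
    refine continuousOn_const.mul ?_
    have h1 := (diffContOnCl_kern hd hρ hg l (i + 1)).continuousOn
    rw [closure_ball _ hρ.pos.ne'] at h1
    exact_mod_cast h1.mono Metric.sphere_subset_closedBall
  have hT : ContinuousOn (fun p => -1 * ∑' m : ℕ, gammaTerm w ξ t (sectorPoint g p - 1 - m))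
      (Metric.sphere 0 ρ) := continuousOn_const.mul (continuousOn_tsum hcont hu hub')
  rw [jet_congr hρ.pos fun p hp => mbSum_eq hpos hN hρ hg (by simpa using hp.le)
    (hσ p (by simpa using hp.le)) htw ht, jet_add hρ.pos hT
    (continuousOn_finsetSum _ fun i _ => hk i), jet_const_mul, hzero, smul_zero, zero_add,
    jet_sum hρ.pos _ hk]
  exact Finset.sum_congr rfl fun i _ => jet_const_mul _ _

/-! ### The Gromov-Witten side -/

/-- The exponents of the summands with values in the sector of `f` are `f̄, f̄ + 1, f̄ + 2, …`. -/
theorem exists_gwIndex_iff {w : Fin N → ℕ} (hpos : ∀ j, 0 < w j) {f : ℚ} (hf : f ∈ sectors w)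
    {n : ℚ} : ((0 ≤ n ∧ ∃ j, (n * (w j : ℚ)).isInt) ∧ Int.fract (-n) = f) ↔
      ∃ m : ℕ, n = Int.fract (1 - f) + m := by
  obtain ⟨hf0, hf1, j, a, ha⟩ := (mem_sectors hpos).1 hf
  constructor
  · rintro ⟨⟨hn, -⟩, h⟩
    obtain ⟨-, -, z, hz⟩ := Int.fract_eq_iff.1 h
    have h1 : n = Int.fract (1 - f) + ((⌊1 - f⌋ - 1 - z : ℤ) : ℚ) := by
      rw [Int.fract]
      push_cast
      linear_combination -hz
    have h2 : (-1 : ℚ) < ((⌊1 - f⌋ - 1 - z : ℤ) : ℚ) := by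
      linarith [Int.fract_lt_one (1 - f)]
    have h3 : (-1 : ℤ) < ⌊1 - f⌋ - 1 - z := by exact_mod_cast h2
    obtain ⟨m, hm⟩ := Int.eq_ofNat_of_zero_le (show 0 ≤ ⌊1 - f⌋ - 1 - z by omega)
    refine ⟨m, ?_⟩
    rw [h1, hm]
    simp
  · rintro ⟨m, rfl⟩
    refine ⟨⟨add_nonneg (Int.fract_nonneg _) (Nat.cast_nonneg _), j, isInt_iff.2
      ⟨w j * (1 - ⌊1 - f⌋ + m) - a, ?_⟩⟩, Int.fract_eq_iff.2 ⟨hf0, hf1, ⌊1 - f⌋ - 1 - m, ?_⟩⟩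
    · rw [Int.fract]
      push_cast
      linear_combination -ha
    · rw [Int.fract]
      push_cast
      ring

theorem gwTerm_apply {w : Fin N → ℕ} {ξ : ℂ} {ρ : ℝ} (hρ : IsRadius w ξ ρ) (t : ℂ)
    (f : sectors w) (hg : IsSectorShift w (Int.fract (1 - (f : ℚ)))) (n : GWIndex w) {m : ℕ}
    (hn : (n : ℚ) = Int.fract (1 - (f : ℚ)) + m) (hfn : Int.fract (-(n : ℚ)) = f) :
    gwTerm w ξ t n f = jet (sectorRank w f) ρ
      (fun p => gammaTerm w ξ t (sectorPoint (Int.fract (1 - (f : ℚ))) p + m)) := by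
  have hG := diffContOnCl_gammaTerm hρ hg t m
  rw [Int.cast_natCast] at hG
  rw [← ofHyperplane_eq_jet w hρ.pos hG, gwTerm, Pi.mul_apply, unitClass, if_pos hfn.symm, mul_one]
  refine congrFun (congrArg (ofHyperplane w) (funext fun p => ?_)) f
  have hnc : (((n : ℚ)) : ℂ) = (Int.fract (1 - (f : ℚ)) : ℚ) + m := by
    rw [hn]; push_cast; rfl
  rw [gammaTerm, gammaRatio, sectorPoint, ← exp_add, hnc, mul_comm]
  congr 2
  · congr 1
    ring
  · refine Finset.prod_congr rfl fun j _ => ?_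
    congr 1
    ring
  · ring

theorem hasSum_gwTerm {w : Fin N → ℕ} (hpos : ∀ j, 0 < w j) (hN : 0 < N)
    (hdvd : ∀ j, w j ∣ deg w) {ξ : ℂ} {ρ : ℝ} (hρ : IsRadius w ξ ρ) {t : ℂ}
    (ht : t.re < Real.log (vc w)) :
    HasSum (gwTerm w ξ t) fun f : sectors w =>
      jet (sectorRank w f) ρ (gwSum w ξ (Int.fract (1 - (f : ℚ))) t) := by
  refine Pi.hasSum.2 fun f => ?_
  have hg := isSectorShift_fract hpos hdvd f.2
  have hidx := fun m : ℕ => (exists_gwIndex_iff hpos f.2).2 ⟨m, rfl⟩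
  let e : ℕ → GWIndex w := fun m => ⟨Int.fract (1 - (f : ℚ)) + m, (hidx m).1⟩
  have he : Function.Injective e := fun m m' h => by
    have := congrArg Subtype.val h
    simpa [e] using this
  refine (he.hasSum_iff fun n hn => ?_).1 ?_
  · rw [gwTerm, Pi.mul_apply, unitClass, if_neg, mul_zero]
    intro h
    obtain ⟨m, hm⟩ := (exists_gwIndex_iff hpos f.2).1 ⟨n.2, h.symm⟩
    exact hn ⟨m, Subtype.ext hm.symm⟩
  · obtain ⟨u, hu, hub⟩ := exists_bound_gammaTerm hpos hN hρ hg ht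
    refine (hasSum_jet (n := sectorRank w f) hρ.pos (G := fun m p => gammaTerm w ξ t
      (sectorPoint (Int.fract (1 - (f : ℚ))) p + m)) (fun m => ?_) hu fun m p hp =>
        hub.self_of_nhds m p (Metric.sphere_subset_closedBall hp)).congr_fun fun m => ?_
    · exact_mod_cast (continuousOn_gammaTerm_sectorPoint hρ hg t m).mono
        Metric.sphere_subset_closedBall
    · exact gwTerm_apply hρ t f hg (e m) rfl (hidx m).2

/-! ### The FJRW side and the connection map -/

theorem broadFactor_add_deg_mul {w : Fin N → ℕ} (hd : deg w ≠ 0) (ξ : ℂ) (k m : ℕ) :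
    broadFactor w ξ (k + deg w * m) = broadFactor w ξ k := by
  have hd' : (deg w : ℚ) ≠ 0 := by exact_mod_cast hd
  have h : ∀ j, (((k + deg w * m : ℕ) : ℚ) * charge w j) =
      (k : ℚ) * charge w j + ((w j * m : ℤ) : ℚ) := fun j => by
    rw [charge]
    push_cast
    field_simp
  refine Finset.prod_congr (Finset.filter_congr fun j _ => ?_) fun _ _ => rfl
  rw [h j, isInt_iff, isInt_iff]
  constructor
  · rintro ⟨a, ha⟩
    exact ⟨a - w j * m, by rw [Int.cast_sub, ← ha]; ring⟩
  · rintro ⟨a, ha⟩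
    exact ⟨a + w j * m, by rw [Int.cast_add, ← ha]⟩

theorem broadFactor_ne_zero {w : Fin N → ℕ} (hpos : ∀ j, 0 < w j) (hd : deg w ≠ 0) {ξ : ℂ}
    (hξ : ξ ≠ 0) (k : ℕ) : broadFactor w ξ k ≠ 0 := by
  refine Finset.prod_ne_zero_iff.2 fun j _ => mul_ne_zero (neg_ne_zero.2 ?_) hξ
  have h : charge w j ≠ 0 :=
    div_ne_zero (by exact_mod_cast (hpos j).ne') (by exact_mod_cast hd)
  exact_mod_cast h

/-- The FJRW summands are, up to `e^{-ξ log u}` and a factor depending only on `k` modulo `d`, the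
residues at the poles `s_k`, with `log v = -d log u`. -/
theorem fjrwTerm_apply {w : Fin N → ℕ} (hd : deg w ≠ 0) (ξ u : ℂ) (i : Fin (deg w)) (k : ℕ+)
    {m : ℕ} (hk : (k : ℕ) = i + 1 + deg w * m) :
    fjrwTerm w ξ u k i = 2 * Real.pi * I * deg w / broadFactor w ξ (i + 1) * exp (-ξ * u) *
      (gammaRes w ξ (i + 1 + deg w * m) *
        exp (-(deg w) * u * gammaPole w ξ (i + 1 + deg w * m))) := by
  have hd' : (deg w : ℂ) ≠ 0 := by exact_mod_cast hd
  have hk1 : (k : ℕ) - 1 = i + deg w * m := by omega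
  have hmod : (i : ℕ) = (i + deg w * m) % deg w := by
    rw [Nat.add_mul_mod_self_left, Nat.mod_eq_of_lt i.2]
  have hkz : ((i : ℤ) + 1 + deg w * m) = ((k : ℕ) : ℤ) := by rw [hk]; push_cast; ring
  have hexp : exp ((k : ℕ) * u) = exp (-ξ * u) * exp (-(deg w) * u * gammaPole w ξ (k : ℕ)) := by
    rw [← exp_add, gammaPole]
    congr 1
    push_cast
    field_simp
    ring
  have hsign : ((-1 : ℂ)) ^ (((k : ℕ) : ℤ) - 1) = (-1) ^ ((k : ℕ) - 1) := by
    rw [← zpow_natCast, Nat.cast_sub (show 1 ≤ (k : ℕ) from k.pos), Nat.cast_one]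
  rw [hkz, fjrwTerm, Pi.smul_apply, phi, hk1, if_pos hmod, smul_eq_mul, mul_one, hexp, gammaRes,
    hsign, hk1, ← broadFactor_add_deg_mul hd ξ (i + 1) m, ← hk]
  push_cast
  generalize ∏ j, Gamma (1 - (charge w j : ℂ) * ((k : ℕ) + ξ)) = P
  field_simp

theorem hasSum_fjrwTerm {w : Fin N → ℕ} (hpos : ∀ j, 0 < w j) (hN : 0 < N) (ξ : ℂ) {u : ℂ}
    (hu : Real.log (vc w) < (-(deg w) * u).re) :
    HasSum (fjrwTerm w ξ u) fun i =>
      2 * Real.pi * I * deg w / broadFactor w ξ (i + 1) * exp (-ξ * u) *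
        resSum w ξ (-(deg w) * u) i := by
  have hd := deg_pos hpos hN
  refine Pi.hasSum.2 fun i => ?_
  let e : ℕ → ℕ+ := fun m => ⟨i + 1 + deg w * m, by positivity⟩
  have he : Function.Injective e := fun m m' h => by
    have h1 : (i : ℕ) + 1 + deg w * m = i + 1 + deg w * m' := congrArg PNat.val h
    exact Nat.eq_of_mul_eq_mul_left hd (Nat.add_left_cancel h1)
  refine (he.hasSum_iff fun k hk => ?_).1 ?_
  · rw [fjrwTerm, Pi.smul_apply, phi, if_neg, smul_zero]
    intro h
    refine hk ⟨((k : ℕ) - 1) / deg w, PNat.eq ?_⟩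
    change (i : ℕ) + 1 + deg w * (((k : ℕ) - 1) / deg w) = k
    have h1 := Nat.mod_add_div ((k : ℕ) - 1) (deg w)
    have h2 := k.pos
    omega
  · exact ((hasSum_resSum hpos hN ξ i hu).mul_left _).congr_fun fun m =>
      fjrwTerm_apply hd.ne' ξ u i (e m) rfl

theorem windowExp_eq {w : Fin N → ℕ} (ξ : ℂ) (k : ℕ) (f : ℚ) (p : ℂ) :
    windowExp w ξ k f p =
      exp (2 * Real.pi * I * (sectorPoint (Int.fract (1 - f)) p - gammaPole w ξ k)) := by
  have h := two_pi_I_ne_zero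
  rw [windowExp, ← exp_nat_mul, ← exp_add, sectorPoint, gammaPole]
  congr 1
  have h1 : 2 * (Real.pi : ℂ) * I * (p / (2 * Real.pi * I)) = p := mul_div_cancel₀ _ h
  push_cast
  linear_combination -h1

/-- The entries of the connection map are the values of the periodic kernel at the poles `s_k`. -/
theorem connectionValue_apply {w : Fin N → ℕ} (hd : (deg w : ℂ) ≠ 0) {ξ : ℂ} {ρ : ℝ}
    (hρ : IsRadius w ξ ρ) (l : ℤ) (k : ℕ) (f : sectors w)
    (hg : IsSectorShift w (Int.fract (1 - (f : ℚ)))) :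
    connectionValue w l ξ k f = (-(broadFactor w ξ k / deg w)) • jet (sectorRank w f) ρ
      (fun p => kern l (sectorPoint (Int.fract (1 - (f : ℚ))) p) (gammaPole w ξ k)) := by
  have h1 : (fun p => windowExp w ξ k f p ^ l / (windowExp w ξ k f p - 1)) = fun p =>
      (-1) * kern l (sectorPoint (Int.fract (1 - (f : ℚ))) p) (gammaPole w ξ k) := by
    funext p
    rw [windowExp_eq, kern]
    ring
  have hG := diffContOnCl_kern hd hρ hg l k
  have hG' : DiffContOnCl ℂ (fun p =>
      (-1) * kern l (sectorPoint (Int.fract (1 - (f : ℚ))) p) (gammaPole w ξ k))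
      (Metric.ball 0 ρ) := hG.const_smul (-1 : ℂ)
  rw [connectionValue, Pi.smul_apply, Finset.sum_apply, Finset.sum_eq_single (f : ℚ)]
  · rw [Pi.smul_apply, Pi.mul_apply, unitClass, if_pos rfl, one_mul, h1,
      ofHyperplane_eq_jet w hρ.pos hG', jet_const_mul, smul_smul, smul_smul]
    congr 1
    ring
  · intro f' _ hf'
    rw [Pi.smul_apply, Pi.mul_apply, unitClass, if_neg (Ne.symm hf'), zero_mul, smul_zero]
  · exact fun h => (h f.2).elim

theorem connectionMap_apply (w : Fin N → ℕ) (l : ℤ) (ξ : ℂ) (x : Hext w) :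
    connectionMap w l ξ x = ∑ i, x i • connectionValue w l ξ ((i : ℕ) + 1) := by
  rw [connectionMap, Module.Basis.constr_apply_fintype]
  rfl

/-- The sum of the residues at the poles `s_k`, as a function of `t = log v` with values in
`H_CR(ℙ(w))`. -/
def fjrwBranch (w : Fin N → ℕ) (ξ : ℂ) (l : ℤ) (ρ : ℝ) (t : ℂ) : HCR w := fun f =>
  ∑ i : Fin (deg w), (-(2 * Real.pi * I) * resSum w ξ t i) • jet (sectorRank w f) ρ
    (fun p => kern l (sectorPoint (Int.fract (1 - (f : ℚ))) p) (gammaPole w ξ (i + 1)))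

theorem connectionMap_hFJRW {w : Fin N → ℕ} (hpos : ∀ j, 0 < w j) (hN : 0 < N)
    (hdvd : ∀ j, w j ∣ deg w) {z lam : ℂ} (hξ : lam / z ≠ 0) {ρ : ℝ} (hρ : IsRadius w (lam / z) ρ)
    (l : ℤ) {u : ℂ} (hu : Real.log (vc w) < (-(deg w) * u).re) :
    connectionMap w l (lam / z) (hFJRW w z lam u) =
      exp (-(lam / z) * u) • z • fjrwBranch w (lam / z) l ρ (-(deg w) * u) := by
  have hd := (deg_pos hpos hN).ne'
  have hd' : (deg w : ℂ) ≠ 0 := by exact_mod_cast hd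
  rw [connectionMap_apply, hFJRW, (hasSum_fjrwTerm hpos hN _ hu).tsum_eq]
  funext f
  rw [Finset.sum_apply, Pi.smul_apply, Pi.smul_apply, fjrwBranch, Finset.smul_sum, Finset.smul_sum]
  refine Finset.sum_congr rfl fun i _ => ?_
  have hB := broadFactor_ne_zero hpos hd hξ (i + 1)
  rw [Pi.smul_apply, Pi.smul_apply, connectionValue_apply hd' hρ l _ f
    (isSectorShift_fract hpos hdvd f.2), smul_smul, smul_smul, smul_smul, smul_eq_mul]
  push_cast
  congr 1
  field_simp

/-! ### Continuation along the path -/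

/-- Analytic continuation along a path is unique. -/
theorem IsContinuationAlong.eventuallyEq {V : Type*} [NormedAddCommGroup V] [NormedSpace ℂ V]
    [CompleteSpace V] {a b : ℂ} {γ : Path a b} {F : ℂ → V} {Φ Ψ : unitInterval → ℂ → V}
    (h1 : IsContinuationAlong γ F Φ) (h2 : IsContinuationAlong γ F Ψ) (s : unitInterval) :
    Φ s =ᶠ[𝓝 (γ s)] Ψ s := by
  set S : Set unitInterval := {s | Φ s =ᶠ[𝓝 (γ s)] Ψ s} with hS
  have hopen : IsOpen S := by
    refine isOpen_iff_mem_nhds.2 fun s hs => ?_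
    have h3 : ∀ᶠ s' in 𝓝 s, Φ s =ᶠ[𝓝 (γ s')] Ψ s :=
      (γ.continuous.tendsto s).eventually (eventually_eventually_nhds.2 hs)
    filter_upwards [h1.compatible s, h2.compatible s, h3] with s' h4 h5 h6
    exact (h4.trans h6).trans h5.symm
  have hclosed : IsClosed S := by
    refine isClosed_iff_frequently.2 fun s hs => ?_
    obtain ⟨r₁, hr₁, hΦ⟩ := (h1.analyticAt s).exists_ball_analyticOnNhd
    obtain ⟨r₂, hr₂, hΨ⟩ := (h2.analyticAt s).exists_ball_analyticOnNhd
    have hr : 0 < min r₁ r₂ := lt_min hr₁ hr₂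
    have h3 : ∀ᶠ s' in 𝓝 s, γ s' ∈ Metric.ball (γ s) (min r₁ r₂) :=
      (γ.continuous.tendsto s).eventually (Metric.ball_mem_nhds _ hr)
    obtain ⟨s', hs', h4, h5, h6⟩ :=
      (hs.and_eventually ((h1.compatible s).and ((h2.compatible s).and h3))).exists
    have hΦ' := hΦ.mono (Metric.ball_subset_ball (min_le_left r₁ r₂))
    have h7 := hΦ'.eqOn_of_preconnected_of_eventuallyEq
      (hΨ.mono (Metric.ball_subset_ball (min_le_right _ _)))
      (convex_ball (γ s) (min r₁ r₂)).isPreconnected h6 ((h4.symm.trans hs').trans h5)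
    exact h7.eventuallyEq_of_mem (Metric.ball_mem_nhds _ hr)
  have h0 : (0 : unitInterval) ∈ S := by
    change Φ 0 =ᶠ[𝓝 (γ 0)] Ψ 0
    rw [γ.source]
    exact h1.start.trans h2.start.symm
  have : S = univ := IsClopen.eq_univ ⟨hclosed, hopen⟩ ⟨0, h0⟩
  exact (this ▸ mem_univ s : s ∈ S)

instance (n : ℕ) : FiniteDimensional ℂ (ProjCohomology n) :=
  (ProjCohomology.coords n).symm.finiteDimensional

instance (n : ℕ) : CompleteSpace (ProjCohomology n) := FiniteDimensional.complete ℂ _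

/-- The Gromov-Witten series, with the sum over the exponents taken before the Taylor expansion. -/
def gwBranch (w : Fin N → ℕ) (ξ : ℂ) (ρ : ℝ) (t : ℂ) : HCR w := fun f =>
  jet (sectorRank w f) ρ (gwSum w ξ (Int.fract (1 - (f : ℚ))) t)

/-- The Mellin-Barnes integrals, as a function of `t = log v` with values in `H_CR(ℙ(w))`. -/
def mbBranch (w : Fin N → ℕ) (ξ : ℂ) (l : ℤ) (ρ : ℝ) (m₀ : sectors w → ℕ) (σ : sectors w → ℝ)
    (t : ℂ) : HCR w := fun f =>
  jet (sectorRank w f) ρ (mbSum w ξ l (Int.fract (1 - (f : ℚ))) (m₀ f) (σ f) t)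

/-- The three branches, which agree where they overlap in the window, glued along the line
`Re log v = log v_c`. -/
def gluedBranch (w : Fin N → ℕ) (ξ : ℂ) (l : ℤ) (ρ : ℝ) (m₀ : sectors w → ℕ) (σ : sectors w → ℝ)
    (t : ℂ) : HCR w :=
  if t.re < Real.log (vc w) then gwBranch w ξ ρ t
  else if Real.log (vc w) < t.re then fjrwBranch w ξ l ρ t
  else mbBranch w ξ l ρ m₀ σ t

theorem gluedBranch_of_inWindow {w : Fin N → ℕ} (hpos : ∀ j, 0 < w j) (hN : 0 < N)
    (hdvd : ∀ j, w j ∣ deg w) {ξ : ℂ} {ρ : ℝ} (hρ : IsRadius w ξ ρ) {l : ℤ} {m₀ : sectors w → ℕ}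
    {σ : sectors w → ℝ} (hσ : ∀ (f : sectors w) (p : ℂ), ‖p‖ ≤ ρ →
      IsSeparating w ξ (sectorPoint (Int.fract (1 - (f : ℚ))) p + m₀ f) (σ f)) {t : ℂ}
    (ht : InWindow l t) : gluedBranch w ξ l ρ m₀ σ t = mbBranch w ξ l ρ m₀ σ t := by
  rw [gluedBranch]
  split_ifs with h1 h2
  · funext f
    have hg := isSectorShift_fract hpos hdvd f.2
    exact jet_congr hρ.pos fun p hp => gwSum_eq_mbSum hpos hN hρ hg (by simpa using hp.le)
      (hσ f p (by simpa using hp.le)) ht h1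
  · funext f
    exact (jet_mbSum_of_lt_re hpos hN hρ (isSectorShift_fract hpos hdvd f.2) (hσ f) ht h2).symm
  · rfl

theorem analyticAt_gluedBranch {w : Fin N → ℕ} (hpos : ∀ j, 0 < w j) (hN : 0 < N)
    (hdvd : ∀ j, w j ∣ deg w) {ξ : ℂ} {ρ : ℝ} (hρ : IsRadius w ξ ρ) {l : ℤ} {m₀ : sectors w → ℕ}
    {σ : sectors w → ℝ} (hσ : ∀ (f : sectors w) (p : ℂ), ‖p‖ ≤ ρ →
      IsSeparating w ξ (sectorPoint (Int.fract (1 - (f : ℚ))) p + m₀ f) (σ f)) {t : ℂ}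
    (ht : t.re = Real.log (vc w) → InWindow l t) :
    AnalyticAt ℂ (gluedBranch w ξ l ρ m₀ σ) t := by
  have hg := fun f : sectors w => isSectorShift_fract hpos hdvd f.2
  rcases lt_trichotomy t.re (Real.log (vc w)) with h | h | h
  · have hU : IsOpen {t : ℂ | t.re < Real.log (vc w)} := isOpen_lt continuous_re continuous_const
    have h1 : DifferentiableOn ℂ (gwBranch w ξ ρ) {t : ℂ | t.re < Real.log (vc w)} :=
      differentiableOn_pi.2 fun f => differentiableOn_jet_gwSum hpos hN hρ (hg f) _
    refine (h1.analyticAt (hU.mem_nhds h)).congr ?_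
    filter_upwards [hU.mem_nhds h] with t ht
    rw [gluedBranch, if_pos ht]
  · have h1 : DifferentiableOn ℂ (mbBranch w ξ l ρ m₀ σ) {t : ℂ | InWindow l t} :=
      differentiableOn_pi.2 fun f => differentiableOn_jet_mbSum hpos hN hρ (hg f) (hσ f) _
    refine (h1.analyticAt ((isOpen_inWindow l).mem_nhds (ht h))).congr ?_
    filter_upwards [(isOpen_inWindow l).mem_nhds (ht h)] with t ht
    exact (gluedBranch_of_inWindow hpos hN hdvd hρ hσ ht).symm
  · have hU : IsOpen {t : ℂ | Real.log (vc w) < t.re} := isOpen_lt continuous_const continuous_re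
    have h1 : DifferentiableOn ℂ (fjrwBranch w ξ l ρ) {t : ℂ | Real.log (vc w) < t.re} :=
      differentiableOn_pi.2 fun f => DifferentiableOn.fun_sum fun i _ =>
        ((differentiableOn_resSum hpos hN ξ i).const_mul _).smul_const _
    refine (h1.analyticAt (hU.mem_nhds h)).congr ?_
    filter_upwards [hU.mem_nhds h] with t ht
    rw [gluedBranch, if_neg (not_lt.2 (le_of_lt ht)), if_pos ht]

theorem isContinuationAlong_gluedBranch {w : Fin N → ℕ} (hpos : ∀ j, 0 < w j) (hN : 0 < N)
    (hdvd : ∀ j, w j ∣ deg w) {z lam : ℂ} {ρ : ℝ} (hρ : IsRadius w (lam / z) ρ) {l : ℤ}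
    {m₀ : sectors w → ℕ} {σ : sectors w → ℝ} (hσ : ∀ (f : sectors w) (p : ℂ), ‖p‖ ≤ ρ →
      IsSeparating w (lam / z) (sectorPoint (Int.fract (1 - (f : ℚ))) p + m₀ f) (σ f)) {a b : ℂ}
    {γ : Path a b} (hγ : IsWindowPath w l γ) :
    IsContinuationAlong γ (hGW w z lam) fun _ t => z • gluedBranch w (lam / z) l ρ m₀ σ t := by
  refine ⟨fun s => ?_, fun s => Eventually.of_forall fun s' => EventuallyEq.rfl, ?_⟩
  · exact (analyticAt_gluedBranch hpos hN hdvd hρ hσ (hγ.window s)).fun_const_smul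
  · filter_upwards [continuous_re.continuousAt.eventually (gt_mem_nhds hγ.source_re)] with t ht
    rw [gluedBranch, if_pos ht, hGW, (hasSum_gwTerm hpos hN hdvd hρ ht).tsum_eq]
    rfl

end LGCY

end

theorem mainTheorem7 {N : ℕ} (w : Fin N → ℕ) (hpos : ∀ j, 0 < w j)
    (hcoprime : Finset.univ.gcd w = 1) (hGorenstein : ∀ j, w j ∣ LGCY.deg w)
    (z lam : ℂ) (hz : z ≠ 0) (hξ : ∀ m : ℤ, lam / z ≠ m)
    (l : ℤ) {a b : ℂ} (γ : Path a b) (hγ : LGCY.IsWindowPath w l γ) :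
    (∀ t : ℂ, t.re < Real.log (LGCY.vc w) → Summable (LGCY.gwTerm w (lam / z) t)) ∧
    (∀ t : ℂ, t.re < -Real.log (LGCY.vc w) / LGCY.deg w →
      Summable (LGCY.fjrwTerm w (lam / z) t)) ∧
    (∃ Φ, LGCY.IsContinuationAlong γ (LGCY.hGW w z lam) Φ) ∧
    ∀ Φ, LGCY.IsContinuationAlong γ (LGCY.hGW w z lam) Φ →
      ∀ᶠ logv in 𝓝 b, ∀ logu : ℂ, logv = -(LGCY.deg w : ℂ) * logu →
        Complex.exp (-(lam / z) * logu) • Φ 1 logv =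
          LGCY.connectionMap w l (lam / z) (LGCY.hFJRW w z lam logu) := by
  have hN : 0 < N := by
    rcases N.eq_zero_or_pos with rfl | h
    · simp at hcoprime
    · exact h
  have hd : (0 : ℝ) < LGCY.deg w := by exact_mod_cast LGCY.deg_pos hpos hN
  obtain ⟨ρ, hρ⟩ := LGCY.exists_isRadius hpos hN hξ
  choose m₀ σ hσ using fun f : LGCY.sectors w =>
    LGCY.exists_isSeparating hpos hN hρ (LGCY.isSectorShift_fract hpos hGorenstein f.2)
  have hcont := LGCY.isContinuationAlong_gluedBranch hpos hN hGorenstein hρ hσ hγ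
  refine ⟨fun t ht => (LGCY.hasSum_gwTerm hpos hN hGorenstein hρ ht).summable, fun t ht => ?_,
    ⟨_, hcont⟩, fun Φ hΦ => ?_⟩
  · refine (LGCY.hasSum_fjrwTerm hpos hN (lam / z) ?_).summable
    rw [lt_div_iff₀ hd] at ht
    have : (-(LGCY.deg w : ℂ) * t).re = -(t.re * LGCY.deg w) := by
      simp [mul_comm]
    linarith
  · have h1 := hΦ.eventuallyEq hcont 1
    rw [γ.target] at h1
    filter_upwards [h1, continuous_re.continuousAt.eventually (lt_mem_nhds hγ.target_re)]
      with logv h2 h3 logu hlog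
    rw [h2, LGCY.gluedBranch, if_neg (not_lt.2 (le_of_lt h3)), if_pos h3,
      LGCY.connectionMap_hFJRW hpos hN hGorenstein (by simpa using hξ 0) hρ l (hlog ▸ h3), hlog]
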